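/- Let $\eta=(\eta_{\alpha\beta})$ be a real symmetric nondegenerate $4\times4$ matrix with inverse $(\eta^{\alpha\beta})$, and consider the WDVV equations $$S_{\alpha\beta\gamma\nu}:=\eta^{\lambda\mu}(F_{\lambda\alpha\beta}F_{\mu\gamma\nu}-F_{\lambda\alpha\nu}F_{\mu\gamma\beta})=0,\qquad F_{1\alpha\beta}=\eta_{\alpha\beta},$$ for a function $F(t^1,\dots,t^4)$, where $F_{\alpha\beta\gamma}=\partial^3F/\partial t^\alpha\partial t^\beta\partial t^\gamma$. Number the pairs $(m,i)=(i,m)$, $2\le i\le m\le4$, by $(2,2),(3,2),(3,3),(4,2),(4,3),(4,4)\mapsto1,\dots,6$, and for $p\in\{2,3,4\}$ put $u_p^{(m,i)}=F_{pim}$, so that $u_p=(u_p^I)\in\mathbb R^6$. Number the pairs $1\le\beta<\nu\le4$ by $\gamma=(\nu,\beta+1)$. Let $\psi^\gamma_{kh}=-\psi^\gamma_{hk}$, ${}_\rho\omega^\gamma_k$ and ${}_{pq}\xi^\gamma$ be the following constants, where $\rho,p,q\in\{2,3,4\}$; all those not listed are zero. For $\gamma=(\nu,2)$, that is $\beta=1$: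 ${}_\rho\omega^\gamma_{(\nu,\rho)}=1$. For $\gamma=(\nu,\beta+1)$ with $\beta\ge2$: $\psi^\gamma_{(\nu,a)(\beta,b)}=\eta^{ab}=-\psi^\gamma_{(\beta,b)(\nu,a)}$ for $2\le a,b\le4$ with $(\nu,a)\ne(\beta,b)$; the ${}_\rho\omega^\gamma_k$ are the coefficients in $\sum_k{}_\rho\omega^\gamma_kv^k=\sum_{a=2}^4\eta^{1a}\big(\eta_{\rho\beta}v^{(\nu,a)}-\eta_{\rho\nu}v^{(\beta,a)}\big)$; and ${}_{pq}\xi^\gamma=-\eta^{11}(\eta_{p\beta}\eta_{q\nu}-\eta_{p\nu}\eta_{q\beta})$. Finally let $\phi_{(A,a)(B,b)}=\eta^{AB}\eta^{(a-1)(b-1)}-\eta^{A(b-1)}\eta^{B(a-1)}$. Fix $p\in\{2,3,4\}$, and for $u\in\mathbb R^6$ put $\psi^\gamma_i(u)=\psi^\gamma_{ik}u^k+{}_p\omega^\gamma_i$. Then: 1. The matrix $\phi$ is invertible, and the matrix $\psi(u)=(\psi^\gamma_i(u))$ is nondegenerate for generic $u$: the set $U=\{u\in\mathbb R^6:\det\psi(u)\ne0\}$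 is open and dense. 2. Let $q\in\{2,3,4\}\setminus\{p\}$. The six WDVV equations $S_{p\beta q\nu}=0$, $\beta<\nu$ (some of them trivial), have the form of a linear line congruence in $u_p,u_q$: for $\gamma=(\nu,\beta+1)$, $$S_{p\beta q\nu}=\tfrac12\psi^\gamma_{km}(u_p^mu_q^k-u_p^ku_q^m)+{}_p\omega^\gamma_ku_q^k-{}_q\omega^\gamma_mu_p^m-{}_{pq}\xi^\gamma .$$ For $u_p\in U$ and arbitrary $u_q\in\mathbb R^6$, the right-hand sides vanish for all $\gamma$ if and only if $u_q^I=V_q^I(u_p):=\psi^I_\gamma(u_p)\,({}_q\omega^\gamma_ku_p^k+{}_{pq}\xi^\gamma)$, where $(\psi^I_\gamma)=(\psi^\gamma_I)^{-1}$. Hence, for every $C^4$ solution $F$ of the WDVV equations on an open set, at each point where $u_p\in U$ one has $u_q=V_q(u_p)$ and $$(u^I_p)_{t^q}=\big(V_q^I(u_p)\big)_{t^p},\qquad I=1,\dots,6 .$$ The two choices of $q$ thus give two systems of conservation laws for $u=u_p\in U$, with space variable $x=t^p$. 3. On $U$ the matrix $f_{ij}=\phi_{\alpha\beta}\psi^\alpha_i\psi^\beta_j$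 is a nondegenerate Monge metric (it is symmetric and invertible and $f_{mk,s}+f_{ks,m}+f_{ms,k}=0$). The third-order operator $A^{ij}=D_x\circ(f^{ij}D_x+c^{ij}_ku^k_x)\circ D_x$ that it defines, where $(f^{ij})=(f_{ij})^{-1}$, $c_{skm}=\frac13(f_{sm,k}-f_{sk,m})$ and $c_{ijk}=f_{iq}f_{jp}c^{pq}_k$, is Hamiltonian: the bracket $\{F,G\}=\int\frac{\delta F}{\delta u^i}A^{ij}\frac{\delta G}{\delta u^j}\,dx$ on local functionals with smooth densities, taken modulo total $x$-derivatives, is skew-symmetric and satisfies the Jacobi identity. Both systems are Hamiltonian with respect to this same operator: each has the form $u^i_t=A^{ij}\frac{\delta H}{\delta u^j}$ with a functional $H=\int h(x,b,b_x,\dots)\,dx$, where $b$ is the potential defined by $b_x=u$ and $D_x\frac{\delta H}{\delta u}=-\frac{\delta H}{\delta b}$. 4. The two systems commute: with $V,W$ the two fluxes, the Jacobi bracket of the generalized vector fields $(V^I)_x\,\partial_{u^I}$ and $(W^I)_x\,\partial_{u^I}$ is zero on the jets of fields with values in $U$. -/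

import Mathlib

open scoped ContDiff

noncomputable section

namespace WDVV

/-! ### Formal variational calculus in one space variable

A point of the infinite jet space of `n` field variables is `z = (x, j)`, where `j k i` is the value of the
`k`-th `x`-derivative of the `i`-th field. -/

/-- Infinite jets of maps from the `x`-line to `ℝⁿ`. -/
abbrev Jet (n : ℕ) : Type := ℝ × (ℕ → Fin n → ℝ)

/-- The jets whose derivative of order `d` lies in `U`. For `d = 0` the field `u` itself takes values in `U`;
for `d = 1` the jet is that of a potential `b`, and `u = b_x` takes values in `U`. -/
def jetDomain {n : ℕ} (d : ℕ) (U : Set (Fin n → ℝ)) : Set (Jet n) := {z | z.2 d ∈ U}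

/-- Smooth differential functions on `jetDomain d U`: smooth functions of `x` and of finitely many derivatives. -/
def IsDiffFun {n : ℕ} (d : ℕ) (U : Set (Fin n → ℝ)) (f : Jet n → ℝ) : Prop :=
  ∃ (m : ℕ) (g : ℝ × (Fin (d + m + 1) → Fin n → ℝ) → ℝ),
    ContDiffOn ℝ ∞ g {q | q.2 ⟨d, by omega⟩ ∈ U} ∧
    ∀ z ∈ jetDomain d U, f z = g (z.1, fun k => z.2 k)

/-- The partial derivative with respect to the jet coordinate `u^i_k`. -/
def pdJet {n : ℕ} (k : ℕ) (i : Fin n) (f : Jet n → ℝ) : Jet n → ℝ := fun z =>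
  deriv (fun s : ℝ => f (z.1, Function.update z.2 k (Function.update (z.2 k) i s))) (z.2 k i)

/-- The total derivative `D_x = ∂_x + ∑ u^i_{k+1} ∂/∂u^i_k`. -/
def totalD {n : ℕ} (f : Jet n → ℝ) : Jet n → ℝ := fun z =>
  deriv (fun s : ℝ => f (s, z.2)) z.1 + ∑ᶠ k : ℕ, ∑ i, z.2 (k + 1) i * pdJet k i f z

/-- The variational (Euler-Lagrange) derivative `∑ (-D_x)^k ∂f/∂u^i_k` of the functional `∫ f dx`. -/
def varD {n : ℕ} (f : Jet n → ℝ) (i : Fin n) : Jet n → ℝ := fun z =>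
  ∑ᶠ k : ℕ, (-1 : ℝ) ^ k * (totalD^[k] (pdJet k i f)) z

/-- The functional `∫ f dx` is zero: `f` is the total derivative of a differential function. -/
def IsNullFunctional {n : ℕ} (U : Set (Fin n → ℝ)) (f : Jet n → ℝ) : Prop :=
  ∃ s : Jet n → ℝ, IsDiffFun 0 U s ∧ ∀ z ∈ jetDomain 0 U, f z = totalD s z

/-- The density `∑ (δF/δu^i) A^{ij} (δG/δu^j)` of the bracket `{F, G}_A`. -/
def bracket {n : ℕ} (A : (Fin n → Jet n → ℝ) → Fin n → Jet n → ℝ) (f g : Jet n → ℝ) : Jet n → ℝ := fun z =>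
  ∑ i, varD f i z * A (varD g) i z

/-- `A` is a Hamiltonian operator on fields with values in `U`: the bracket of functionals
`{F, G}_A = ∫ (δF/δu^i) A^{ij} (δG/δu^j) dx` is skew-symmetric and satisfies the Jacobi identity. -/
def IsHamiltonianOperator {n : ℕ} (U : Set (Fin n → ℝ))
    (A : (Fin n → Jet n → ℝ) → Fin n → Jet n → ℝ) : Prop :=
  (∀ f g : Jet n → ℝ, IsDiffFun 0 U f → IsDiffFun 0 U g →
    IsNullFunctional U (fun z => bracket A f g z + bracket A g f z)) ∧
  (∀ f g h : Jet n → ℝ, IsDiffFun 0 U f → IsDiffFun 0 U g → IsDiffFun 0 U h →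
    IsNullFunctional U (fun z => bracket A (bracket A f g) h z + bracket A (bracket A g h) f z +
      bracket A (bracket A h f) g z))

/-- The evolutionary vector field with characteristic `Q`, applied to `f`: `∑ D_x^k(Q^i) ∂f/∂u^i_k`. -/
def evol {n : ℕ} (Q : Fin n → Jet n → ℝ) (f : Jet n → ℝ) : Jet n → ℝ := fun z =>
  ∑ᶠ k : ℕ, ∑ i, (totalD^[k] (Q i)) z * pdJet k i f z

/-- The right-hand side `D_x (V^i(u))` of the system of conservation laws `u^i_t = (V^i(u))_x`. -/
def conservationLaw {n : ℕ} (V : (Fin n → ℝ) → Fin n → ℝ) (i : Fin n) : Jet n → ℝ :=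
  totalD (fun z => V (z.2 0) i)

/-- The systems `u_t = V(u)_x` and `u_s = W(u)_x` commute: the Jacobi bracket of the generalized vector fields
`(V^i)_x ∂/∂u^i` and `(W^i)_x ∂/∂u^i` vanishes. -/
def SystemsCommute {n : ℕ} (U : Set (Fin n → ℝ)) (V W : (Fin n → ℝ) → Fin n → ℝ) : Prop :=
  ∀ z ∈ jetDomain 0 U, ∀ i,
    evol (conservationLaw V) (conservationLaw W i) z - evol (conservationLaw W) (conservationLaw V i) z = 0

/-! ### Third-order operators in canonical (Doyle-Potëmin) form -/

/-- The partial derivative `f_{sm,k} = ∂f_{sm}/∂u^k` of an entry of a matrix function. -/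
def entryD {n : ℕ} (g : (Fin n → ℝ) → Matrix (Fin n) (Fin n) ℝ) (s m k : Fin n) (u : Fin n → ℝ) : ℝ :=
  fderiv ℝ (fun w => g w s m) u (Pi.single k 1)

/-- `g` is a nondegenerate Monge metric on `U`: symmetric, invertible, and
`f_{mk,s} + f_{ks,m} + f_{ms,k} = 0`. -/
def IsMongeMetric {n : ℕ} (U : Set (Fin n → ℝ)) (g : (Fin n → ℝ) → Matrix (Fin n) (Fin n) ℝ) : Prop :=
  ∀ u ∈ U, (g u).IsSymm ∧ IsUnit (g u).det ∧
    ∀ m k s, entryD g m k s u + entryD g k s m u + entryD g m s k u = 0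

/-- `c_{skm} = (f_{sm,k} - f_{sk,m}) / 3`. -/
def cLow {n : ℕ} (g : (Fin n → ℝ) → Matrix (Fin n) (Fin n) ℝ) (s k m : Fin n) (u : Fin n → ℝ) : ℝ :=
  (1 / 3) * (entryD g s m k u - entryD g s k m u)

/-- `c^{pq}_k`, determined by `c_{ijk} = f_{iq} f_{jp} c^{pq}_k`. -/
def cUp {n : ℕ} (g : (Fin n → ℝ) → Matrix (Fin n) (Fin n) ℝ) (p q k : Fin n) (u : Fin n → ℝ) : ℝ :=
  ∑ i, ∑ j, (g u)⁻¹ p j * (g u)⁻¹ q i * cLow g i j k u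

/-- The first-order factor `f^{ij} D_x + c^{ij}_k u^k_x`, where `u` is the derivative of order `d` of the jet
variable (`d = 0`: the jet variable is `u`; `d = 1`: it is a potential of `u`). -/
def innerOp {n : ℕ} (d : ℕ) (g : (Fin n → ℝ) → Matrix (Fin n) (Fin n) ℝ)
    (P : Fin n → Jet n → ℝ) (i : Fin n) : Jet n → ℝ := fun z =>
  ∑ j, ((g (z.2 d))⁻¹ i j * totalD (P j) z + (∑ k, cUp g i j k (z.2 d) * z.2 (d + 1) k) * P j z)

/-- The third-order operator `A^{ij} = D_x ∘ (f^{ij} D_x + c^{ij}_k u^k_x) ∘ D_x` defined by the metric `g = (f_{ij})`. -/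
def thirdOrderOp {n : ℕ} (g : (Fin n → ℝ) → Matrix (Fin n) (Fin n) ℝ)
    (P : Fin n → Jet n → ℝ) (i : Fin n) : Jet n → ℝ :=
  totalD (innerOp 0 g (fun j => totalD (P j)) i)

/-- The system `u^i_t = (V^i(u))_x` is Hamiltonian with respect to the third-order operator `A` defined by `g`:
`u^i_t = A^{ij} δH/δu^j` for some functional `H`. As usual for these operators, `H = ∫ h(x, b, b_x, …) dx` may be
nonlocal in `u`, where `b` is the potential with `b_x = u`. Then `δH/δb = -D_x (δH/δu)`, so that
`A (δH/δu) = -D_x (f^{ij} D_x + c^{ij}_k u^k_x) (δH/δb^j)`. A functional that is local in `u` is the special case in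
which `h` depends on the derivatives of `b` only. -/
def IsHamiltonianSystem {n : ℕ} (U : Set (Fin n → ℝ)) (g : (Fin n → ℝ) → Matrix (Fin n) (Fin n) ℝ)
    (V : (Fin n → ℝ) → Fin n → ℝ) : Prop :=
  ∃ h : Jet n → ℝ, IsDiffFun 1 U h ∧ ∀ z ∈ jetDomain 1 U, ∀ i,
    totalD (fun y => V (y.2 1) i) z = - totalD (innerOp 1 g (varD h) i) z

/-! ### The WDVV equations for `N = 4`

The indices `1, 2, 3, 4` of `t^1, …, t^4` are the elements `0, 1, 2, 3` of `Fin 4`. -/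

/-- `S_{αβγν} = η^{λμ} (F_{λαβ} F_{μγν} - F_{λαν} F_{μγβ})` for the third derivatives `F_{αβγ} = c α β γ`. -/
def wdvv (η : Matrix (Fin 4) (Fin 4) ℝ) (c : Fin 4 → Fin 4 → Fin 4 → ℝ) (α β γ ν : Fin 4) : ℝ :=
  ∑ l, ∑ m, η⁻¹ l m * (c l α β * c m γ ν - c l α ν * c m γ β)

/-- `∂F/∂t^i`. -/
def pd (i : Fin 4) (F : (Fin 4 → ℝ) → ℝ) : (Fin 4 → ℝ) → ℝ := fun t => fderiv ℝ F t (Pi.single i 1)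

/-- `F_{αβγ}` at the point `t`. -/
def third (F : (Fin 4 → ℝ) → ℝ) (t : Fin 4 → ℝ) (α β γ : Fin 4) : ℝ := pd α (pd β (pd γ F)) t

/-- `F` is a solution of the WDVV equations with metric `η` on the open set `M`. -/
def IsWDVVSolution (η : Matrix (Fin 4) (Fin 4) ℝ) (M : Set (Fin 4 → ℝ)) (F : (Fin 4 → ℝ) → ℝ) : Prop :=
  IsOpen M ∧ ContDiffOn ℝ 4 F M ∧ ∀ t ∈ M,
    (∀ α β, third F t 0 α β = η α β) ∧ ∀ α β γ ν, wdvv η (third F t) α β γ ν = 0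

/-- The index `I = (m, i)`, `2 ≤ i ≤ m ≤ 4`, runs through `(2,2), (3,2), (3,3), (4,2), (4,3), (4,4)`;
this is the larger index `m`. -/
def hi : Fin 6 → Fin 4 := ![1, 2, 2, 3, 3, 3]

/-- The smaller index `i` of `I = (m, i)`. -/
def lo : Fin 6 → Fin 4 := ![1, 1, 2, 1, 2, 3]

/-- An index `γ` of equations is `(ν, β + 1)` with `1 ≤ β < ν ≤ 4`; here `ν = hi γ`, and this is `β`. -/
def bt : Fin 6 → Fin 4 := ![0, 0, 1, 0, 1, 2]

/-- The field variables `u^{(m,i)}_p = F_{pim}`. -/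
def field (c : Fin 4 → Fin 4 → Fin 4 → ℝ) (p : Fin 4) : Fin 6 → ℝ := fun I => c p (lo I) (hi I)

/-- The constants `ψ^γ_{kh}`. -/
def psiC (η : Matrix (Fin 4) (Fin 4) ℝ) : Fin 6 → Matrix (Fin 6) (Fin 6) ℝ :=
  let a22 := η⁻¹ 1 1
  let a23 := η⁻¹ 1 2
  let a24 := η⁻¹ 1 3
  let a33 := η⁻¹ 2 2
  let a34 := η⁻¹ 2 3
  let a44 := η⁻¹ 3 3
  ![0, 0,
    !![0, -a22, -a23, 0, -a24, 0;
       a22, 0, -a33, a24, -a34, 0;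
       a23, a33, 0, a34, 0, 0;
       0, -a24, -a34, 0, -a44, 0;
       a24, a34, 0, a44, 0, 0;
       0, 0, 0, 0, 0, 0],
    0,
    !![0, 0, 0, -a22, -a23, -a24;
       0, 0, 0, -a23, -a33, -a34;
       0, 0, 0, 0, 0, 0;
       a22, a23, 0, 0, -a34, -a44;
       a23, a33, 0, a34, 0, 0;
       a24, a34, 0, a44, 0, 0],
    !![0, 0, 0, 0, 0, 0;
       0, 0, 0, -a22, -a23, -a24;
       0, 0, 0, -a23, -a33, -a34;
       0, a22, a23, 0, a24, 0;
       0, a23, a33, -a24, 0, -a44;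
       0, a24, a34, 0, a44, 0]]

/-- The row `(ν, 2)` of `ω_ρ`: its only nonzero entry is `1` in the column `(ν, ρ) = (ρ, ν)`. -/
def omegaTriv (ρ ν : Fin 4) : Fin 6 → ℝ := fun k =>
  if (hi k = ν ∧ lo k = ρ) ∨ (hi k = ρ ∧ lo k = ν) then 1 else 0

/-- The constants `ω_ρ = (_ρω^γ_k)` (row `γ`, column `k`). -/
def omega (η : Matrix (Fin 4) (Fin 4) ℝ) (ρ : Fin 4) : Matrix (Fin 6) (Fin 6) ℝ :=
  let b2 := η⁻¹ 0 1
  let b3 := η⁻¹ 0 2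
  let b4 := η⁻¹ 0 3
  let e2 := η ρ 1
  let e3 := η ρ 2
  let e4 := η ρ 3
  Matrix.of ![
    omegaTriv ρ 1,
    omegaTriv ρ 2,
    ![-(b2 * e3), b2 * e2 - b3 * e3, b3 * e2, -(b4 * e3), b4 * e2, 0],
    omegaTriv ρ 3,
    ![-(b2 * e4), -(b3 * e4), 0, b2 * e2 - b4 * e4, b3 * e2, b4 * e2],
    ![0, -(b2 * e4), -(b3 * e4), b2 * e3, b3 * e3 - b4 * e4, b4 * e3]]

/-- The constants `_{pq}ξ^γ`. -/
def xi (η : Matrix (Fin 4) (Fin 4) ℝ) (p q : Fin 4) : Fin 6 → ℝ := fun γ =>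
  if bt γ = 0 then 0
  else -(η⁻¹ 0 0) * (η p (bt γ) * η q (hi γ) - η p (hi γ) * η q (bt γ))

/-- The matrix `φ`, `φ_{(A,a)(B,b)} = η^{AB} η^{(a-1)(b-1)} - η^{A(b-1)} η^{B(a-1)}`. -/
def phi (η : Matrix (Fin 4) (Fin 4) ℝ) : Matrix (Fin 6) (Fin 6) ℝ := Matrix.of fun α β =>
  η⁻¹ (hi α) (hi β) * η⁻¹ (bt α) (bt β) - η⁻¹ (hi α) (bt β) * η⁻¹ (hi β) (bt α)

/-- The matrix `ψ^γ_i = ψ^γ_{ik} u^k + _pω^γ_i` (row `γ`, column `i`). -/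
def psi (η : Matrix (Fin 4) (Fin 4) ℝ) (p : Fin 4) (u : Fin 6 → ℝ) : Matrix (Fin 6) (Fin 6) ℝ :=
  Matrix.of fun γ i => ∑ k, psiC η γ i k * u k + omega η p γ i

/-- The set of all `u` at which the matrix `ψ` is invertible. -/
def regularSet (η : Matrix (Fin 4) (Fin 4) ℝ) (p : Fin 4) : Set (Fin 6 → ℝ) := {u | IsUnit (psi η p u).det}

/-- The left-hand side of the equations of the linear line congruence between `u = u_p` and `v = u_q`. -/
def congruence (η : Matrix (Fin 4) (Fin 4) ℝ) (p q : Fin 4) (u v : Fin 6 → ℝ) (γ : Fin 6) : ℝ :=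
  (1 / 2) * (∑ k, ∑ m, psiC η γ k m * (u m * v k - u k * v m)) +
    ∑ k, omega η p γ k * v k - ∑ m, omega η q γ m * u m - xi η p q γ

/-- The flux `ψ^I_γ Z^γ_q`, with `Z^γ_q = _qω^γ_k u^k + _{pq}ξ^γ`. -/
def flux (η : Matrix (Fin 4) (Fin 4) ℝ) (p q : Fin 4) (u : Fin 6 → ℝ) : Fin 6 → ℝ :=
  (psi η p u)⁻¹.mulVec ((omega η q).mulVec u + xi η p q)

/-- The metric `f_{ij} = φ_{αβ} ψ^α_i ψ^β_j`. -/
def monge (η : Matrix (Fin 4) (Fin 4) ℝ) (p : Fin 4) (u : Fin 6 → ℝ) : Matrix (Fin 6) (Fin 6) ℝ :=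
  Matrix.of fun i j => ∑ α, ∑ β, phi η α β * psi η p u α i * psi η p u β j

end WDVV

end

/-! Write E = η⁻¹ and let L_p = (F_{pαβ}), the symmetric matrix whose first row is row p of η and
whose other entries are u_p. The WDVV equations say L_p E L_q = L_q E L_p, that is, the matrices E
L_p commute. Split L_p = B_p + S(u_p) into a part fixed by η and a part linear in u_p. Then ψ(u)x,
ω_q x and -ξ are the entries above the diagonal of A E B - B E A for (A, B) equal to (L_p(u), S(x)),
(B_q, S(x)) and (B_p, B_q) (`psi_mulVec`, `omega_mulVec`, `xi_eq`), and φ is the form -½ tr(A E B E)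
on skew matrices (`phi_form`). Invariance of the trace and the Jacobi identity for matrices give
`phi_comm_form`. Its main consequence is the cyclic identity `phi_cyclic`: φ(ψ(u)x, Ψ(y,z)) has zero
cyclic sum, where Ψ is the bilinear map with coefficients ψ^γ_{ik}.

Regular points: if e₀ is a cyclic vector of E L_p(u), a matrix that commutes with E L_p(u) and kills
e₀ is zero, so ψ(u) is injective (`cyclicSet_subset`). A suitable L_p comes from a basis e₀, e_p,
v₂, v₃ whose Gram matrix is Hankel (`exists_hankel_basis`); a polynomial argument on lines then
gives density.

Hamiltonian operator: the metric is f = ψᵀφψ, and the cyclic identity turns the operator into D ψ⁻¹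
φ⁻¹ D ψ⁻ᵀ D (`cLow_monge`, `innerOp_monge`). Skew-symmetry is integration by parts. In the Jacobi
identity the second variations cancel by formal self-adjointness (`fnl_helmholtz`), and the
remaining terms integrate by parts to the cyclic identity (`fnl_jacobi`). This is carried out in an
abstract differential algebra and then specialised to smooth functions on jets (`diffAlg.jets`).

Hamiltonians: a density is needed whose variational derivative in b is -ψ(u)ᵀφ(ω_q b + xξ). An
explicit polynomial, with constant coefficients fixed by its degrees, does this
(`euler_hamDensity`).

Commutation: the flows commute once the Jacobians of the two fluxes do. At cyclic points this is
linear algebra in the commutant of E L_p (`fluxJac_commute_of_cyclic`); the other regular points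
follow by continuity. -/

noncomputable section
namespace WDVV

variable {n : ℕ}

/-! ### Smooth differential functions and their derivatives -/

/-- The jets of order less than `N`. -/
abbrev TJet (n N : ℕ) : Type := ℝ × (Fin N → Fin n → ℝ)

/-- Truncation of an infinite jet. -/
def trunc (N : ℕ) (z : Jet n) : TJet n N := (z.1, fun k => z.2 k)

/-- The truncated jets whose derivative of order `d` lies in `U`. -/
def truncDomain (d : ℕ) (U : Set (Fin n → ℝ)) (N : ℕ) : Set (TJet n N) :=
  {q | ∃ h : d < N, q.2 ⟨d, h⟩ ∈ U}

/-- The smooth function `g` of truncated jets represents `f` on `jetDomain d U`. -/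
structure Represents (d : ℕ) (U : Set (Fin n → ℝ)) (N : ℕ) (g : TJet n N → ℝ) (f : Jet n → ℝ) : Prop where
  lt : d < N
  contDiffOn : ContDiffOn ℝ ∞ g (truncDomain d U N)
  eq : ∀ z ∈ jetDomain d U, f z = g (trunc N z)

lemma isDiffFun_iff {d : ℕ} {U : Set (Fin n → ℝ)} {f : Jet n → ℝ} :
    IsDiffFun d U f ↔ ∃ N g, Represents d U N g f := by
  constructor
  · rintro ⟨m, g, hg, hf⟩
    refine ⟨d + m + 1, g, by omega, hg.mono ?_, hf⟩
    rintro q ⟨_, h⟩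
    exact h
  · rintro ⟨N, g, hN, hg, hf⟩
    obtain ⟨m, rfl⟩ : ∃ m, N = d + m + 1 := ⟨N - d - 1, by omega⟩
    exact ⟨m, g, hg.mono fun q h => ⟨hN, h⟩, hf⟩

lemma isOpen_truncDomain (d : ℕ) {U : Set (Fin n → ℝ)} (hU : IsOpen U) (N : ℕ) :
    IsOpen (truncDomain d U N) := by
  by_cases h : d < N
  · have : truncDomain d U N = (fun q : TJet n N => q.2 ⟨d, h⟩) ⁻¹' U := by
      ext q; simp [truncDomain, h]
    rw [this]
    exact hU.preimage (by fun_prop)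
  · have : truncDomain d U N = ∅ := by
      ext q; simp [truncDomain, h]
    rw [this]
    exact isOpen_empty

/-- The coordinate direction of `u^i_k` in truncated jets (zero if `k ≥ N`). -/
def dir (N k : ℕ) (i : Fin n) : TJet n N := (0, fun l => if (l : ℕ) = k then Pi.single i 1 else 0)

/-- The jets obtained from `z` by changing the coordinate `u^i_k` to `s`. -/
def moveJet (z : Jet n) (k : ℕ) (i : Fin n) (s : ℝ) : Jet n :=
  (z.1, Function.update z.2 k (Function.update (z.2 k) i s))

lemma trunc_moveJet (N : ℕ) (z : Jet n) (k : ℕ) (i : Fin n) (s : ℝ) :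
    trunc N (moveJet z k i s) = trunc N z + (s - z.2 k i) • dir N k i := by
  refine Prod.ext (by simp [trunc, moveJet, dir]) ?_
  funext l j
  by_cases h : (l : ℕ) = k
  · subst h
    by_cases hj : j = i
    · subst hj; simp [trunc, moveJet, dir]
    · simp [trunc, moveJet, dir, hj]
  · simp [trunc, moveJet, dir, h]

lemma moveJet_self (z : Jet n) (k : ℕ) (i : Fin n) : moveJet z k i (z.2 k i) = z := by
  simp [moveJet]

lemma eventually_moveJet_mem {d : ℕ} {U : Set (Fin n → ℝ)} (hU : IsOpen U) {z : Jet n}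
    (hz : z ∈ jetDomain d U) (k : ℕ) (i : Fin n) :
    ∀ᶠ s in nhds (z.2 k i), moveJet z k i s ∈ jetDomain d U := by
  have hc : Continuous fun s => (moveJet z k i s).2 d := by
    unfold moveJet
    exact (continuous_apply d).comp (by fun_prop)
  refine hc.continuousAt.eventually_mem (hU.mem_nhds ?_)
  rw [moveJet_self]
  exact hz

lemma pdJet_congr {d : ℕ} {U : Set (Fin n → ℝ)} (hU : IsOpen U) {f g : Jet n → ℝ}
    (h : ∀ z ∈ jetDomain d U, f z = g z) (k : ℕ) (i : Fin n) :
    ∀ z ∈ jetDomain d U, pdJet k i f z = pdJet k i g z := by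
  intro z hz
  refine Filter.EventuallyEq.deriv_eq ?_
  filter_upwards [eventually_moveJet_mem hU hz k i] with s hs using h _ hs

lemma totalD_congr {d : ℕ} {U : Set (Fin n → ℝ)} (hU : IsOpen U) {f g : Jet n → ℝ}
    (h : ∀ z ∈ jetDomain d U, f z = g z) : ∀ z ∈ jetDomain d U, totalD f z = totalD g z := by
  intro z hz
  -- The domain restricts only the derivative of order `d`, so moving `x` never leaves it.
  have h1 : (fun s : ℝ => f (s, z.2)) = fun s => g (s, z.2) := funext fun s => h _ hz
  simp only [totalD, h1, fun k i => pdJet_congr hU h k i z hz]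

lemma trunc_mem {d : ℕ} {U : Set (Fin n → ℝ)} {N : ℕ} (hN : d < N) {z : Jet n}
    (hz : z ∈ jetDomain d U) : trunc N z ∈ truncDomain d U N := ⟨hN, hz⟩

namespace Represents

variable {d N : ℕ} {U : Set (Fin n → ℝ)} {g : TJet n N → ℝ} {f : Jet n → ℝ}

lemma contDiffAt (h : Represents d U N g f) (hU : IsOpen U) {z : Jet n} (hz : z ∈ jetDomain d U) :
    ContDiffAt ℝ ∞ g (trunc N z) :=
  h.contDiffOn.contDiffAt ((isOpen_truncDomain d hU N).mem_nhds (trunc_mem h.lt hz))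

lemma differentiableAt (h : Represents d U N g f) (hU : IsOpen U) {z : Jet n} (hz : z ∈ jetDomain d U) :
    DifferentiableAt ℝ g (trunc N z) := (h.contDiffAt hU hz).differentiableAt (by simp)

lemma pdJet_eq (h : Represents d U N g f) (hU : IsOpen U) {z : Jet n} (hz : z ∈ jetDomain d U)
    (k : ℕ) (i : Fin n) : pdJet k i f z = fderiv ℝ g (trunc N z) (dir N k i) := by
  have h1 : (fun s => f (moveJet z k i s)) =ᶠ[nhds (z.2 k i)]
      fun s => g (trunc N z + (s - z.2 k i) • dir N k i) := by
    filter_upwards [eventually_moveJet_mem hU hz k i] with s hs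
    rw [h.eq _ hs, trunc_moveJet]
  have h2 : HasDerivAt (fun s : ℝ => trunc N z + (s - z.2 k i) • dir N k i) (dir N k i) (z.2 k i) := by
    simpa using (((hasDerivAt_id (z.2 k i)).sub_const (z.2 k i)).smul_const (dir N k i)).const_add (trunc N z)
  have h3 : HasFDerivAt g (fderiv ℝ g (trunc N z)) (trunc N z + (z.2 k i - z.2 k i) • dir N k i) := by
    simpa using (h.differentiableAt hU hz).hasFDerivAt
  have h4 := h3.comp_hasDerivAt (z.2 k i) h2
  exact h1.deriv_eq.trans h4.deriv

/-- By the chain rule, `D_x` is the directional derivative of the representative along the prolonged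
direction (1, u₁, u₂, …). -/
lemma totalD_eq (h : Represents d U N g f) (hU : IsOpen U) {z : Jet n} (hz : z ∈ jetDomain d U) :
    totalD f z = fderiv ℝ g (trunc N z) (1, fun k => z.2 (k + 1)) := by
  have h1 : deriv (fun s : ℝ => f (s, z.2)) z.1 = fderiv ℝ g (trunc N z) (1, 0) := by
    have e : (fun s : ℝ => f (s, z.2)) = fun s => g (s, fun k => z.2 k) :=
      funext fun s => h.eq (s, z.2) hz
    have h2 : HasDerivAt (fun s : ℝ => ((s, fun k => z.2 k) : TJet n N)) (1, 0) z.1 :=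
      (hasDerivAt_id z.1).prodMk (hasDerivAt_const z.1 _)
    have h3 := (h.differentiableAt hU hz).hasFDerivAt
    rw [e]
    exact (HasFDerivAt.comp_hasDerivAt (f := fun s : ℝ => ((s, fun k => z.2 k) : TJet n N)) z.1 h3 h2).deriv
  have h2 : ((1, fun k => z.2 (k + 1)) : TJet n N) =
      (1, 0) + ∑ k ∈ Finset.range N, ∑ i, z.2 (k + 1) i • dir N k i := by
    refine Prod.ext (by simp [dir, Prod.fst_sum]) ?_
    funext l j
    simp only [Prod.snd_add, Prod.snd_sum, Prod.smul_snd, dir, Pi.add_apply, Pi.zero_apply, zero_add,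
      Finset.sum_apply, Pi.smul_apply, smul_eq_mul]
    rw [Finset.sum_eq_single (l : ℕ)]
    · simp [Pi.single_apply]
    · intro k _ hk
      simp [Ne.symm hk]
    · intro hl
      simp at hl
  rw [totalD, h1, h2, map_add, map_sum]
  congr 1
  rw [finsum_eq_sum_of_support_subset (s := Finset.range N)]
  · refine Finset.sum_congr rfl fun k _ => ?_
    rw [map_sum]
    refine Finset.sum_congr rfl fun i _ => ?_
    rw [map_smul, h.pdJet_eq hU hz, smul_eq_mul]
  · intro k hk
    by_contra hkN
    refine hk (Finset.sum_eq_zero fun i _ => ?_)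
    have : dir N k i = 0 := by
      refine Prod.ext rfl ?_
      funext l
      have : (l : ℕ) ≠ k := by
        have := l.2
        simp at hkN
        omega
      simp [dir, this]
    rw [h.pdJet_eq hU hz, this, map_zero, mul_zero]

lemma pdJet_eq_zero (h : Represents d U N g f) (hU : IsOpen U) {z : Jet n} (hz : z ∈ jetDomain d U)
    {k : ℕ} (hk : N ≤ k) (i : Fin n) : pdJet k i f z = 0 := by
  have : dir N k i = 0 := by
    refine Prod.ext rfl ?_
    funext l
    have : (l : ℕ) ≠ k := by
      have := l.2
      omega
    simp [dir, this]
  rw [h.pdJet_eq hU hz, this, map_zero]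

lemma contDiffOn_fderiv (h : Represents d U N g f) (hU : IsOpen U) :
    ContDiffOn ℝ ∞ (fderiv ℝ g) (truncDomain d U N) :=
  h.contDiffOn.fderiv_of_isOpen (isOpen_truncDomain d hU N) (by simp)

lemma pdJet (h : Represents d U N g f) (hU : IsOpen U) (k : ℕ) (i : Fin n) :
    Represents d U N (fun q => fderiv ℝ g q (dir N k i)) (pdJet k i f) :=
  ⟨h.lt, (h.contDiffOn_fderiv hU).clm_apply contDiffOn_const, fun _ hz => h.pdJet_eq hU hz k i⟩

lemma mono (h : Represents d U N g f) {N' : ℕ} (hN : N ≤ N') :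
    Represents d U N' (fun q => g (q.1, fun k => q.2 (k.castLE hN))) f := by
  refine ⟨h.lt.trans_le hN, h.contDiffOn.comp (ContDiff.contDiffOn (by fun_prop)) ?_, fun z hz => h.eq z hz⟩
  rintro q ⟨_, hq⟩
  exact ⟨h.lt, hq⟩

/-- Two truncations of jets of order `N + 1`. -/
def shiftMap (n N : ℕ) : TJet n (N + 1) →L[ℝ] TJet n N :=
  (0 : TJet n (N + 1) →L[ℝ] ℝ).prod
    (ContinuousLinearMap.pi fun k => (ContinuousLinearMap.proj k.succ).comp (ContinuousLinearMap.snd ℝ ℝ _))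

/-- Forgetting the highest derivative. -/
def dropMap (n N : ℕ) : TJet n (N + 1) →L[ℝ] TJet n N :=
  (ContinuousLinearMap.fst ℝ ℝ _).prod
    (ContinuousLinearMap.pi fun k => (ContinuousLinearMap.proj k.castSucc).comp (ContinuousLinearMap.snd ℝ ℝ _))

lemma dropMap_trunc (z : Jet n) : dropMap n N (trunc (N + 1) z) = trunc N z := rfl

lemma shiftMap_trunc (z : Jet n) :
    ((1, 0) : TJet n N) + shiftMap n N (trunc (N + 1) z) =
      ((1, fun k => z.2 (k + 1)) : TJet n N) := by
  refine Prod.ext (by simp [shiftMap]) ?_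
  funext k
  simp [shiftMap, trunc]

lemma totalD (h : Represents d U N g f) (hU : IsOpen U) :
    Represents d U (N + 1) (fun q => fderiv ℝ g (dropMap n N q) ((1, 0) + shiftMap n N q)) (totalD f) := by
  refine ⟨h.lt.trans (Nat.lt_succ_self N), ContDiffOn.clm_apply ?_ ?_, fun z hz => ?_⟩
  · refine (h.contDiffOn_fderiv hU).comp (dropMap n N).contDiff.contDiffOn ?_
    rintro q ⟨_, hq⟩
    exact ⟨h.lt, hq⟩
  · exact (contDiff_const.add (shiftMap n N).contDiff).contDiffOn
  · rw [h.totalD_eq hU hz, dropMap_trunc, shiftMap_trunc]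

lemma dropMap_dir (k : ℕ) (i : Fin n) : dropMap n N (dir (N + 1) k i) = dir N k i := rfl

lemma shiftMap_dir_zero (i : Fin n) : shiftMap n N (dir (N + 1) 0 i) = 0 := by
  refine Prod.ext rfl ?_
  funext k
  simp [shiftMap, dir]

lemma shiftMap_dir_succ (k : ℕ) (i : Fin n) : shiftMap n N (dir (N + 1) (k + 1) i) = dir N k i := by
  refine Prod.ext rfl ?_
  funext l
  simp [shiftMap, dir]

lemma isSymm (h : Represents d U N g f) (hU : IsOpen U) {z : Jet n} (hz : z ∈ jetDomain d U)
    (v w : TJet n N) :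
    fderiv ℝ (fderiv ℝ g) (trunc N z) v w = fderiv ℝ (fderiv ℝ g) (trunc N z) w v :=
  ((h.contDiffAt hU hz).isSymmSndFDerivAt (by
    rw [minSmoothness_of_isRCLikeNormedField]
    exact WithTop.coe_le_coe.2 (le_top : (2 : ℕ∞) ≤ ⊤))) v w

lemma differentiableAt_fderiv (h : Represents d U N g f) (hU : IsOpen U) {z : Jet n} (hz : z ∈ jetDomain d U) :
    DifferentiableAt ℝ (fderiv ℝ g) (trunc N z) :=
  (((h.contDiffOn_fderiv hU).contDiffAt ((isOpen_truncDomain d hU N).mem_nhds (trunc_mem h.lt hz)))).differentiableAt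
    (by simp)

lemma fderiv_fderiv_apply (h : Represents d U N g f) (hU : IsOpen U) {z : Jet n} (hz : z ∈ jetDomain d U)
    (v w : TJet n N) :
    fderiv ℝ (fun q => fderiv ℝ g q v) (trunc N z) w = fderiv ℝ (fderiv ℝ g) (trunc N z) w v := by
  rw [fderiv_clm_apply (h.differentiableAt_fderiv hU hz) (by fun_prop)]
  simp

lemma pdJet_comm (h : Represents d U N g f) (hU : IsOpen U) {z : Jet n} (hz : z ∈ jetDomain d U)
    (k l : ℕ) (i j : Fin n) : WDVV.pdJet k i (WDVV.pdJet l j f) z = WDVV.pdJet l j (WDVV.pdJet k i f) z := by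
  rw [(h.pdJet hU l j).pdJet_eq hU hz, (h.pdJet hU k i).pdJet_eq hU hz, h.fderiv_fderiv_apply hU hz,
    h.fderiv_fderiv_apply hU hz, h.isSymm hU hz]

/-- This is the source of the commutation rule [∂/∂u_k, D] = ∂/∂u_{k-1}: the direction of
differentiation in `D_x` itself depends on the jet, and differentiating it produces the shifted
coordinate direction. The other term needs only the symmetry of second derivatives. -/
lemma pdJet_totalD (h : Represents d U N g f) (hU : IsOpen U) {z : Jet n} (hz : z ∈ jetDomain d U)
    (k : ℕ) (i : Fin n) : WDVV.pdJet k i (WDVV.totalD f) z = WDVV.totalD (WDVV.pdJet k i f) z +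
      fderiv ℝ g (trunc N z) (shiftMap n N (dir (N + 1) k i)) := by
  rw [(h.totalD hU).pdJet_eq hU hz, (h.pdJet hU k i).totalD_eq hU hz, h.fderiv_fderiv_apply hU hz]
  have h1 : HasFDerivAt (fun q => fderiv ℝ g (dropMap n N q))
      ((fderiv ℝ (fderiv ℝ g) (trunc N z)).comp (dropMap n N)) (trunc (N + 1) z) :=
    HasFDerivAt.comp (g := fderiv ℝ g) (trunc (N + 1) z) (h.differentiableAt_fderiv hU hz).hasFDerivAt
      (dropMap n N).hasFDerivAt
  have h2 : HasFDerivAt (fun q => ((1, 0) : TJet n N) + shiftMap n N q) (shiftMap n N) (trunc (N + 1) z) :=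
    (shiftMap n N).hasFDerivAt.const_add _
  rw [(h1.clm_apply h2).fderiv]
  simp only [add_apply, ContinuousLinearMap.comp_apply, ContinuousLinearMap.flip_apply,
    dropMap_dir, shiftMap_trunc, dropMap_trunc]
  rw [h.isSymm hU hz, add_comm]

end Represents

/-! ### Closure properties of smooth differential functions. -/

lemma IsDiffFun.pdJet {d : ℕ} {U : Set (Fin n → ℝ)} {f : Jet n → ℝ} (h : IsDiffFun d U f) (hU : IsOpen U)
    (k : ℕ) (i : Fin n) : IsDiffFun d U (pdJet k i f) := by
  obtain ⟨N, g, hg⟩ := isDiffFun_iff.1 h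
  exact isDiffFun_iff.2 ⟨N, _, hg.pdJet hU k i⟩

lemma IsDiffFun.totalD {d : ℕ} {U : Set (Fin n → ℝ)} {f : Jet n → ℝ} (h : IsDiffFun d U f) (hU : IsOpen U) :
    IsDiffFun d U (totalD f) := by
  obtain ⟨N, g, hg⟩ := isDiffFun_iff.1 h
  exact isDiffFun_iff.2 ⟨N + 1, _, hg.totalD hU⟩

lemma IsDiffFun.congr {d : ℕ} {U : Set (Fin n → ℝ)} {f g : Jet n → ℝ} (h : IsDiffFun d U f)
    (hfg : ∀ z ∈ jetDomain d U, g z = f z) : IsDiffFun d U g := by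
  obtain ⟨m, G, hG, hf⟩ := h
  exact ⟨m, G, hG, fun z hz => (hfg z hz).trans (hf z hz)⟩

/-- Two differential functions are represented on the same jets. -/
lemma exists_represents₂ {d : ℕ} {U : Set (Fin n → ℝ)} {f₁ f₂ : Jet n → ℝ} (h₁ : IsDiffFun d U f₁)
    (h₂ : IsDiffFun d U f₂) : ∃ N g₁ g₂, Represents d U N g₁ f₁ ∧ Represents d U N g₂ f₂ := by
  obtain ⟨N₁, g₁, hg₁⟩ := isDiffFun_iff.1 h₁
  obtain ⟨N₂, g₂, hg₂⟩ := isDiffFun_iff.1 h₂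
  exact ⟨max N₁ N₂, _, _, hg₁.mono (le_max_left _ _), hg₂.mono (le_max_right _ _)⟩

namespace Represents

variable {d N : ℕ} {U : Set (Fin n → ℝ)} {g₁ g₂ : TJet n N → ℝ} {f₁ f₂ : Jet n → ℝ}

lemma add (h₁ : Represents d U N g₁ f₁) (h₂ : Represents d U N g₂ f₂) :
    Represents d U N (fun q => g₁ q + g₂ q) (fun z => f₁ z + f₂ z) :=
  ⟨h₁.lt, h₁.contDiffOn.add h₂.contDiffOn, fun z hz => by rw [h₁.eq z hz, h₂.eq z hz]⟩

lemma mul (h₁ : Represents d U N g₁ f₁) (h₂ : Represents d U N g₂ f₂) :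
    Represents d U N (fun q => g₁ q * g₂ q) (fun z => f₁ z * f₂ z) :=
  ⟨h₁.lt, h₁.contDiffOn.mul h₂.contDiffOn, fun z hz => by rw [h₁.eq z hz, h₂.eq z hz]⟩

end Represents

lemma IsDiffFun.of_smooth {d : ℕ} (U : Set (Fin n → ℝ)) {N : ℕ} (hN : d < N) {g : TJet n N → ℝ}
    (hg : ContDiff ℝ ∞ g) {f : Jet n → ℝ} (hf : ∀ z, f z = g (trunc N z)) : IsDiffFun d U f :=
  isDiffFun_iff.2 ⟨N, g, hN, hg.contDiffOn, fun z _ => hf z⟩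

lemma isDiffFun_const (d : ℕ) (U : Set (Fin n → ℝ)) (c : ℝ) : IsDiffFun d U fun _ => c :=
  .of_smooth U (Nat.lt_succ_self d) (contDiff_const (c := c)) fun _ => rfl

lemma isDiffFun_fst (d : ℕ) (U : Set (Fin n → ℝ)) : IsDiffFun d U fun z => z.1 :=
  .of_smooth U (Nat.lt_succ_self d) contDiff_fst fun _ => rfl

lemma isDiffFun_coord (d : ℕ) (U : Set (Fin n → ℝ)) (k : ℕ) (i : Fin n) :
    IsDiffFun d U fun z => z.2 k i :=
  .of_smooth U (N := d + k + 1) (by omega) (g := fun q => q.2 ⟨k, by omega⟩ i) (by fun_prop) fun _ => rfl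

lemma IsDiffFun.inv {d : ℕ} {U : Set (Fin n → ℝ)} {f : Jet n → ℝ} (h : IsDiffFun d U f)
    (h0 : ∀ z ∈ jetDomain d U, f z ≠ 0) : IsDiffFun d U fun z => (f z)⁻¹ := by
  obtain ⟨N, g, hg⟩ := isDiffFun_iff.1 h
  refine isDiffFun_iff.2 ⟨N, fun q => (g q)⁻¹, hg.lt, hg.contDiffOn.inv ?_, fun z hz => by rw [hg.eq z hz]⟩
  rintro ⟨x, q⟩ ⟨hN, hq⟩
  -- The nonvanishing hypothesis concerns infinite jets; extending a truncated jet by zeros makes it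
  -- available for the representative.
  let z : Jet n := (x, fun k => if h : k < N then q ⟨k, h⟩ else 0)
  have hz : z ∈ jetDomain d U := by simpa [z, jetDomain, hN] using hq
  have e : trunc N z = (x, q) := by
    refine Prod.ext rfl ?_
    funext k
    simp [trunc, z]
  rw [← e, ← hg.eq z hz]
  exact h0 z hz

end WDVV
end

noncomputable section
namespace WDVV

/-! ### Algebraic variational calculus -/

/-- A differential algebra with a total derivative `D` and partial derivatives `pd k i` with respect to
the jet variables `u^i_k`. -/
structure JetCalculus (ι R : Type*) [CommRing R] [Algebra ℝ R] where
  D : Derivation ℝ R R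
  pd : ℕ → ι → Derivation ℝ R R
  pd_comm : ∀ k l i j f, pd k i (pd l j f) = pd l j (pd k i f)
  pd_zero_D : ∀ i f, pd 0 i (D f) = D (pd 0 i f)
  pd_succ_D : ∀ k i f, pd (k + 1) i (D f) = D (pd (k + 1) i f) + pd k i f
  exists_order : ∀ f, ∃ N, ∀ k, N ≤ k → ∀ i, pd k i f = 0

namespace JetCalculus

open Finset

variable {ι R : Type*} [CommRing R] [Algebra ℝ R] (J : JetCalculus ι R)

/-- Total derivatives. -/
def exact : Submodule ℝ R := LinearMap.range J.D.toLinearMap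

/-- The functional with density `f`. -/
def fnl : R →ₗ[ℝ] R ⧸ J.exact := J.exact.mkQ

lemma fnl_D (f : R) : J.fnl (J.D f) = 0 :=
  (Submodule.Quotient.mk_eq_zero _).2 ⟨f, rfl⟩

lemma fnl_eq_zero {f : R} : J.fnl f = 0 ↔ ∃ s, J.D s = f :=
  (Submodule.Quotient.mk_eq_zero _).trans Iff.rfl

/-- Integration by parts modulo total derivatives. -/
lemma fnl_mul_D (f g : R) : J.fnl (f * J.D g) = -J.fnl (J.D f * g) := by
  have h := J.fnl_D (f * g)
  rw [J.D.leibniz, smul_eq_mul, smul_eq_mul, map_add, mul_comm g] at h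
  exact eq_neg_of_add_eq_zero_left h

lemma fnl_mul_D_iterate (k : ℕ) (f g : R) :
    J.fnl (f * J.D^[k] g) = J.fnl ((-1) ^ k * J.D^[k] f * g) := by
  induction k generalizing f g with
  | zero => simp
  | succ k ih =>
    rw [Function.iterate_succ_apply, ih, fnl_mul_D, ← map_neg, Function.iterate_succ_apply']
    congr 1
    have : J.D ((-1) ^ k * J.D^[k] f) = (-1) ^ k * J.D (J.D^[k] f) := by
      rcases neg_one_pow_eq_or R k with h | h <;> simp [h]
    rw [this, pow_succ]
    ring

/-- The variational derivative. -/
def euler (f : R) (i : ι) : R := ∑ᶠ k : ℕ, (-1) ^ k * J.D^[k] (J.pd k i f)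

lemma euler_eq_sum {f : R} {N : ℕ} (hN : ∀ k, N ≤ k → ∀ i, J.pd k i f = 0) (i : ι) :
    J.euler f i = ∑ k ∈ range N, (-1) ^ k * J.D^[k] (J.pd k i f) := by
  refine finsum_eq_sum_of_support_subset _ fun k hk => ?_
  by_contra h
  refine hk ?_
  dsimp only
  rw [hN k (by simpa using h) i, iterate_map_zero, mul_zero]

lemma exists_order₂ (f g : R) : ∃ N, (∀ k, N ≤ k → ∀ i, J.pd k i f = 0) ∧ ∀ k, N ≤ k → ∀ i, J.pd k i g = 0 := by
  obtain ⟨N, hN⟩ := J.exists_order f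
  obtain ⟨M, hM⟩ := J.exists_order g
  exact ⟨max N M, fun k hk => hN k (le_trans (le_max_left _ _) hk),
    fun k hk => hM k (le_trans (le_max_right _ _) hk)⟩

variable [Fintype ι]

/-- The evolutionary vector field with characteristic `X`. -/
def evol (X : ι → R) (f : R) : R := ∑ᶠ k : ℕ, ∑ i, J.D^[k] (X i) * J.pd k i f

lemma evol_eq_sum (X : ι → R) {f : R} {N : ℕ} (hN : ∀ k, N ≤ k → ∀ i, J.pd k i f = 0) :
    J.evol X f = ∑ k ∈ range N, ∑ i, J.D^[k] (X i) * J.pd k i f := by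
  refine finsum_eq_sum_of_support_subset _ fun k hk => ?_
  by_contra h
  refine hk (sum_eq_zero fun i _ => ?_)
  rw [hN k (by simpa using h) i, mul_zero]

lemma evol_add (X : ι → R) (f g : R) : J.evol X (f + g) = J.evol X f + J.evol X g := by
  obtain ⟨N, hf, hg⟩ := J.exists_order₂ f g
  rw [J.evol_eq_sum X hf, J.evol_eq_sum X hg, J.evol_eq_sum X (N := N)]
  · simp only [map_add, mul_add, sum_add_distrib]
  · intro k hk i
    rw [map_add, hf k hk, hg k hk, add_zero]

lemma evol_mul (X : ι → R) (f g : R) : J.evol X (f * g) = f * J.evol X g + g * J.evol X f := by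
  obtain ⟨N, hf, hg⟩ := J.exists_order₂ f g
  rw [J.evol_eq_sum X hf, J.evol_eq_sum X hg, J.evol_eq_sum X (N := N)]
  · simp only [Derivation.leibniz, smul_eq_mul, mul_sum, ← sum_add_distrib]
    refine sum_congr rfl fun k _ => sum_congr rfl fun i _ => ?_
    ring
  · intro k hk i
    rw [Derivation.leibniz, hf k hk, hg k hk, smul_zero, smul_zero, add_zero]

lemma evol_algebraMap (X : ι → R) (c : ℝ) : J.evol X (algebraMap ℝ R c) = 0 := by
  rw [J.evol_eq_sum X (N := 0) fun k _ i => by simp]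
  simp

/-- Evolutionary vector fields are derivations. -/
def evolD (X : ι → R) : Derivation ℝ R R :=
  Derivation.mk' { toFun := J.evol X
                   map_add' := J.evol_add X
                   map_smul' := fun c f => by
                    rw [Algebra.smul_def, evol_mul, evol_algebraMap, mul_zero, add_zero, RingHom.id_apply,
                      Algebra.smul_def] }
    fun f g => by simp [evol_mul]

lemma evolD_eq_sum (X : ι → R) {f : R} {N : ℕ} (hN : ∀ k, N ≤ k → ∀ i, J.pd k i f = 0) :
    J.evolD X f = ∑ k ∈ range N, ∑ i, J.D^[k] (X i) * J.pd k i f := J.evol_eq_sum X hN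

/-- The terms [∂/∂u_{k+1}, D] = ∂/∂u_k are exactly those in which D falls on the coefficients D^k X.
The sum for `D f` runs one order higher, and its extra term is harmless because `f` does not depend
on u_N. -/
lemma evolD_D (X : ι → R) (f : R) : J.evolD X (J.D f) = J.D (J.evolD X f) := by
  obtain ⟨N, hf, hg⟩ := J.exists_order₂ f (J.D f)
  rw [J.evolD_eq_sum X hf, J.evolD_eq_sum X (f := J.D f) (N := N + 1) fun k hk => hg k (by omega)]
  have e : ∀ i, J.pd N i f = 0 := hf N le_rfl
  rw [sum_range_succ', map_sum]
  simp only [J.pd_zero_D, J.pd_succ_D, map_sum, Derivation.leibniz, smul_eq_mul, mul_add, sum_add_distrib,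
    ← Function.iterate_succ_apply' (⇑J.D)]
  have h1 : ∑ k ∈ range N, ∑ i, J.D^[k + 1] (X i) * J.D (J.pd (k + 1) i f) +
      ∑ i, J.D^[0] (X i) * J.D (J.pd 0 i f) = ∑ k ∈ range N, ∑ i, J.D^[k] (X i) * J.D (J.pd k i f) := by
    rw [← sum_range_succ' (fun k => ∑ i, J.D^[k] (X i) * J.D (J.pd k i f)), sum_range_succ]
    simp [e]
  rw [add_right_comm, h1]
  congr 1
  refine sum_congr rfl fun k _ => sum_congr rfl fun i _ => mul_comm _ _

lemma evolD_D_iterate (X : ι → R) (k : ℕ) (f : R) : J.evolD X (J.D^[k] f) = J.D^[k] (J.evolD X f) := by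
  induction k with
  | zero => rfl
  | succ k ih => rw [Function.iterate_succ_apply', Function.iterate_succ_apply', evolD_D, ih]

/-- `∫ δf/δu · X = ∫ X(f)`. -/
lemma fnl_euler (X : ι → R) (f : R) : J.fnl (∑ i, J.euler f i * X i) = J.fnl (J.evolD X f) := by
  obtain ⟨N, hf⟩ := J.exists_order f
  simp only [J.euler_eq_sum hf, J.evolD_eq_sum X hf, map_sum, sum_mul]
  rw [sum_comm]
  refine sum_congr rfl fun k _ => sum_congr rfl fun i _ => ?_
  rw [mul_comm (J.D^[k] (X i)), fnl_mul_D_iterate]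

lemma fnl_evolD_congr (X : ι → R) {f g : R} (h : J.fnl f = J.fnl g) :
    J.fnl (J.evolD X f) = J.fnl (J.evolD X g) := by
  rw [← sub_eq_zero, ← map_sub, fnl_eq_zero] at h
  obtain ⟨s, hs⟩ := h
  rw [← sub_eq_zero, ← map_sub, ← map_sub, ← hs, evolD_D, fnl_D]

/-- The second-order part is symmetric in the two fields because partial derivatives commute, so
only derivatives of the characteristics survive. -/
lemma evolD_commutator (X Y : ι → R) (f : R) :
    J.evolD Y (J.evolD X f) - J.evolD X (J.evolD Y f) =
      J.evolD (fun i => J.evolD Y (X i) - J.evolD X (Y i)) f := by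
  obtain ⟨N, hf⟩ := J.exists_order f
  have key : ∀ X Y : ι → R, J.evolD Y (J.evolD X f) =
      ∑ k ∈ range N, ∑ i, J.D^[k] (J.evolD Y (X i)) * J.pd k i f +
      ∑ k ∈ range N, ∑ i, ∑ l ∈ range N, ∑ j, J.D^[k] (X i) * J.D^[l] (Y j) * J.pd l j (J.pd k i f) := by
    intro X Y
    have h2 : ∀ k i l, N ≤ l → ∀ j, J.pd l j (J.pd k i f) = 0 := by
      intro k i l hl j
      rw [J.pd_comm, hf l hl, map_zero]
    simp only [J.evolD_eq_sum X hf, map_sum, Derivation.leibniz, smul_eq_mul, evolD_D_iterate,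
      J.evolD_eq_sum Y (h2 _ _), sum_add_distrib, mul_sum]
    rw [add_comm]
    refine congrArg₂ _ ?_ ?_
    · exact sum_congr rfl fun k _ => sum_congr rfl fun i _ => mul_comm _ _
    · refine sum_congr rfl fun k _ => sum_congr rfl fun i _ => sum_congr rfl fun l _ =>
        sum_congr rfl fun j _ => ?_
      ring
  have hsymm : ∑ k ∈ range N, ∑ i, ∑ l ∈ range N, ∑ j, J.D^[k] (X i) * J.D^[l] (Y j) * J.pd l j (J.pd k i f) =
      ∑ k ∈ range N, ∑ i, ∑ l ∈ range N, ∑ j, J.D^[k] (Y i) * J.D^[l] (X j) * J.pd l j (J.pd k i f) := by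
    simp only [← sum_product' (s := range N) (t := (univ : Finset ι))]
    rw [sum_comm]
    refine sum_congr rfl fun a _ => sum_congr rfl fun b _ => ?_
    rw [J.pd_comm]
    ring
  rw [key, key, hsymm, J.evolD_eq_sum _ hf, add_sub_add_right_eq_sub, ← sum_sub_distrib]
  refine sum_congr rfl fun k _ => ?_
  rw [← sum_sub_distrib]
  refine sum_congr rfl fun i _ => ?_
  rw [iterate_map_sub]
  ring

/-- The linearization of a variational derivative is formally self-adjoint. -/
lemma fnl_helmholtz (X Y : ι → R) (f : R) :
    J.fnl (∑ i, J.evolD Y (J.euler f i) * X i) = J.fnl (∑ i, J.evolD X (J.euler f i) * Y i) := by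
  -- Vary the first-variation formula for X along Y and the one for Y along X. The difference of the
  -- right-hand sides is the first variation along the commutator, which accounts for all
  -- derivatives of X and Y.
  have h1 := J.fnl_evolD_congr Y (J.fnl_euler X f)
  have h2 := J.fnl_evolD_congr X (J.fnl_euler Y f)
  have h3 := J.fnl_euler (fun i => J.evolD Y (X i) - J.evolD X (Y i)) f
  rw [← evolD_commutator, map_sub, ← h1, ← h2] at h3
  simp only [map_sum, Derivation.leibniz, smul_eq_mul, mul_sub, map_sub, map_add, sum_add_distrib,
    sum_sub_distrib] at h3
  simp only [map_sum, mul_comm (J.evolD _ (J.euler f _))]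
  have h4 : ∀ a b c d : R ⧸ J.exact, a - b = a + c - (b + d) → c = d := by
    intro a b c d h
    have : c - d = 0 := by
      rw [add_sub_add_comm] at h
      simpa using h
    exact sub_eq_zero.1 this
  exact h4 _ _ _ _ h3

end JetCalculus
end WDVV
end

noncomputable section
namespace WDVV

/-! ### Operators of the form `D ψ⁻¹ φ⁻¹ D ψ⁻ᵀ D` -/

section MatrixDerivations

open Matrix

variable {R ι κ : Type*} [CommRing R] [Algebra ℝ R] (δ : Derivation ℝ R R)

lemma derivation_map_algebraMap (M : Matrix κ ι ℝ) : (M.map (algebraMap ℝ R)).map δ = 0 := by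
  ext i j
  simp

variable [Fintype ι]

lemma derivation_dotProduct (a b : ι → R) : δ (a ⬝ᵥ b) = (δ ∘ a) ⬝ᵥ b + a ⬝ᵥ (δ ∘ b) := by
  simp only [dotProduct, map_sum, Derivation.leibniz, smul_eq_mul, Function.comp_apply, ← Finset.sum_add_distrib]
  exact Finset.sum_congr rfl fun i _ => by ring

lemma derivation_mulVec (M : Matrix κ ι R) (v : ι → R) :
    δ ∘ (M *ᵥ v) = (M.map δ) *ᵥ v + M *ᵥ (δ ∘ v) := by
  funext i
  exact derivation_dotProduct δ _ _

lemma transpose_mulVec_dotProduct {R ι κ : Type*} [CommRing R] [Fintype ι] [Fintype κ] (ψ : Matrix κ ι R)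
    (a : κ → R) (y : ι → R) :
    ψᵀ *ᵥ a ⬝ᵥ y = a ⬝ᵥ ψ *ᵥ y := by
  rw [mulVec_transpose, dotProduct_mulVec]

end MatrixDerivations

namespace JetCalculus

open Matrix

variable {ι κ R : Type*} [CommRing R] [Algebra ℝ R] (J : JetCalculus ι R) [Fintype κ]

lemma fnl_dotProduct_D (a b : κ → R) : J.fnl (a ⬝ᵥ (J.D ∘ b)) = -J.fnl ((J.D ∘ a) ⬝ᵥ b) := by
  have h := J.fnl_D (a ⬝ᵥ b)
  rw [derivation_dotProduct, map_add] at h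
  exact eq_neg_of_add_eq_zero_right h

variable [Fintype ι]

/-- `a = ψ⁻ᵀ D P` and `y = ψ⁻¹ φ⁻¹ D a`, so that `D y` is the value of the operator at `P`. -/
structure Chain (ψ : Matrix κ ι R) (φ : Matrix κ κ R) (P : ι → R) (a : κ → R) (y : ι → R) : Prop where
  left : ψᵀ *ᵥ a = J.D ∘ P
  right : J.D ∘ a = φ *ᵥ (ψ *ᵥ y)

variable {ψ : Matrix κ ι R} {φ' : Matrix κ κ ℝ} {φ : Matrix κ κ R}

lemma mulVec_inverse [DecidableEq κ] (hφ : φ'.map (algebraMap ℝ R) * φ = 1) {P : ι → R} {a : κ → R} {y : ι → R}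
    (h : J.Chain ψ φ P a y) : ψ *ᵥ y = φ'.map (algebraMap ℝ R) *ᵥ (J.D ∘ a) := by
  rw [h.right, mulVec_mulVec, hφ, one_mulVec]

lemma symm_dotProduct (hs : φ'.IsSymm) (a b : κ → R) :
    a ⬝ᵥ φ'.map (algebraMap ℝ R) *ᵥ b = φ'.map (algebraMap ℝ R) *ᵥ a ⬝ᵥ b := by
  rw [dotProduct_mulVec, ← mulVec_transpose]
  have : (φ'.map (algebraMap ℝ R))ᵀ = φ'.map (algebraMap ℝ R) := by
    rw [← transpose_map, hs.eq]
  rw [this]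

lemma D_comp_const_mulVec (φ' : Matrix κ κ ℝ) (δ : Derivation ℝ R R) (a : κ → R) :
    δ ∘ (φ'.map (algebraMap ℝ R) *ᵥ a) = φ'.map (algebraMap ℝ R) *ᵥ (δ ∘ a) := by
  rw [derivation_mulVec, derivation_map_algebraMap, zero_mulVec, zero_add]

variable [DecidableEq κ]

/-- Integrating by parts and moving ψ across the pairing leaves a form in `a` and `b` with constant
coefficients; this form makes skew-symmetry visible and is convenient to vary. -/
lemma fnl_bracket (hφ : φ'.map (algebraMap ℝ R) * φ = 1) {P Q : ι → R} {a b : κ → R}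
    {x y : ι → R} (hP : J.Chain ψ φ P a x) (hQ : J.Chain ψ φ Q b y) :
    J.fnl (P ⬝ᵥ (J.D ∘ y)) = -J.fnl (a ⬝ᵥ φ'.map (algebraMap ℝ R) *ᵥ (J.D ∘ b)) := by
  rw [fnl_dotProduct_D, ← hP.left, transpose_mulVec_dotProduct, J.mulVec_inverse hφ hQ]

lemma fnl_bracket_skew (hφ : φ'.map (algebraMap ℝ R) * φ = 1) (hs : φ'.IsSymm) {P Q : ι → R} {a b : κ → R}
    {x y : ι → R} (hP : J.Chain ψ φ P a x) (hQ : J.Chain ψ φ Q b y) :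
    J.fnl (P ⬝ᵥ (J.D ∘ y) + Q ⬝ᵥ (J.D ∘ x)) = 0 := by
  rw [map_add, J.fnl_bracket hφ hP hQ, J.fnl_bracket hφ hQ hP, symm_dotProduct hs, fnl_dotProduct_D,
    D_comp_const_mulVec, dotProduct_comm b, neg_neg, add_neg_cancel]

variable {B : (ι → R) → (ι → R) → κ → R}

/-- Vary a · φ⁻¹ D b instead of the original density. The variation of `a = ψ⁻ᵀ D P` consists of the
variation of P and of that of ψ; the latter gives the terms with `B`, since the variation of ψ along
X applied to y is `B y X`. -/
lemma fnl_evolD_bracket (hφ : φ'.map (algebraMap ℝ R) * φ = 1) (hs : φ'.IsSymm)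
    (hB : ∀ X y, (ψ.map (J.evolD X)) *ᵥ y = B y X) {P Q : ι → R} {a b : κ → R}
    {x y : ι → R} (hP : J.Chain ψ φ P a x) (hQ : J.Chain ψ φ Q b y) (X : ι → R) :
    J.fnl (J.evolD X (P ⬝ᵥ (J.D ∘ y))) =
      J.fnl ((J.evolD X ∘ P) ⬝ᵥ (J.D ∘ y)) - J.fnl ((J.evolD X ∘ Q) ⬝ᵥ (J.D ∘ x)) +
      J.fnl (a ⬝ᵥ B y X) - J.fnl (b ⬝ᵥ B x X) := by
  have hcomm : ∀ (c : κ → R), J.evolD X ∘ (J.D ∘ c) = J.D ∘ (J.evolD X ∘ c) := fun c =>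
    funext fun i => J.evolD_D X (c i)
  -- Differentiating ψᵀa = DP avoids ever differentiating ψ⁻¹.
  have key : ∀ {P : ι → R} {a : κ → R} {x : ι → R}, J.Chain ψ φ P a x → ∀ y : ι → R,
      J.fnl ((J.evolD X ∘ a) ⬝ᵥ ψ *ᵥ y) = -J.fnl ((J.evolD X ∘ P) ⬝ᵥ (J.D ∘ y)) - J.fnl (a ⬝ᵥ B y X) := by
    intro P a x hP y
    have h1 : J.evolD X ∘ (ψᵀ *ᵥ a) = J.D ∘ (J.evolD X ∘ P) := by
      rw [hP.left]
      exact funext fun i => J.evolD_D X (P i)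
    rw [derivation_mulVec] at h1
    have h2 : ψᵀ *ᵥ (J.evolD X ∘ a) = J.D ∘ (J.evolD X ∘ P) - (ψ.map (J.evolD X))ᵀ *ᵥ a :=
      eq_sub_of_add_eq' h1
    rw [← transpose_mulVec_dotProduct, h2, sub_dotProduct, transpose_mulVec_dotProduct, hB, map_sub,
      fnl_dotProduct_D, neg_neg]
  have h1 := J.fnl_evolD_congr X ((J.fnl_bracket hφ hP hQ).trans (map_neg _ _).symm)
  rw [h1, map_neg, derivation_dotProduct, D_comp_const_mulVec, hcomm, symm_dotProduct hs _ (J.D ∘ (J.evolD X ∘ b)),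
    map_neg, map_add, fnl_dotProduct_D J (φ'.map (algebraMap ℝ R) *ᵥ a), D_comp_const_mulVec,
    ← J.mulVec_inverse hφ hP, ← J.mulVec_inverse hφ hQ, key hP, dotProduct_comm (ψ *ᵥ x), key hQ]
  abel

/-- The Jacobi identity of the bracket of the operator `D ψ⁻¹ φ⁻¹ D ψ⁻ᵀ D`. -/
theorem fnl_jacobi (hφ : φ'.map (algebraMap ℝ R) * φ = 1) (hs : φ'.IsSymm)
    (hB : ∀ X y, (ψ.map (J.evolD X)) *ᵥ y = B y X)
    (hBs : ∀ x y, B x y = -B y x) (hBD : ∀ x y, J.D ∘ B x y = B (J.D ∘ x) y + B x (J.D ∘ y))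
    (hcyc : ∀ x y z, φ *ᵥ (ψ *ᵥ x) ⬝ᵥ B y z + φ *ᵥ (ψ *ᵥ y) ⬝ᵥ B z x + φ *ᵥ (ψ *ᵥ z) ⬝ᵥ B x y = 0)
    {f g h : R} {a b c : κ → R} {x y z : ι → R}
    (hf : J.Chain ψ φ (J.euler f) a x) (hg : J.Chain ψ φ (J.euler g) b y) (hh : J.Chain ψ φ (J.euler h) c z) :
    J.fnl (J.euler (J.euler f ⬝ᵥ (J.D ∘ y)) ⬝ᵥ (J.D ∘ z) + J.euler (J.euler g ⬝ᵥ (J.D ∘ z)) ⬝ᵥ (J.D ∘ x) +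
      J.euler (J.euler h ⬝ᵥ (J.D ∘ x)) ⬝ᵥ (J.D ∘ y)) = 0 := by
  have e : ∀ F (w : ι → R), J.fnl (J.euler F ⬝ᵥ (J.D ∘ w)) = J.fnl (J.evolD (J.D ∘ w) F) := fun F w =>
    J.fnl_euler _ _
  have hel : ∀ F (X Y : ι → R), J.fnl ((J.evolD X ∘ J.euler F) ⬝ᵥ Y) = J.fnl ((J.evolD Y ∘ J.euler F) ⬝ᵥ X) :=
    fun F X Y => J.fnl_helmholtz Y X F
  -- By skew-symmetry the two terms combine to a · D(B(y,z)), and integration by parts together with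
  -- Da = φψx gives a summand of the cyclic identity.
  have main : ∀ {F : R} {a : κ → R} {x : ι → R}, J.Chain ψ φ (J.euler F) a x → ∀ y z : ι → R,
      J.fnl (a ⬝ᵥ B y (J.D ∘ z)) - J.fnl (a ⬝ᵥ B z (J.D ∘ y)) = -J.fnl (φ *ᵥ (ψ *ᵥ x) ⬝ᵥ B y z) := by
    intro F a x h y z
    rw [← h.right, ← fnl_dotProduct_D, hBD, hBs z, dotProduct_neg, map_neg, sub_neg_eq_add, dotProduct_add,
      map_add, add_comm]
  have h0 := congrArg J.fnl (hcyc x y z)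
  rw [map_zero, map_add, map_add] at h0
  have m1 := main hf y z
  have m2 := main hg z x
  have m3 := main hh x y
  rw [map_add, map_add, e, e, e, J.fnl_evolD_bracket hφ hs hB hf hg, J.fnl_evolD_bracket hφ hs hB hg hh,
    J.fnl_evolD_bracket hφ hs hB hh hf, hel f (J.D ∘ z), hel g (J.D ∘ x), hel h (J.D ∘ y)]
  linear_combination (norm := module) m1 + m2 + m3 - h0

end JetCalculus
end WDVV
end

noncomputable section
namespace WDVV

/-! ### The algebra of smooth differential functions -/

variable {n : ℕ}

section Rules

variable {d : ℕ} {U : Set (Fin n → ℝ)} {f g : Jet n → ℝ} {z : Jet n}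

lemma IsDiffFun.add (hf : IsDiffFun d U f) (hg : IsDiffFun d U g) : IsDiffFun d U fun z => f z + g z := by
  obtain ⟨N, F, G, hF, hG⟩ := exists_represents₂ hf hg
  exact isDiffFun_iff.2 ⟨N, _, hF.add hG⟩

lemma IsDiffFun.mul (hf : IsDiffFun d U f) (hg : IsDiffFun d U g) : IsDiffFun d U fun z => f z * g z := by
  obtain ⟨N, F, G, hF, hG⟩ := exists_represents₂ hf hg
  exact isDiffFun_iff.2 ⟨N, _, hF.mul hG⟩

lemma pdJet_add (hU : IsOpen U) (hf : IsDiffFun d U f) (hg : IsDiffFun d U g) (hz : z ∈ jetDomain d U)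
    (k : ℕ) (i : Fin n) : pdJet k i (fun z => f z + g z) z = pdJet k i f z + pdJet k i g z := by
  obtain ⟨N, F, G, hF, hG⟩ := exists_represents₂ hf hg
  rw [(hF.add hG).pdJet_eq hU hz, hF.pdJet_eq hU hz, hG.pdJet_eq hU hz,
    fderiv_fun_add (hF.differentiableAt hU hz) (hG.differentiableAt hU hz), add_apply]

lemma pdJet_mul (hU : IsOpen U) (hf : IsDiffFun d U f) (hg : IsDiffFun d U g) (hz : z ∈ jetDomain d U)
    (k : ℕ) (i : Fin n) : pdJet k i (fun z => f z * g z) z = f z * pdJet k i g z + g z * pdJet k i f z := by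
  obtain ⟨N, F, G, hF, hG⟩ := exists_represents₂ hf hg
  rw [(hF.mul hG).pdJet_eq hU hz, hF.pdJet_eq hU hz, hG.pdJet_eq hU hz, hF.eq z hz, hG.eq z hz,
    fderiv_fun_mul (hF.differentiableAt hU hz) (hG.differentiableAt hU hz)]
  simp

lemma totalD_add (hU : IsOpen U) (hf : IsDiffFun d U f) (hg : IsDiffFun d U g) (hz : z ∈ jetDomain d U) :
    totalD (fun z => f z + g z) z = totalD f z + totalD g z := by
  obtain ⟨N, F, G, hF, hG⟩ := exists_represents₂ hf hg
  rw [(hF.add hG).totalD_eq hU hz, hF.totalD_eq hU hz, hG.totalD_eq hU hz,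
    fderiv_fun_add (hF.differentiableAt hU hz) (hG.differentiableAt hU hz), add_apply]

lemma totalD_mul (hU : IsOpen U) (hf : IsDiffFun d U f) (hg : IsDiffFun d U g) (hz : z ∈ jetDomain d U) :
    totalD (fun z => f z * g z) z = f z * totalD g z + g z * totalD f z := by
  obtain ⟨N, F, G, hF, hG⟩ := exists_represents₂ hf hg
  rw [(hF.mul hG).totalD_eq hU hz, hF.totalD_eq hU hz, hG.totalD_eq hU hz, hF.eq z hz, hG.eq z hz,
    fderiv_fun_mul (hF.differentiableAt hU hz) (hG.differentiableAt hU hz)]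
  simp

lemma pdJet_const (c : ℝ) (k : ℕ) (i : Fin n) (z : Jet n) : pdJet k i (fun _ => c) z = 0 := by
  simp [pdJet]

lemma totalD_const (c : ℝ) (z : Jet n) : totalD (fun _ => c) z = 0 := by
  simp [totalD, pdJet_const]

lemma totalD_fst (z : Jet n) : totalD (fun z => z.1) z = 1 := by
  simp [totalD, pdJet]

lemma pdJet_coord (k l : ℕ) (i j : Fin n) (z : Jet n) :
    pdJet k i (fun z => z.2 l j) z = if l = k ∧ j = i then 1 else 0 := by
  unfold pdJet
  by_cases h : l = k
  · subst h
    by_cases hj : j = i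
    · subst hj; simp
    · simp [hj]
  · simp [h]

lemma totalD_coord (l : ℕ) (j : Fin n) (z : Jet n) : totalD (fun z => z.2 l j) z = z.2 (l + 1) j := by
  simp only [totalD, pdJet_coord, deriv_const, zero_add]
  rw [finsum_eq_single _ l]
  · simp
  · intro k hk
    simp [Ne.symm hk]

end Rules

/-- The algebra of smooth differential functions on `jetDomain d U`. -/
def diffAlg (d : ℕ) (U : Set (Fin n → ℝ)) : Subalgebra ℝ (jetDomain d U → ℝ) where
  carrier := {F | ∃ f : Jet n → ℝ, IsDiffFun d U f ∧ ∀ z : jetDomain d U, F z = f z}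
  add_mem' := by
    rintro F G ⟨f, hf, hF⟩ ⟨g, hg, hG⟩
    exact ⟨_, hf.add hg, fun z => by rw [Pi.add_apply, hF, hG]⟩
  mul_mem' := by
    rintro F G ⟨f, hf, hF⟩ ⟨g, hg, hG⟩
    exact ⟨_, hf.mul hg, fun z => by rw [Pi.mul_apply, hF, hG]⟩
  algebraMap_mem' := fun c => ⟨fun _ => c, isDiffFun_const d U c, fun _ => rfl⟩

namespace diffAlg

variable {d : ℕ} {U : Set (Fin n → ℝ)}

/-- A function on the whole jet space that restricts to a given differential function. -/
def fn (F : diffAlg d U) : Jet n → ℝ := F.2.choose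

lemma isDiffFun_fn (F : diffAlg d U) : IsDiffFun d U (fn F) := F.2.choose_spec.1

/-- The value at a jet. -/
def eval (z : Jet n) (hz : z ∈ jetDomain d U) : diffAlg d U →ₐ[ℝ] ℝ :=
  (Pi.evalAlgHom ℝ (fun _ : jetDomain d U => ℝ) ⟨z, hz⟩).comp (diffAlg d U).val

lemma eval_eq_fn (F : diffAlg d U) {z : Jet n} (hz : z ∈ jetDomain d U) : eval z hz F = (fn F) z :=
  F.2.choose_spec.2 ⟨z, hz⟩

lemma ext {F G : diffAlg d U} (h : ∀ z (hz : z ∈ jetDomain d U), eval z hz F = eval z hz G) : F = G :=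
  Subtype.ext (funext fun z => h z.1 z.2)

/-- The restriction of a differential function. -/
def ofFn (f : Jet n → ℝ) (hf : IsDiffFun d U f) : diffAlg d U := ⟨fun z => f z, f, hf, fun _ => rfl⟩

lemma eval_ofFn {f : Jet n → ℝ} (hf : IsDiffFun d U f) {z : Jet n} (hz : z ∈ jetDomain d U) :
    eval z hz (ofFn f hf) = f z := rfl

lemma fn_ofFn {f : Jet n → ℝ} (hf : IsDiffFun d U f) (z : Jet n) (hz : z ∈ jetDomain d U) :
    fn (ofFn f hf) z = f z := by
  rw [← eval_eq_fn _ hz, eval_ofFn]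

/-- The pointwise reciprocal is again a smooth differential function, so matrices with nowhere
vanishing determinant are invertible over the algebra. -/
lemma isUnit_of_eval_ne_zero (F : diffAlg d U) (h : ∀ z (hz : z ∈ jetDomain d U), eval z hz F ≠ 0) :
    IsUnit F := by
  have h0 : ∀ z ∈ jetDomain d U, (fn F) z ≠ 0 := fun z hz => by
    rw [← eval_eq_fn F hz]
    exact h z hz
  refine IsUnit.of_mul_eq_one (ofFn _ ((isDiffFun_fn F).inv h0)) (ext fun z hz => ?_)
  rw [map_mul, eval_ofFn, map_one, eval_eq_fn]
  exact mul_inv_cancel₀ (h0 z hz)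

/-- The jet coordinate `u^i_k`. -/
def coord (d : ℕ) (U : Set (Fin n → ℝ)) (k : ℕ) (i : Fin n) : diffAlg d U := ofFn _ (isDiffFun_coord d U k i)

/-- The independent variable `x`. -/
def var (d : ℕ) (U : Set (Fin n → ℝ)) : diffAlg d U := ofFn _ (isDiffFun_fst d U)

lemma eval_coord (k : ℕ) (i : Fin n) (z : Jet n) (hz : z ∈ jetDomain d U) :
    eval z hz (coord d U k i) = z.2 k i := rfl

lemma eval_var (z : Jet n) (hz : z ∈ jetDomain d U) : eval z hz (var d U) = z.1 := rfl

lemma fn_add_eq (F G : diffAlg d U) : ∀ z ∈ jetDomain d U, fn (F + G) z = (fn F) z + (fn G) z := by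
  intro z hz
  rw [← eval_eq_fn _ hz, map_add, eval_eq_fn, eval_eq_fn]

lemma fn_mul_eq (F G : diffAlg d U) : ∀ z ∈ jetDomain d U, fn (F * G) z = (fn F) z * (fn G) z := by
  intro z hz
  rw [← eval_eq_fn _ hz, map_mul, eval_eq_fn, eval_eq_fn]

lemma fn_smul_eq (c : ℝ) (F : diffAlg d U) : ∀ z ∈ jetDomain d U, fn (c • F) z = c * (fn F) z := by
  intro z hz
  rw [← eval_eq_fn _ hz, map_smul, eval_eq_fn, smul_eq_mul]

/-- The total derivative. -/
def totalDer (hU : IsOpen U) : Derivation ℝ (diffAlg d U) (diffAlg d U) :=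
  Derivation.mk'
    { toFun := fun F => ofFn (totalD (fn F)) ((isDiffFun_fn F).totalD hU)
      map_add' := fun F G => ext fun z hz => by
        rw [map_add, eval_ofFn, eval_ofFn, eval_ofFn, totalD_congr hU (fn_add_eq F G) z hz,
          totalD_add hU (isDiffFun_fn F) (isDiffFun_fn G) hz]
      map_smul' := fun c F => ext fun z hz => by
        rw [RingHom.id_apply, map_smul, eval_ofFn, eval_ofFn, totalD_congr hU (fn_smul_eq c F) z hz,
          totalD_mul hU (isDiffFun_const d U c) (isDiffFun_fn F) hz, totalD_const, mul_zero, add_zero, smul_eq_mul] }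
    fun F G => ext fun z hz => by
      rw [map_add, smul_eq_mul, smul_eq_mul, map_mul (eval z hz), map_mul (eval z hz)]
      change totalD _ z = _ * totalD _ z + _ * totalD _ z
      rw [totalD_congr hU (fn_mul_eq F G) z hz, totalD_mul hU (isDiffFun_fn F) (isDiffFun_fn G) hz, eval_eq_fn,
        eval_eq_fn]

/-- The partial derivative with respect to `u^i_k`. -/
def partialDer (hU : IsOpen U) (k : ℕ) (i : Fin n) : Derivation ℝ (diffAlg d U) (diffAlg d U) :=
  Derivation.mk'
    { toFun := fun F => ofFn (pdJet k i (fn F)) ((isDiffFun_fn F).pdJet hU k i)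
      map_add' := fun F G => ext fun z hz => by
        rw [map_add, eval_ofFn, eval_ofFn, eval_ofFn, pdJet_congr hU (fn_add_eq F G) k i z hz,
          pdJet_add hU (isDiffFun_fn F) (isDiffFun_fn G) hz]
      map_smul' := fun c F => ext fun z hz => by
        rw [RingHom.id_apply, map_smul, eval_ofFn, eval_ofFn, pdJet_congr hU (fn_smul_eq c F) k i z hz,
          pdJet_mul hU (isDiffFun_const d U c) (isDiffFun_fn F) hz, pdJet_const, mul_zero, add_zero, smul_eq_mul] }
    fun F G => ext fun z hz => by
      rw [map_add, smul_eq_mul, smul_eq_mul, map_mul (eval z hz), map_mul (eval z hz)]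
      change pdJet k i _ z = _ * pdJet k i _ z + _ * pdJet k i _ z
      rw [pdJet_congr hU (fn_mul_eq F G) k i z hz, pdJet_mul hU (isDiffFun_fn F) (isDiffFun_fn G) hz, eval_eq_fn,
        eval_eq_fn]

lemma totalDer_ofFn (hU : IsOpen U) {f : Jet n → ℝ} (hf : IsDiffFun d U f) :
    totalDer hU (ofFn f hf) = ofFn (totalD f) (hf.totalD hU) :=
  ext fun z hz => totalD_congr hU (fn_ofFn hf) z hz

lemma partialDer_ofFn (hU : IsOpen U) (k : ℕ) (i : Fin n) {f : Jet n → ℝ} (hf : IsDiffFun d U f) :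
    partialDer hU k i (ofFn f hf) = ofFn (pdJet k i f) (hf.pdJet hU k i) :=
  ext fun z hz => pdJet_congr hU (fn_ofFn hf) k i z hz

lemma exists_ofFn (F : diffAlg d U) : ∃ (f : Jet n → ℝ) (hf : IsDiffFun d U f), F = ofFn f hf :=
  ⟨(fn F), (isDiffFun_fn F), ext fun _ hz => eval_eq_fn F hz⟩

/-- The variational calculus of smooth differential functions. -/
def jets (d : ℕ) {U : Set (Fin n → ℝ)} (hU : IsOpen U) : JetCalculus (Fin n) (diffAlg d U) where
  D := totalDer hU
  pd := partialDer hU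
  pd_comm := by
    intro k l i j F
    obtain ⟨f, hf, rfl⟩ := exists_ofFn F
    obtain ⟨N, g, hg⟩ := isDiffFun_iff.1 hf
    simp only [partialDer_ofFn]
    exact ext fun z hz => hg.pdJet_comm hU hz k l i j
  pd_zero_D := by
    intro i F
    obtain ⟨f, hf, rfl⟩ := exists_ofFn F
    obtain ⟨N, g, hg⟩ := isDiffFun_iff.1 hf
    simp only [partialDer_ofFn, totalDer_ofFn]
    refine ext fun z hz => ?_
    rw [eval_ofFn, eval_ofFn, hg.pdJet_totalD hU hz, Represents.shiftMap_dir_zero, map_zero, add_zero]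
  pd_succ_D := by
    intro k i F
    obtain ⟨f, hf, rfl⟩ := exists_ofFn F
    obtain ⟨N, g, hg⟩ := isDiffFun_iff.1 hf
    simp only [partialDer_ofFn, totalDer_ofFn]
    refine ext fun z hz => ?_
    rw [map_add, eval_ofFn, eval_ofFn, eval_ofFn, hg.pdJet_totalD hU hz, Represents.shiftMap_dir_succ,
      hg.pdJet_eq hU hz]
  exists_order := by
    intro F
    obtain ⟨f, hf, rfl⟩ := exists_ofFn F
    obtain ⟨N, g, hg⟩ := isDiffFun_iff.1 hf
    refine ⟨N, fun k hk i => ?_⟩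
    rw [partialDer_ofFn]
    exact ext fun z hz => hg.pdJet_eq_zero hU hz hk i

lemma D_ofFn (hU : IsOpen U) {f : Jet n → ℝ} (hf : IsDiffFun d U f) :
    (jets d hU).D (ofFn f hf) = ofFn (totalD f) (hf.totalD hU) := totalDer_ofFn hU hf

lemma pd_ofFn (hU : IsOpen U) (k : ℕ) (i : Fin n) {f : Jet n → ℝ} (hf : IsDiffFun d U f) :
    (jets d hU).pd k i (ofFn f hf) = ofFn (pdJet k i f) (hf.pdJet hU k i) := partialDer_ofFn hU k i hf

lemma D_coord (hU : IsOpen U) (k : ℕ) (i : Fin n) :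
    (jets d hU).D (coord d U k i) = coord d U (k + 1) i :=
  (D_ofFn hU _).trans (ext fun z _ => totalD_coord k i z)

lemma D_var (hU : IsOpen U) : (jets d hU).D (var d U) = 1 :=
  (D_ofFn hU _).trans (ext fun z _ => totalD_fst z)

lemma pd_coord (hU : IsOpen U) (k l : ℕ) (i j : Fin n) :
    (jets d hU).pd k i (coord d U l j) = if l = k ∧ j = i then 1 else 0 := by
  refine (pd_ofFn hU k i _).trans (ext fun z hz => (pdJet_coord k l i j z).trans ?_)
  split_ifs <;> simp

lemma pd_var (hU : IsOpen U) (k : ℕ) (i : Fin n) : (jets d hU).pd k i (var d U) = 0 :=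
  (pd_ofFn hU k i _).trans (ext fun _ _ => deriv_const _ _)

/-! ### Agreement of the pointwise variational operators with the algebraic ones. -/

lemma totalD_iterate (hU : IsOpen U) {f : Jet n → ℝ} (hf : IsDiffFun d U f) (k : ℕ) (z : Jet n)
    (hz : z ∈ jetDomain d U) : (totalD^[k] f) z = eval z hz ((jets d hU).D^[k] (ofFn f hf)) := by
  induction k generalizing f with
  | zero => rfl
  | succ k ih =>
    rw [Function.iterate_succ_apply, Function.iterate_succ_apply, D_ofFn, ih]

lemma varD_eq (hU : IsOpen U) {f : Jet n → ℝ} (hf : IsDiffFun d U f) (i : Fin n) (z : Jet n)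
    (hz : z ∈ jetDomain d U) : varD f i z = eval z hz ((jets d hU).euler (ofFn f hf) i) := by
  obtain ⟨N, hN⟩ := (jets d hU).exists_order (ofFn f hf)
  have h1 : ∀ k, (totalD^[k] (pdJet k i f)) z = eval z hz ((jets d hU).D^[k] ((jets d hU).pd k i (ofFn f hf))) := by
    intro k
    rw [pd_ofFn, totalD_iterate hU (hf.pdJet hU k i) k z hz]
  rw [(jets d hU).euler_eq_sum hN, map_sum, varD, finsum_eq_sum_of_support_subset (s := Finset.range N)]
  · refine Finset.sum_congr rfl fun k _ => ?_
    rw [h1, map_mul, map_pow, map_neg, map_one]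
  · intro k hk
    by_contra h
    refine hk ?_
    dsimp only
    rw [h1, hN k (by simpa using h) i, iterate_map_zero, map_zero, mul_zero]

lemma isDiffFun_varD (hU : IsOpen U) {f : Jet n → ℝ} (hf : IsDiffFun d U f) (i : Fin n) :
    IsDiffFun d U (varD f i) :=
  (isDiffFun_fn ((jets d hU).euler (ofFn f hf) i)).congr fun z hz => by
    rw [varD_eq hU hf i z hz, eval_eq_fn]

lemma euler_ofFn (hU : IsOpen U) {f : Jet n → ℝ} (hf : IsDiffFun d U f) (i : Fin n) :
    (jets d hU).euler (ofFn f hf) i = ofFn (varD f i) (isDiffFun_varD hU hf i) :=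
  ext fun z hz => (varD_eq hU hf i z hz).symm

lemma evol_eq (hU : IsOpen U) {Q : Fin n → Jet n → ℝ} (hQ : ∀ i, IsDiffFun d U (Q i)) {f : Jet n → ℝ}
    (hf : IsDiffFun d U f) (z : Jet n) (hz : z ∈ jetDomain d U) :
    evol Q f z = eval z hz ((jets d hU).evolD (fun i => ofFn (Q i) (hQ i)) (ofFn f hf)) := by
  obtain ⟨N, hN⟩ := (jets d hU).exists_order (ofFn f hf)
  have h1 : ∀ k i, pdJet k i f z = eval z hz ((jets d hU).pd k i (ofFn f hf)) := by
    intro k i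
    rw [pd_ofFn, eval_ofFn]
  rw [(jets d hU).evolD_eq_sum _ hN, map_sum, evol, finsum_eq_sum_of_support_subset (s := Finset.range N)]
  · refine Finset.sum_congr rfl fun k _ => ?_
    rw [map_sum]
    refine Finset.sum_congr rfl fun i _ => ?_
    rw [h1, map_mul, totalD_iterate hU (hQ i) k z hz]
  · intro k hk
    by_contra h
    refine hk (Finset.sum_eq_zero fun i _ => ?_)
    rw [h1, hN k (by simpa using h) i, map_zero, mul_zero]

lemma isNullFunctional_of_fnl (hU : IsOpen U) {f : Jet n → ℝ} {F : diffAlg 0 U} (hF : (jets 0 hU).fnl F = 0)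
    (h : ∀ z (hz : z ∈ jetDomain 0 U), f z = eval z hz F) : IsNullFunctional U f := by
  obtain ⟨s, rfl⟩ := (jets 0 hU).fnl_eq_zero.1 hF
  obtain ⟨s, hs, rfl⟩ := exists_ofFn s
  refine ⟨s, hs, fun z hz => ?_⟩
  rw [h z hz, D_ofFn, eval_ofFn]

end diffAlg
end WDVV
end

noncomputable section
namespace WDVV

/-! ### The congruence as a commutator of `4 × 4` matrices -/

open Matrix

/-- The symmetric matrix with vanishing first row and entries `x^{(m,i)}`. -/
def symMat (x : Fin 6 → ℝ) : Matrix (Fin 4) (Fin 4) ℝ :=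
  !![0, 0, 0, 0; 0, x 0, x 1, x 3; 0, x 1, x 2, x 4; 0, x 3, x 4, x 5]

/-- The symmetric matrix with first row `η_{p·}` and all entries outside the first row and column zero. -/
def baseMat (η : Matrix (Fin 4) (Fin 4) ℝ) (p : Fin 4) : Matrix (Fin 4) (Fin 4) ℝ :=
  !![η p 0, η p 1, η p 2, η p 3; η p 1, 0, 0, 0; η p 2, 0, 0, 0; η p 3, 0, 0, 0]

/-- The matrix `(F_{pαβ})` of third derivatives with `u_p = u`. -/
def hessMat (η : Matrix (Fin 4) (Fin 4) ℝ) (p : Fin 4) (u : Fin 6 → ℝ) : Matrix (Fin 4) (Fin 4) ℝ :=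
  baseMat η p + symMat u

/-- `A E B - B E A`. -/
def comm (E A B : Matrix (Fin 4) (Fin 4) ℝ) : Matrix (Fin 4) (Fin 4) ℝ := A * E * B - B * E * A

lemma comm_apply (E A B : Matrix (Fin 4) (Fin 4) ℝ) (i j : Fin 4) : comm E A B i j =
    (A i 0 * E 0 0 + A i 1 * E 1 0 + A i 2 * E 2 0 + A i 3 * E 3 0) * B 0 j +
    (A i 0 * E 0 1 + A i 1 * E 1 1 + A i 2 * E 2 1 + A i 3 * E 3 1) * B 1 j +
    (A i 0 * E 0 2 + A i 1 * E 1 2 + A i 2 * E 2 2 + A i 3 * E 3 2) * B 2 j +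
    (A i 0 * E 0 3 + A i 1 * E 1 3 + A i 2 * E 2 3 + A i 3 * E 3 3) * B 3 j -
    ((B i 0 * E 0 0 + B i 1 * E 1 0 + B i 2 * E 2 0 + B i 3 * E 3 0) * A 0 j +
    (B i 0 * E 0 1 + B i 1 * E 1 1 + B i 2 * E 2 1 + B i 3 * E 3 1) * A 1 j +
    (B i 0 * E 0 2 + B i 1 * E 1 2 + B i 2 * E 2 2 + B i 3 * E 3 2) * A 2 j +
    (B i 0 * E 0 3 + B i 1 * E 1 3 + B i 2 * E 2 3 + B i 3 * E 3 3) * A 3 j) := by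
  simp only [comm, Matrix.sub_apply, Matrix.mul_apply, Fin.sum_univ_four]

/-- The entries above the diagonal. -/
def coords (A : Matrix (Fin 4) (Fin 4) ℝ) : Fin 6 → ℝ := fun γ => A (bt γ) (hi γ)

/-- The bilinear map with coefficients `ψ^γ_{ik}`. -/
def psiForm (η : Matrix (Fin 4) (Fin 4) ℝ) (x y : Fin 6 → ℝ) : Fin 6 → ℝ := fun γ =>
  ∑ i, ∑ k, psiC η γ i k * x i * y k

lemma symMat_isSymm (x : Fin 6 → ℝ) : (symMat x).IsSymm := by
  ext i j
  fin_cases i <;> fin_cases j <;> rfl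

lemma baseMat_isSymm (η : Matrix (Fin 4) (Fin 4) ℝ) (p : Fin 4) : (baseMat η p).IsSymm := by
  ext i j
  fin_cases i <;> fin_cases j <;> rfl

lemma hessMat_isSymm (η : Matrix (Fin 4) (Fin 4) ℝ) (p : Fin 4) (u : Fin 6 → ℝ) : (hessMat η p u).IsSymm :=
  (baseMat_isSymm η p).add (symMat_isSymm u)

lemma symMat_add (x y : Fin 6 → ℝ) : symMat (x + y) = symMat x + symMat y := by
  ext i j
  fin_cases i <;> fin_cases j <;> simp [symMat]

lemma symMat_injective {x : Fin 6 → ℝ} (h : symMat x = 0) : x = 0 := by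
  funext i
  fin_cases i
  · exact congrFun (congrFun h 1) 1
  · exact congrFun (congrFun h 1) 2
  · exact congrFun (congrFun h 2) 2
  · exact congrFun (congrFun h 1) 3
  · exact congrFun (congrFun h 2) 3
  · exact congrFun (congrFun h 3) 3

lemma comm_skew {E A B : Matrix (Fin 4) (Fin 4) ℝ} (hE : E.IsSymm) (hA : A.IsSymm) (hB : B.IsSymm) :
    (comm E A B)ᵀ = -comm E A B := by
  simp only [comm, transpose_sub, transpose_mul, hE.eq, hA.eq, hB.eq, mul_assoc, neg_sub]

lemma coords_add (A B : Matrix (Fin 4) (Fin 4) ℝ) : coords (A + B) = coords A + coords B := rfl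

lemma coords_neg (A : Matrix (Fin 4) (Fin 4) ℝ) : coords (-A) = -coords A := rfl

lemma comm_add_left (E A A' B : Matrix (Fin 4) (Fin 4) ℝ) : comm E (A + A') B = comm E A B + comm E A' B := by
  simp only [comm, add_mul, mul_add]
  abel

lemma comm_add_right (E A B B' : Matrix (Fin 4) (Fin 4) ℝ) : comm E A (B + B') = comm E A B + comm E A B' := by
  simp only [comm, add_mul, mul_add]
  abel

lemma comm_swap (E A B : Matrix (Fin 4) (Fin 4) ℝ) : comm E B A = -comm E A B := by
  simp only [comm, neg_sub]

lemma coords_injective {A : Matrix (Fin 4) (Fin 4) ℝ} (hA : Aᵀ = -A) (h : coords A = 0) : A = 0 := by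
  have hs : ∀ i j, A j i = -A i j := fun i j => congrFun (congrFun hA i) j
  have h0 : ∀ γ, A (bt γ) (hi γ) = 0 := fun γ => congrFun h γ
  have e0 : A 0 1 = 0 := h0 0
  have e1 : A 0 2 = 0 := h0 1
  have e2 : A 1 2 = 0 := h0 2
  have e3 : A 0 3 = 0 := h0 3
  have e4 : A 1 3 = 0 := h0 4
  have e5 : A 2 3 = 0 := h0 5
  ext i j
  fin_cases i <;> fin_cases j <;> simp [e0, e1, e2, e3, e4, e5, hs 0 1, hs 0 2, hs 0 3, hs 1 2, hs 1 3, hs 2 3] <;>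
    first | linarith [hs 0 0] | linarith [hs 1 1] | linarith [hs 2 2] | linarith [hs 3 3]

/-- The quadratic part of the equations is the commutator of two matrices with zero first row. That
commutator also has zero first row, which matches the three vanishing blocks of `psiC`. -/
lemma psiForm_eq {η : Matrix (Fin 4) (Fin 4) ℝ} (hη : η.IsSymm) (x y : Fin 6 → ℝ) :
    psiForm η x y = coords (comm η⁻¹ (symMat y) (symMat x)) := by
  have hE : ∀ i j, η⁻¹ j i = η⁻¹ i j := fun i j => by
    have h : (η⁻¹)ᵀ = η⁻¹ := by rw [transpose_nonsing_inv, hη.eq]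
    exact congrFun (congrFun h i) j
  have h0 : ∀ ν, comm η⁻¹ (symMat y) (symMat x) 0 ν = 0 := fun ν => by
    rw [comm_apply]
    simp [symMat]
  have h2 : psiC η 2 = !![0, -η⁻¹ 1 1, -η⁻¹ 1 2, 0, -η⁻¹ 1 3, 0;
       η⁻¹ 1 1, 0, -η⁻¹ 2 2, η⁻¹ 1 3, -η⁻¹ 2 3, 0;
       η⁻¹ 1 2, η⁻¹ 2 2, 0, η⁻¹ 2 3, 0, 0;
       0, -η⁻¹ 1 3, -η⁻¹ 2 3, 0, -η⁻¹ 3 3, 0;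
       η⁻¹ 1 3, η⁻¹ 2 3, 0, η⁻¹ 3 3, 0, 0;
       0, 0, 0, 0, 0, 0] := rfl
  have h4 : psiC η 4 = !![0, 0, 0, -η⁻¹ 1 1, -η⁻¹ 1 2, -η⁻¹ 1 3;
       0, 0, 0, -η⁻¹ 1 2, -η⁻¹ 2 2, -η⁻¹ 2 3;
       0, 0, 0, 0, 0, 0;
       η⁻¹ 1 1, η⁻¹ 1 2, 0, 0, -η⁻¹ 2 3, -η⁻¹ 3 3;
       η⁻¹ 1 2, η⁻¹ 2 2, 0, η⁻¹ 2 3, 0, 0;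
       η⁻¹ 1 3, η⁻¹ 2 3, 0, η⁻¹ 3 3, 0, 0] := rfl
  have h5 : psiC η 5 = !![0, 0, 0, 0, 0, 0;
       0, 0, 0, -η⁻¹ 1 1, -η⁻¹ 1 2, -η⁻¹ 1 3;
       0, 0, 0, -η⁻¹ 1 2, -η⁻¹ 2 2, -η⁻¹ 2 3;
       0, η⁻¹ 1 1, η⁻¹ 1 2, 0, η⁻¹ 1 3, 0;
       0, η⁻¹ 1 2, η⁻¹ 2 2, -η⁻¹ 1 3, 0, -η⁻¹ 3 3;
       0, η⁻¹ 1 3, η⁻¹ 2 3, 0, η⁻¹ 3 3, 0] := rfl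
  have hz : ∀ γ, psiC η γ = 0 → bt γ = 0 → psiForm η x y γ = coords (comm η⁻¹ (symMat y) (symMat x)) γ := by
    intro γ hγ hb
    simp [psiForm, hγ, coords, hb, h0]
  have hs : ∀ γ b h M, psiC η γ = M → bt γ = b → hi γ = h →
      ∑ i, ∑ k, M i k * x i * y k = comm η⁻¹ (symMat y) (symMat x) b h →
      psiForm η x y γ = coords (comm η⁻¹ (symMat y) (symMat x)) γ := by
    rintro γ b h M rfl rfl rfl e
    exact e
  funext γ
  fin_cases γ
  · exact hz 0 rfl rfl
  · exact hz 1 rfl rfl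
  · refine hs 2 1 2 _ h2 rfl rfl ?_
    rw [comm_apply]
    simp [Fin.sum_univ_six, symMat, hE 1 2, hE 1 3, hE 2 3]
    ring
  · exact hz 3 rfl rfl
  · refine hs 4 1 3 _ h4 rfl rfl ?_
    rw [comm_apply]
    simp [Fin.sum_univ_six, symMat, hE 1 2, hE 1 3, hE 2 3]
    ring
  · refine hs 5 2 3 _ h5 rfl rfl ?_
    rw [comm_apply]
    simp [Fin.sum_univ_six, symMat, hE 1 2, hE 1 3, hE 2 3]
    ring

lemma baseMat_row_mul_inv {η : Matrix (Fin 4) (Fin 4) ℝ} (hdet : IsUnit η.det) (p b : Fin 4) :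
    (baseMat η p * η⁻¹) 0 b = if p = b then 1 else 0 := by
  have h : η * η⁻¹ = 1 := mul_nonsing_inv η hdet
  rw [← Matrix.one_apply, ← h]
  simp [Matrix.mul_apply, baseMat, Fin.sum_univ_four]

/-- The first row of `baseMat η p` is row p of η, so after multiplication by η⁻¹ it becomes the unit
row e_p; the other product has zero first row. This is why the equations with β = 1 only select
entries of the field. -/
lemma comm_base_zero {η : Matrix (Fin 4) (Fin 4) ℝ} (hdet : IsUnit η.det) (p : Fin 4)
    {X : Matrix (Fin 4) (Fin 4) ℝ} (hX : ∀ j, X 0 j = 0) (ν : Fin 4) :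
    comm η⁻¹ (baseMat η p) X 0 ν = X p ν := by
  rw [comm, Matrix.sub_apply, mul_apply]
  simp only [baseMat_row_mul_inv hdet]
  have : (X * η⁻¹ * baseMat η p) 0 ν = 0 := by
    rw [Matrix.mul_assoc, mul_apply]
    simp [hX]
  simp [this]

lemma omega_mulVec {η : Matrix (Fin 4) (Fin 4) ℝ} (hη : η.IsSymm) (hdet : IsUnit η.det) {p : Fin 4} (hp : p ≠ 0)
    (x : Fin 6 → ℝ) : omega η p *ᵥ x = coords (comm η⁻¹ (baseMat η p) (symMat x)) := by
  have hE : ∀ i j, η⁻¹ j i = η⁻¹ i j := fun i j => by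
    have h : (η⁻¹)ᵀ = η⁻¹ := by rw [transpose_nonsing_inv, hη.eq]
    exact congrFun (congrFun h i) j
  have hz : ∀ ν, comm η⁻¹ (baseMat η p) (symMat x) 0 ν = symMat x p ν :=
    comm_base_zero hdet p fun j => by fin_cases j <;> rfl
  have ht : ∀ ν, ν ≠ 0 → ∑ k, omegaTriv p ν k * x k = symMat x p ν := by
    intro ν hν
    simp only [Fin.sum_univ_six, omegaTriv]
    fin_cases p <;> fin_cases ν <;> first | exact absurd rfl hp | exact absurd rfl hν | simp [hi, lo, symMat]
  funext γ
  fin_cases γ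
  · exact (ht 1 (by decide)).trans (hz 1).symm
  · exact (ht 2 (by decide)).trans (hz 2).symm
  · rw [coords, comm_apply]
    simp [mulVec, dotProduct, omega, bt, hi, symMat, baseMat, Fin.sum_univ_six, hE 0 1, hE 0 2, hE 0 3]
    ring
  · exact (ht 3 (by decide)).trans (hz 3).symm
  · rw [coords, comm_apply]
    simp [mulVec, dotProduct, omega, bt, hi, symMat, baseMat, Fin.sum_univ_six, hE 0 1, hE 0 2, hE 0 3]
    ring
  · rw [coords, comm_apply]
    simp [mulVec, dotProduct, omega, bt, hi, symMat, baseMat, Fin.sum_univ_six, hE 0 1, hE 0 2, hE 0 3]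
    ring

lemma xi_eq {η : Matrix (Fin 4) (Fin 4) ℝ} (hdet : IsUnit η.det) {p q : Fin 4} (hp : p ≠ 0) (hq : q ≠ 0) :
    xi η p q = -coords (comm η⁻¹ (baseMat η p) (baseMat η q)) := by
  have h0 : ∀ ν, ν ≠ 0 → comm η⁻¹ (baseMat η p) (baseMat η q) 0 ν = 0 := by
    intro ν hν
    rw [comm, Matrix.sub_apply, mul_apply, mul_apply]
    simp only [baseMat_row_mul_inv hdet, ite_mul, one_mul, zero_mul, Finset.sum_ite_eq, Finset.mem_univ, if_true]
    fin_cases p <;> fin_cases q <;> fin_cases ν <;>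
      first | exact absurd rfl hp | exact absurd rfl hq | exact absurd rfl hν | simp [baseMat]
  have h1 : ∀ β ν, β ≠ 0 → ν ≠ 0 → comm η⁻¹ (baseMat η p) (baseMat η q) β ν =
      η⁻¹ 0 0 * (η p β * η q ν - η p ν * η q β) := by
    intro β ν hβ hν
    rw [comm_apply]
    fin_cases β <;> fin_cases ν <;>
      first | exact absurd rfl hβ | exact absurd rfl hν |
        (simp [baseMat]; try ring)
  funext γ
  rw [xi, Pi.neg_apply, coords]
  fin_cases γ <;> simp [bt, hi, h0, h1]

lemma psi_mulVec_eq (η : Matrix (Fin 4) (Fin 4) ℝ) (p : Fin 4) (u x : Fin 6 → ℝ) :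
    psi η p u *ᵥ x = psiForm η x u + omega η p *ᵥ x := by
  funext γ
  simp only [mulVec, dotProduct, psi, of_apply, psiForm, Pi.add_apply, add_mul, Finset.sum_add_distrib,
    Finset.sum_mul]
  congr 1
  exact Finset.sum_congr rfl fun i _ => Finset.sum_congr rfl fun k _ => by ring

lemma psiForm_skew {η : Matrix (Fin 4) (Fin 4) ℝ} (hη : η.IsSymm) (x y : Fin 6 → ℝ) :
    psiForm η x y = -psiForm η y x := by
  rw [psiForm_eq hη, psiForm_eq hη, comm_swap, coords_neg]

lemma congruence_eq_sub {η : Matrix (Fin 4) (Fin 4) ℝ} (hη : η.IsSymm) (p q : Fin 4) (u v : Fin 6 → ℝ) :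
    congruence η p q u v = psi η p u *ᵥ v - (omega η q *ᵥ u + xi η p q) := by
  have h : congruence η p q u v = (1 / 2 : ℝ) • (psiForm η v u - psiForm η u v) + omega η p *ᵥ v -
      omega η q *ᵥ u - xi η p q := by
    funext γ
    simp only [congruence, psiForm, Pi.sub_apply, Pi.add_apply, Pi.smul_apply, smul_eq_mul, mulVec, dotProduct,
      ← Finset.sum_sub_distrib]
    congr 4
    exact Finset.sum_congr rfl fun i _ => Finset.sum_congr rfl fun k _ => by ring
  rw [h, psi_mulVec_eq, psiForm_skew hη u v]
  module

/-- Since the commutator is bilinear, ψ(u) is the linear part, in the second argument, of the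
commutator with the full matrix L_p(u). -/
lemma psi_mulVec {η : Matrix (Fin 4) (Fin 4) ℝ} (hη : η.IsSymm) (hdet : IsUnit η.det) {p : Fin 4} (hp : p ≠ 0)
    (u x : Fin 6 → ℝ) : psi η p u *ᵥ x = coords (comm η⁻¹ (hessMat η p u) (symMat x)) := by
  rw [psi_mulVec_eq, psiForm_eq hη, omega_mulVec hη hdet hp, hessMat, comm_add_left, coords_add, add_comm]

lemma congruence_eq {η : Matrix (Fin 4) (Fin 4) ℝ} (hη : η.IsSymm) (hdet : IsUnit η.det) {p q : Fin 4}
    (hp : p ≠ 0) (hq : q ≠ 0) (u v : Fin 6 → ℝ) :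
    congruence η p q u v = coords (comm η⁻¹ (hessMat η p u) (hessMat η q v)) := by
  rw [congruence_eq_sub hη, psi_mulVec hη hdet hp, omega_mulVec hη hdet hq, xi_eq hdet hp hq, hessMat, hessMat,
    comm_add_right, comm_add_left _ _ _ (baseMat η q), comm_swap _ (symMat u) (baseMat η q)]
  simp only [coords_add, coords_neg]
  abel

lemma sum_pairs (g : Fin 4 → Fin 4 → ℝ) :
    ∑ γ, g (bt γ) (hi γ) = g 0 1 + g 0 2 + g 1 2 + g 0 3 + g 1 3 + g 2 3 := by
  rw [Fin.sum_univ_six]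
  rfl

/-- The bilinear form `φ` is a trace form. -/
lemma phi_form {η : Matrix (Fin 4) (Fin 4) ℝ} (hη : η.IsSymm) {A B : Matrix (Fin 4) (Fin 4) ℝ} (hA : Aᵀ = -A)
    (hB : Bᵀ = -B) : phi η *ᵥ coords A ⬝ᵥ coords B = -(1 / 2) * trace (A * η⁻¹ * (B * η⁻¹)) := by
  have hE : ∀ i j, η⁻¹ j i = η⁻¹ i j := fun i j => by
    have h : (η⁻¹)ᵀ = η⁻¹ := by rw [transpose_nonsing_inv, hη.eq]
    exact congrFun (congrFun h i) j
  have hs : ∀ i j, A j i = -A i j := fun i j => congrFun (congrFun hA i) j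
  have ht : ∀ i j, B j i = -B i j := fun i j => congrFun (congrFun hB i) j
  have hs0 : ∀ i, A i i = 0 := fun i => by linarith [hs i i]
  have ht0 : ∀ i, B i i = 0 := fun i => by linarith [ht i i]
  have e : phi η *ᵥ coords A ⬝ᵥ coords B = ∑ α, ∑ β, (η⁻¹ (hi α) (hi β) * η⁻¹ (bt α) (bt β) -
      η⁻¹ (hi α) (bt β) * η⁻¹ (hi β) (bt α)) * A (bt β) (hi β) * B (bt α) (hi α) := by
    simp only [mulVec, dotProduct, phi, of_apply, coords, Finset.sum_mul]
  rw [e, sum_pairs fun b h => ∑ β, (η⁻¹ h (hi β) * η⁻¹ b (bt β) - η⁻¹ h (bt β) * η⁻¹ (hi β) b) *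
      A (bt β) (hi β) * B b h]
  have e2 : ∀ b h, ∑ β, (η⁻¹ h (hi β) * η⁻¹ b (bt β) - η⁻¹ h (bt β) * η⁻¹ (hi β) b) * A (bt β) (hi β) * B b h =
      _ := fun b h => sum_pairs fun b' h' => (η⁻¹ h h' * η⁻¹ b b' - η⁻¹ h b' * η⁻¹ h' b) * A b' h' * B b h
  simp only [e2]
  simp only [trace, diag, Matrix.mul_apply, Fin.sum_univ_four]
  generalize η⁻¹ = E at hE
  simp only [hs0, ht0, hE 0 1, hE 0 2, hE 0 3, hE 1 2, hE 1 3, hE 2 3, hs 0 1, hs 0 2, hs 0 3, hs 1 2, hs 1 3,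
    hs 2 3, ht 0 1, ht 0 2, ht 0 3, ht 1 2, ht 1 3, ht 2 3]
  ring

end WDVV
end

noncomputable section
namespace WDVV

open Matrix

lemma inv_isSymm {η : Matrix (Fin 4) (Fin 4) ℝ} (hη : η.IsSymm) : (η⁻¹).IsSymm := by
  rw [IsSymm, transpose_nonsing_inv, hη.eq]

/-! ### Algebraic identities of the constants -/

/-- Invariance of the trace form moves A out of each first bracket; what is left is the trace of A
times the Jacobi identity for B, C, D. -/
lemma trace_lie_mul_lie (A B C D : Matrix (Fin 4) (Fin 4) ℝ) :
    trace (⁅A, B⁆ * ⁅C, D⁆) + trace (⁅A, C⁆ * ⁅D, B⁆) + trace (⁅A, D⁆ * ⁅B, C⁆) = 0 := by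
  have h : ∀ X Y : Matrix (Fin 4) (Fin 4) ℝ, trace (⁅A, X⁆ * Y) = trace (A * ⁅X, Y⁆) := by
    intro X Y
    simp only [Ring.lie_def, sub_mul, mul_sub, trace_sub, ← mul_assoc]
    rw [trace_mul_cycle X A Y, trace_mul_cycle Y X A]
  have hj : ⁅B, ⁅C, D⁆⁆ + ⁅C, ⁅D, B⁆⁆ + ⁅D, ⁅B, C⁆⁆ = 0 := by
    simp only [Ring.lie_def]
    noncomm_ring
  rw [h, h, h, ← trace_add, ← trace_add, ← mul_add, ← mul_add, hj, mul_zero, trace_zero]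

lemma comm_mul (E A B : Matrix (Fin 4) (Fin 4) ℝ) : comm E A B * E = ⁅A * E, B * E⁆ := by
  simp only [comm, Ring.lie_def, sub_mul, mul_assoc]

/-- Multiplication by η⁻¹ turns `comm` into an ordinary Lie bracket, and φ into the invariant trace
form. -/
lemma phi_comm_form {η : Matrix (Fin 4) (Fin 4) ℝ} (hη : η.IsSymm) {A B C D : Matrix (Fin 4) (Fin 4) ℝ}
    (hA : A.IsSymm) (hB : B.IsSymm) (hC : C.IsSymm) (hD : D.IsSymm) :
    phi η *ᵥ coords (comm η⁻¹ A B) ⬝ᵥ coords (comm η⁻¹ C D) +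
      phi η *ᵥ coords (comm η⁻¹ A C) ⬝ᵥ coords (comm η⁻¹ D B) +
      phi η *ᵥ coords (comm η⁻¹ A D) ⬝ᵥ coords (comm η⁻¹ B C) = 0 := by
  have hE := inv_isSymm hη
  rw [phi_form hη (comm_skew hE hA hB) (comm_skew hE hC hD), phi_form hη (comm_skew hE hA hC) (comm_skew hE hD hB),
    phi_form hη (comm_skew hE hA hD) (comm_skew hE hB hC), ← mul_add, ← mul_add]
  simp only [comm_mul, trace_lie_mul_lie, mul_zero]

lemma phi_isSymm {η : Matrix (Fin 4) (Fin 4) ℝ} (hη : η.IsSymm) : (phi η).IsSymm := by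
  have hE : ∀ i j, η⁻¹ j i = η⁻¹ i j := fun i j => congrFun (congrFun (inv_isSymm hη) i) j
  ext α β
  simp only [phi, transpose_apply, of_apply]
  rw [hE (hi α) (hi β), hE (bt α) (bt β)]
  ring

/-- The form `φ(ψ(u)x, ψ_{··}(y, z))` has vanishing cyclic sum. -/
lemma phi_cyclic {η : Matrix (Fin 4) (Fin 4) ℝ} (hη : η.IsSymm) (hdet : IsUnit η.det) {p : Fin 4} (hp : p ≠ 0)
    (u x y z : Fin 6 → ℝ) :
    phi η *ᵥ (psi η p u *ᵥ x) ⬝ᵥ psiForm η y z + phi η *ᵥ (psi η p u *ᵥ y) ⬝ᵥ psiForm η z x +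
      phi η *ᵥ (psi η p u *ᵥ z) ⬝ᵥ psiForm η x y = 0 := by
  have h := phi_comm_form hη (hessMat_isSymm η p u) (symMat_isSymm x) (symMat_isSymm z) (symMat_isSymm y)
  rw [psi_mulVec hη hdet hp, psi_mulVec hη hdet hp, psi_mulVec hη hdet hp, psiForm_eq hη, psiForm_eq hη,
    psiForm_eq hη]
  rw [← h]
  ring

/-- The same identity with `ω_q` in place of `ψ(u)`. -/
lemma phi_cyclic_omega {η : Matrix (Fin 4) (Fin 4) ℝ} (hη : η.IsSymm) (hdet : IsUnit η.det) {q : Fin 4} (hq : q ≠ 0)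
    (x y z : Fin 6 → ℝ) :
    phi η *ᵥ (omega η q *ᵥ x) ⬝ᵥ psiForm η y z + phi η *ᵥ (omega η q *ᵥ y) ⬝ᵥ psiForm η z x +
      phi η *ᵥ (omega η q *ᵥ z) ⬝ᵥ psiForm η x y = 0 := by
  have h : psi η q 0 = omega η q := by
    ext γ i
    simp [psi]
  rw [← h]
  exact phi_cyclic hη hdet hq 0 x y z

/-- `phi_comm_form` for B_p, S(x), B_q, S(y). The asymmetry of the form built from ω_p and ω_q is
thus measured by ξ, which the Hamiltonian density has to compensate. -/
lemma phi_omega_omega {η : Matrix (Fin 4) (Fin 4) ℝ} (hη : η.IsSymm) (hdet : IsUnit η.det) {p q : Fin 4}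
    (hp : p ≠ 0) (hq : q ≠ 0) (x y : Fin 6 → ℝ) :
    phi η *ᵥ (omega η p *ᵥ x) ⬝ᵥ omega η q *ᵥ y - phi η *ᵥ (omega η p *ᵥ y) ⬝ᵥ omega η q *ᵥ x =
      phi η *ᵥ xi η p q ⬝ᵥ psiForm η x y := by
  have h := phi_comm_form hη (baseMat_isSymm η p) (symMat_isSymm x) (baseMat_isSymm η q) (symMat_isSymm y)
  simp only [omega_mulVec hη hdet hp, omega_mulVec hη hdet hq, xi_eq hdet hp hq, psiForm_eq hη]
  rw [comm_swap _ (baseMat η q) (symMat x), coords_neg, dotProduct_neg] at h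
  rw [mulVec_neg, neg_dotProduct]
  linarith

/-- The skew-symmetric matrix with given entries above the diagonal. -/
def skewMat (a : Fin 6 → ℝ) : Matrix (Fin 4) (Fin 4) ℝ :=
  !![0, a 0, a 1, a 3; -a 0, 0, a 2, a 4; -a 1, -a 2, 0, a 5; -a 3, -a 4, -a 5, 0]

lemma coords_skewMat (a : Fin 6 → ℝ) : coords (skewMat a) = a := by
  funext γ
  fin_cases γ <;> rfl

lemma skewMat_transpose (a : Fin 6 → ℝ) : (skewMat a)ᵀ = -skewMat a := by
  ext i j
  fin_cases i <;> fin_cases j <;> simp [skewMat]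

/-- Pair a skew matrix A in the kernel with ηAη: the trace form becomes, up to a factor, tr(AᵀA),
which is definite although η need not be. -/
lemma isUnit_det_phi {η : Matrix (Fin 4) (Fin 4) ℝ} (hη : η.IsSymm) (hdet : IsUnit η.det) :
    IsUnit (phi η).det := by
  rw [isUnit_iff_ne_zero, ne_eq, ← exists_mulVec_eq_zero_iff]
  rintro ⟨a, ha, h⟩
  have hA := skewMat_transpose a
  have hB : (η * skewMat a * η)ᵀ = -(η * skewMat a * η) := by
    simp only [transpose_mul, hη.eq, hA, neg_mul, mul_neg, mul_assoc]
  have h1 := phi_form hη hA hB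
  rw [coords_skewMat, h, zero_dotProduct] at h1
  have h2 : skewMat a * η⁻¹ * (η * skewMat a * η * η⁻¹) = -((skewMat a)ᵀ * skewMat a) := by
    rw [mul_nonsing_inv_cancel_right _ _ hdet, mul_assoc, nonsing_inv_mul_cancel_left _ _ hdet, hA,
      neg_mul, neg_neg]
  rw [h2, trace_neg] at h1
  have h3 : trace ((skewMat a)ᵀ * skewMat a) = 0 := by linarith
  have h4 : skewMat a = 0 := by
    rw [← conjTranspose_eq_transpose_of_trivial] at h3
    exact trace_conjTranspose_mul_self_eq_zero_iff.1 h3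
  refine ha ?_
  rw [← coords_skewMat a, h4]
  rfl

/-! ### Cyclic vectors -/

section Krylov

variable {R S : Type*} [CommRing R] [CommRing S]

/-- The matrix with columns `M^j e₀`. -/
def krylov (M : Matrix (Fin 4) (Fin 4) R) : Matrix (Fin 4) (Fin 4) R := of fun i j => (M ^ (j : ℕ)) i 0

lemma krylov_map (f : R →+* S) (M : Matrix (Fin 4) (Fin 4) R) : (krylov M).map f = krylov (M.map f) := by
  ext i j
  have : f.mapMatrix (M ^ (j : ℕ)) = (f.mapMatrix M) ^ (j : ℕ) := map_pow _ _ _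
  exact congrFun (congrFun this i) 0

variable {M A B : Matrix (Fin 4) (Fin 4) R}

/-- A M^j e₀ = M^j A e₀ = 0, and the vectors M^j e₀ form a basis. -/
lemma eq_zero_of_commute (hM : IsUnit (krylov M).det) (hA : Commute A M) (h0 : ∀ i, A i 0 = 0) : A = 0 := by
  have h : A * krylov M = 0 := by
    ext i j
    have h1 : (A * krylov M) i j = (A * M ^ (j : ℕ)) i 0 := rfl
    rw [h1, (hA.pow_right _).eq, mul_apply]
    simp [h0]
  have := congrArg (· * (krylov M)⁻¹) h
  simpa [mul_nonsing_inv_cancel_right _ _ hM] using this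

/-- Choose the polynomial in M that agrees with A on the cyclic vector; the difference commutes with
M and kills that vector. -/
lemma exists_eq_sum_of_commute (hM : IsUnit (krylov M).det) (hA : Commute A M) :
    ∃ c : Fin 4 → R, A = ∑ j, c j • M ^ (j : ℕ) := by
  refine ⟨(krylov M)⁻¹ *ᵥ fun i => A i 0, sub_eq_zero.1 (eq_zero_of_commute hM ?_ fun i => ?_)⟩
  · refine hA.sub_left (Commute.sum_left _ _ _ fun j _ => ?_)
    exact ((Commute.refl M).pow_left _).smul_left _
  · have h1 : (∑ j, ((krylov M)⁻¹ *ᵥ fun i => A i 0) j • M ^ (j : ℕ)) i 0 =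
        (krylov M *ᵥ ((krylov M)⁻¹ *ᵥ fun i => A i 0)) i := by
      rw [Matrix.sum_apply]
      simp only [Matrix.smul_apply, smul_eq_mul, mulVec, dotProduct]
      exact Finset.sum_congr rfl fun j _ => mul_comm _ _
    rw [Matrix.sub_apply, h1, mulVec_mulVec, mul_nonsing_inv _ hM, one_mulVec, sub_self]

lemma commute_of_commute (hM : IsUnit (krylov M).det) (hA : Commute A M) (hB : Commute B M) : Commute A B := by
  obtain ⟨c, rfl⟩ := exists_eq_sum_of_commute hM hA
  exact Commute.sum_left _ _ _ fun j _ => (hB.symm.pow_left _).smul_left _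

lemma selfAdjoint_of_commute {G : Matrix (Fin 4) (Fin 4) R} (hM : IsUnit (krylov M).det) (hMG : Mᵀ * G = G * M)
    (hA : Commute A M) : Aᵀ * G = G * A := by
  obtain ⟨c, rfl⟩ := exists_eq_sum_of_commute hM hA
  have h : ∀ k : ℕ, (M ^ k)ᵀ * G = G * M ^ k := by
    intro k
    induction k with
    | zero => simp
    | succ k ih => rw [pow_succ, transpose_mul, mul_assoc, ih, ← mul_assoc, hMG, mul_assoc, ← pow_succ', pow_succ]
  simp only [transpose_sum, transpose_smul, Finset.sum_mul, Finset.mul_sum, smul_mul_assoc, mul_smul_comm, h]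

end Krylov

end WDVV
end

noncomputable section
namespace WDVV

open Matrix

/-! ### Existence of cyclic vectors and density of the regular set -/

/-- Real numbers that make a two-by-two minor nonzero; `e, k, l, g, h, x, y, z` are the entries of a symmetric
`4 × 4` matrix and `n, m, a, b` a row of its inverse. -/
lemma exists_minor_ne_zero (e k l g₁ g₂ h₁ h₂ x y z n m a b : ℝ)
    (f₁ : n * e + m * k + a * g₁ + b * g₂ = 0) (f₂ : n * k + m * l + a * h₁ + b * h₂ = 1)
    (f₃ : n * g₁ + m * h₁ + a * x + b * y = 0) (f₄ : n * g₂ + m * h₂ + a * y + b * z = 0)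
    (hrow : ∀ α β, α * g₁ + β * g₂ = 0 → α * h₁ + β * h₂ = 0 → α * x + β * y = 0 → α * y + β * z = 0 →
      α = 0 ∧ β = 0) :
    ∃ s c d t r : ℝ, ∀ w, w = m * (m * e + s * k + c * g₁ + d * g₂) + s * (m * k + s * l + c * h₁ + d * h₂) +
        c * (m * g₁ + s * h₁ + c * x + d * y) + d * (m * g₂ + s * h₂ + c * y + d * z) →
      (m * g₁ + s * h₁ + c * x + d * y) * (s * g₂ + w * h₂ + t * y + r * z) -
        (m * g₂ + s * h₂ + c * y + d * z) * (s * g₁ + w * h₁ + t * x + r * y) ≠ 0 := by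
  by_contra! hcon
  -- `w` does not involve `t` and `r`, and the minor is affine in them; subtracting its value at `t
  -- = r = 0` eliminates `w`.
  have H : ∀ s c d t r,
      (m * g₁ + s * h₁ + c * x + d * y) * (t * y + r * z) - (m * g₂ + s * h₂ + c * y + d * z) * (t * x + r * y) = 0 := by
    intro s c d t r
    obtain ⟨w, rfl, h₁⟩ := hcon s c d t r
    obtain ⟨w, rfl, h₂⟩ := hcon s c d 0 0
    linear_combination h₁ - h₂
  have hF : x * z - y * y = 0 := by linear_combination H 0 1 0 0 1 - H 0 0 0 0 1
  have hh1 : h₁ * y - h₂ * x = 0 := by linear_combination H 1 0 0 1 0 - H 0 0 0 1 0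
  have hh2 : h₁ * z - h₂ * y = 0 := by linear_combination H 1 0 0 0 1 - H 0 0 0 0 1
  have hm1 : m * (g₁ * y - g₂ * x) = 0 := by linear_combination H 0 0 0 1 0
  have hm2 : m * (g₁ * z - g₂ * y) = 0 := by linear_combination H 0 0 0 0 1
  -- So far (h₁,h₂), (x,y) and (y,z) are pairwise proportional. If (g₁,g₂) is proportional to the
  -- last two as well, independence of the rows forces x = y = z = 0, then m = 0, and s = 1 with the
  -- other parameters zero gives a nonzero minor. Otherwise n, m, a and b all vanish, contradicting
  -- `f₂`.
  by_cases hg : g₁ * y - g₂ * x = 0 ∧ g₁ * z - g₂ * y = 0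
  · obtain ⟨hg1, hg2⟩ := hg
    have c1 := hrow y (-x) (by linear_combination hg1) (by linear_combination hh1) (by ring) (by linear_combination -hF)
    have c2 := hrow z (-y) (by linear_combination hg2) (by linear_combination hh2) (by linear_combination hF) (by ring)
    obtain ⟨rfl, hx⟩ := c1
    obtain ⟨rfl, -⟩ := c2
    have hx : x = 0 := by linarith
    subst hx
    have hgh : g₁ * h₂ - g₂ * h₁ ≠ 0 := by
      intro h0
      obtain ⟨e1, e2⟩ := hrow g₂ (-g₁) (by ring) (by linear_combination -h0) (by ring) (by ring)
      obtain ⟨e3, e4⟩ := hrow h₂ (-h₁) (by linear_combination h0) (by ring) (by ring) (by ring)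
      have := hrow 1 0 (by linarith) (by linarith) (by ring) (by ring)
      exact one_ne_zero this.1
    have hm : m = 0 := by
      have : m * (g₁ * h₂ - g₂ * h₁) = 0 := by linear_combination g₁ * f₄ - g₂ * f₃
      exact (mul_eq_zero.1 this).resolve_right hgh
    subst hm
    obtain ⟨w, -, h⟩ := hcon 1 0 0 0 0
    refine hgh ?_
    linear_combination -h
  · have hm : m = 0 := by
      by_contra hm0
      exact hg ⟨(mul_eq_zero.1 hm1).resolve_left hm0, (mul_eq_zero.1 hm2).resolve_left hm0⟩
    subst hm
    have hn : n = 0 := by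
      by_contra hn0
      refine hg ⟨(mul_eq_zero.1 ?_).resolve_left hn0, (mul_eq_zero.1 ?_).resolve_left hn0⟩
      · linear_combination y * f₃ - x * f₄ + b * hF
      · linear_combination z * f₃ - y * f₄ - a * hF
    subst hn
    have ha : a = 0 := by
      by_contra ha0
      refine hg ⟨(mul_eq_zero.1 ?_).resolve_left ha0, (mul_eq_zero.1 ?_).resolve_left ha0⟩
      · linear_combination y * f₁ - g₂ * f₃
      · linear_combination z * f₁ - g₂ * f₄
    have hb : b = 0 := by
      by_contra hb0
      refine hg ⟨(mul_eq_zero.1 ?_).resolve_left hb0, (mul_eq_zero.1 ?_).resolve_left hb0⟩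
      · linear_combination g₁ * f₃ - x * f₁
      · linear_combination g₁ * f₄ - y * f₁
    subst ha hb
    linarith

/-- Listing the indices as 0, p, q, r treats the three values of `p` uniformly. -/
lemma exists_complementary_pair {p : Fin 4} (hp : p ≠ 0) : ∃ q r : Fin 4, q ≠ 0 ∧ r ≠ 0 ∧ q ≠ p ∧ r ≠ p ∧ r ≠ q ∧
    ∀ f : Fin 4 → ℝ, ∑ i, f i = f 0 + f p + f q + f r := by
  fin_cases p
  · exact absurd rfl hp
  · exact ⟨2, 3, by decide, by decide, by decide, by decide, by decide, fun f => Fin.sum_univ_four f⟩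
  · exact ⟨1, 3, by decide, by decide, by decide, by decide, by decide, fun f => by
      rw [Fin.sum_univ_four]; simp only [Fin.reduceFinMk]; ring⟩
  · exact ⟨1, 2, by decide, by decide, by decide, by decide, by decide, fun f => by
      rw [Fin.sum_univ_four]; simp only [Fin.reduceFinMk]; ring⟩

/-- Independent vectors `v₀ = e₀, v₁ = e_p, v₂, v₃` whose Gram matrix is a Hankel matrix. -/
lemma exists_hankel_basis {η : Matrix (Fin 4) (Fin 4) ℝ} (hη : η.IsSymm) (hdet : IsUnit η.det) {p : Fin 4}
    (hp : p ≠ 0) : ∃ (K : Matrix (Fin 4) (Fin 4) ℝ) (g : ℕ → ℝ), IsUnit K.det ∧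
      (∀ i, K i 0 = if i = 0 then 1 else 0) ∧ (∀ i, K i 1 = if i = p then 1 else 0) ∧
      ∀ i j : Fin 4, (Kᵀ * η * K) i j = g (i + j) := by
  obtain ⟨q, r, hq0, hr0, hqp, hrp, hrq, hsum⟩ := exists_complementary_pair hp
  have hE : ∀ i j, η⁻¹ j i = η⁻¹ i j := fun i j => congrFun (congrFun (inv_isSymm hη) i) j
  have hrowp : ∀ j, η p 0 * η⁻¹ 0 j + η p p * η⁻¹ p j + η p q * η⁻¹ q j + η p r * η⁻¹ r j = if p = j then 1 else 0 := by
    intro j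
    rw [← hsum fun i => η p i * η⁻¹ i j, ← mul_apply, mul_nonsing_inv _ hdet, one_apply]
  have hrow : ∀ α β, (∀ j, α * η⁻¹ q j + β * η⁻¹ r j = 0) → α = 0 ∧ β = 0 := by
    intro α β h
    have h1 : ∀ i, α * (1 : Matrix (Fin 4) (Fin 4) ℝ) q i + β * (1 : Matrix (Fin 4) (Fin 4) ℝ) r i = 0 := by
      intro i
      rw [← nonsing_inv_mul _ hdet, mul_apply, mul_apply, Finset.mul_sum, Finset.mul_sum, ← Finset.sum_add_distrib]
      refine Finset.sum_eq_zero fun j _ => ?_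
      rw [← mul_assoc, ← mul_assoc, ← add_mul, h j, zero_mul]
    have hq := h1 q
    have hr := h1 r
    simp only [one_apply_eq, one_apply_ne hrq, one_apply_ne hrq.symm] at hq hr
    exact ⟨by linarith, by linarith⟩
  obtain ⟨s, c, d, t, w', hmin⟩ := exists_minor_ne_zero (η⁻¹ 0 0) (η⁻¹ 0 p) (η⁻¹ p p) (η⁻¹ q 0) (η⁻¹ r 0)
    (η⁻¹ q p) (η⁻¹ r p) (η⁻¹ q q) (η⁻¹ q r) (η⁻¹ r r) (η p 0) (η p p) (η p q) (η p r)
    (by rw [hE p 0]; simpa [hp] using hrowp 0) (by simpa using hrowp p)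
    (by rw [hE 0 q, hE p q, hE r q]; simpa [hqp.symm] using hrowp q)
    (by rw [hE 0 r, hE p r]; simpa [hrp.symm] using hrowp r)
    (fun α β h0 h1 h2 h3 => hrow α β fun j => by
      -- Summing the squares of `f` shows that vanishing at 0, p, q, r means vanishing everywhere.
      have key : ∀ f : Fin 4 → ℝ, f 0 = 0 → f p = 0 → f q = 0 → f r = 0 → f j = 0 := by
        intro f a0 ap aq ar
        have := hsum fun i => f i ^ 2
        rw [a0, ap, aq, ar] at this
        have h5 : f j ^ 2 ≤ ∑ i, f i ^ 2 := Finset.single_le_sum (f := fun i => f i ^ 2) (fun i _ => sq_nonneg _) (Finset.mem_univ j)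
        nlinarith [sq_nonneg (f j)]
      exact key (fun j => α * η⁻¹ q j + β * η⁻¹ r j) h0 h1 (by rw [hE q r]; exact h2) h3)
  obtain ⟨w, hw⟩ : ∃ w, w = η p p * (η p p * η⁻¹ 0 0 + s * η⁻¹ 0 p + c * η⁻¹ q 0 + d * η⁻¹ r 0) +
      s * (η p p * η⁻¹ 0 p + s * η⁻¹ p p + c * η⁻¹ q p + d * η⁻¹ r p) +
      c * (η p p * η⁻¹ q 0 + s * η⁻¹ q p + c * η⁻¹ q q + d * η⁻¹ q r) +
      d * (η p p * η⁻¹ r 0 + s * η⁻¹ r p + c * η⁻¹ q r + d * η⁻¹ r r) := ⟨_, rfl⟩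
  have hmin := hmin w hw
  -- These are the covectors ηv₂ and ηv₃. Their entries at 0 and p are dictated by the Hankel
  -- conditions v₀·v₂ = v₁·v₁, v₀·v₃ = v₁·v₂ and v₁·v₃ = v₂·v₂ for the scalar product η; the entries
  -- at q and r are the free parameters.
  let k₂ : Fin 4 → ℝ := fun i => if i = 0 then η p p else if i = p then s else if i = q then c else d
  let k₃ : Fin 4 → ℝ := fun i => if i = 0 then s else if i = p then w else if i = q then t else w'
  have k20 : k₂ 0 = η p p := by simp [k₂]
  have k2p : k₂ p = s := by simp [k₂, hp]
  have k2q : k₂ q = c := by simp [k₂, hq0, hqp]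
  have k2r : k₂ r = d := by simp [k₂, hr0, hrp, hrq]
  have k30 : k₃ 0 = s := by simp [k₃]
  have k3p : k₃ p = w := by simp [k₃, hp]
  have k3q : k₃ q = t := by simp [k₃, hq0, hqp]
  have k3r : k₃ r = w' := by simp [k₃, hr0, hrp, hrq]
  have hEk : ∀ (k : Fin 4 → ℝ) i, (η⁻¹ *ᵥ k) i = η⁻¹ i 0 * k 0 + η⁻¹ i p * k p + η⁻¹ i q * k q + η⁻¹ i r * k r :=
    fun k i => hsum fun j => η⁻¹ i j * k j
  let v : Fin 4 → Fin 4 → ℝ := ![Pi.single 0 1, Pi.single p 1, η⁻¹ *ᵥ k₂, η⁻¹ *ᵥ k₃]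
  have hηv : ∀ k : Fin 4 → ℝ, η *ᵥ (η⁻¹ *ᵥ k) = k := fun k => by
    rw [mulVec_mulVec, mul_nonsing_inv _ hdet, one_mulVec]
  have hsymm : ∀ x y : Fin 4 → ℝ, x ⬝ᵥ η *ᵥ y = y ⬝ᵥ η *ᵥ x := fun x y => by
    rw [dotProduct_mulVec, ← mulVec_transpose, hη.eq, dotProduct_comm]
  have hG : ∀ i j, ((of v) * η * (of v)ᵀ) i j = v i ⬝ᵥ η *ᵥ v j := fun i j => by
    rw [Matrix.mul_assoc]
    rfl
  have v0 : v 0 = Pi.single 0 1 := rfl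
  have v1 : v 1 = Pi.single p 1 := rfl
  have v2 : v 2 = η⁻¹ *ᵥ k₂ := rfl
  have v3 : v 3 = η⁻¹ *ᵥ k₃ := rfl
  have hs2 : ∀ x, x ⬝ᵥ η *ᵥ v 2 = x ⬝ᵥ k₂ := fun x => by rw [v2, hηv]
  have hs3 : ∀ x, x ⬝ᵥ η *ᵥ v 3 = x ⬝ᵥ k₃ := fun x => by rw [v3, hηv]
  have hpp : v 1 ⬝ᵥ η *ᵥ v 1 = η p p := by simp [v1]
  have h02 : v 0 ⬝ᵥ η *ᵥ v 2 = v 1 ⬝ᵥ η *ᵥ v 1 := by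
    rw [hs2, hpp, v0, single_one_dotProduct, k20]
  have h12 : v 1 ⬝ᵥ η *ᵥ v 2 = s := by rw [hs2, v1, single_one_dotProduct, k2p]
  have h03 : v 0 ⬝ᵥ η *ᵥ v 3 = s := by rw [hs3, v0, single_one_dotProduct, k30]
  have h22 : v 2 ⬝ᵥ η *ᵥ v 2 = w := by
    rw [hs2, v2, dotProduct, hsum, hEk, hEk, hEk, hEk, k20, k2p, k2q, k2r, hw, hE 0 p, hE q 0, hE r 0, hE q p,
      hE r p, hE r q]
    rw [hE q r]
    ring
  have h13 : v 1 ⬝ᵥ η *ᵥ v 3 = w := by rw [hs3, v1, single_one_dotProduct, k3p]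
  -- The Gram matrix uses g only up to index 6, which falls in the final branch; larger values are
  -- arbitrary.
  refine ⟨(of v)ᵀ, fun n => if n = 0 then v 0 ⬝ᵥ η *ᵥ v 0 else if n = 1 then v 0 ⬝ᵥ η *ᵥ v 1 else
    if n = 2 then v 1 ⬝ᵥ η *ᵥ v 1 else if n = 3 then s else if n = 4 then w else
    if n = 5 then v 2 ⬝ᵥ η *ᵥ v 3 else v 3 ⬝ᵥ η *ᵥ v 3, ?_, ?_, ?_, ?_⟩
  · rw [isUnit_iff_ne_zero, ne_eq, ← exists_mulVec_eq_zero_iff]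
    rintro ⟨x, hx, h⟩
    -- Rows q and r involve only v₂ and v₃, so the nonzero minor kills their coefficients first.
    have hi : ∀ i, v 0 i * x 0 + v 1 i * x 1 + v 2 i * x 2 + v 3 i * x 3 = 0 := fun i => by
      have := congrFun h i
      rw [mulVec, dotProduct, Fin.sum_univ_four] at this
      exact this
    have eq := hi q
    have er := hi r
    rw [v0, v1, v2, v3, Pi.single_eq_of_ne hq0, Pi.single_eq_of_ne hqp, hEk, hEk, k20, k2p, k2q, k2r, k30, k3p,
      k3q, k3r] at eq
    rw [v0, v1, v2, v3, Pi.single_eq_of_ne hr0, Pi.single_eq_of_ne hrp, hEk, hEk, k20, k2p, k2q, k2r, k30, k3p,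
      k3q, k3r, hE q r] at er
    have x2 : x 2 = 0 := by
      refine (mul_eq_zero.1 ?_).resolve_right hmin
      linear_combination (s * η⁻¹ r 0 + w * η⁻¹ r p + t * η⁻¹ q r + w' * η⁻¹ r r) * eq -
        (s * η⁻¹ q 0 + w * η⁻¹ q p + t * η⁻¹ q q + w' * η⁻¹ q r) * er
    have x3 : x 3 = 0 := by
      refine (mul_eq_zero.1 ?_).resolve_right hmin
      linear_combination (η p p * η⁻¹ q 0 + s * η⁻¹ q p + c * η⁻¹ q q + d * η⁻¹ q r) * er -
        (η p p * η⁻¹ r 0 + s * η⁻¹ r p + c * η⁻¹ q r + d * η⁻¹ r r) * eq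
    have e0 := hi 0
    have ep := hi p
    rw [x2, x3, v0, v1, Pi.single_eq_same, Pi.single_eq_of_ne hp.symm] at e0
    rw [x2, x3, v0, v1, Pi.single_eq_same, Pi.single_eq_of_ne hp] at ep
    refine hx (funext fun i => ?_)
    fin_cases i
    · change x 0 = 0
      linarith
    · change x 1 = 0
      linarith
    · exact x2
    · exact x3
  · intro i
    exact Pi.single_apply _ _ _
  · intro i
    exact Pi.single_apply _ _ _
  · intro i j
    rw [transpose_transpose, hG]
    fin_cases i <;> fin_cases j <;> simp only [Fin.reduceFinMk, Fin.zero_eta, Fin.mk_one] <;> first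
      | rfl | exact h02 | exact h12 | exact h03 | exact h22 | exact h13 | exact (hsymm _ _)
      | exact (hsymm _ _).trans h02 | exact (hsymm _ _).trans h12 | exact (hsymm _ _).trans h03
      | exact (hsymm _ _).trans h13

end WDVV
end

noncomputable section
namespace WDVV

open Matrix

variable {η : Matrix (Fin 4) (Fin 4) ℝ} {p : Fin 4}

/-! ### Points where e₀ is cyclic, and density of the regular set. -/

lemma exists_hessMat_eq {L : Matrix (Fin 4) (Fin 4) ℝ} (hL : L.IsSymm) (h0 : ∀ i, L i 0 = η p i) :
    ∃ u, hessMat η p u = L := by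
  have hs : ∀ i j, L j i = L i j := fun i j => congrFun (congrFun hL i) j
  refine ⟨![L 1 1, L 1 2, L 2 2, L 1 3, L 2 3, L 3 3], ?_⟩
  ext i j
  fin_cases i <;> fin_cases j <;>
    simp [hessMat, baseMat, symMat, ← h0, hs 0 1, hs 0 2, hs 0 3, hs 1 2, hs 1 3, hs 2 3]

/-- The points at which `e₀` is a cyclic vector of the matrix `(F_{pα}{}^β)`. -/
def cyclicSet (η : Matrix (Fin 4) (Fin 4) ℝ) (p : Fin 4) : Set (Fin 6 → ℝ) :=
  {u | IsUnit (krylov (η⁻¹ * hessMat η p u)).det}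

/-- In a basis v_j with Gram matrix g(i+j), let L be the symmetric form with matrix g(i+j+1). Its
column j is column j+1 of the Gram matrix, so η⁻¹L sends v_j to v_{j+1} for j < 3. Since v₀ = e₀ and
v₁ = e_p, the first column of L is the prescribed one, so L is an admissible L_p with cyclic vector
e₀. -/
lemma cyclicSet_nonempty (hη : η.IsSymm) (hdet : IsUnit η.det) (hp : p ≠ 0) : (cyclicSet η p).Nonempty := by
  obtain ⟨K, g, hK, hK0, hK1, hg⟩ := exists_hankel_basis hη hdet hp
  have hKt : IsUnit Kᵀ.det := by rwa [det_transpose]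
  let H : Matrix (Fin 4) (Fin 4) ℝ := of fun i j => g (i + j + 1)
  have hH : H.IsSymm := by
    ext i j
    simp only [H, transpose_apply, of_apply, add_comm (i : ℕ)]
  let L : Matrix (Fin 4) (Fin 4) ℝ := (Kᵀ)⁻¹ * H * K⁻¹
  have hL : L.IsSymm := by
    simp only [L, IsSymm, transpose_mul, transpose_nonsing_inv, transpose_transpose, hH.eq, Matrix.mul_assoc]
  have hLK : Kᵀ * (L * K) = H := by
    simp only [L]
    rw [nonsing_inv_mul_cancel_right _ _ hK, mul_nonsing_inv_cancel_left _ _ hKt]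
  have hshift : ∀ (j j' : Fin 4), (j' : ℕ) = j + 1 → ∀ i, (L * K) i j = (η * K) i j' := by
    intro j j' hj i
    have h1 : Kᵀ *ᵥ (fun i => (L * K) i j) = Kᵀ *ᵥ fun i => (η * K) i j' := by
      funext i
      have e1 : (Kᵀ *ᵥ fun i => (L * K) i j) i = (Kᵀ * (L * K)) i j := rfl
      have e2 : (Kᵀ *ᵥ fun i => (η * K) i j') i = (Kᵀ * (η * K)) i j' := rfl
      rw [e1, e2, hLK, ← Matrix.mul_assoc, hg, hj]
      rfl
    have h2 := congrArg ((Kᵀ)⁻¹ *ᵥ ·) h1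
    simp only [mulVec_mulVec, nonsing_inv_mul _ hKt, one_mulVec] at h2
    exact congrFun h2 i
  have hL0 : ∀ i, L i 0 = η p i := by
    intro i
    have h := hshift 0 1 rfl i
    simp only [mul_apply, hK0, hK1, mul_ite, mul_one, mul_zero, Finset.sum_ite_eq', Finset.mem_univ, if_true] at h
    rw [h]
    exact congrFun (congrFun hη p) i
  obtain ⟨u, hu⟩ := exists_hessMat_eq hL hL0
  refine ⟨u, ?_⟩
  have hcol : ∀ (j j' : Fin 4), (j' : ℕ) = j + 1 → ∀ i, ((η⁻¹ * L) * K) i j = K i j' := by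
    intro j j' hj i
    have e1 : ((η⁻¹ * L) * K) i j = (η⁻¹ *ᵥ fun i => (L * K) i j) i := by
      rw [Matrix.mul_assoc]
      rfl
    rw [e1, funext (hshift j j' hj)]
    have e2 : (η⁻¹ *ᵥ fun i => (η * K) i j') i = (η⁻¹ * (η * K)) i j' := rfl
    rw [e2, nonsing_inv_mul_cancel_left _ _ hdet]
  have hkr : ∀ (k : ℕ) (j : Fin 4), (j : ℕ) = k → ∀ i, ((η⁻¹ * L) ^ k) i 0 = K i j := by
    intro k
    induction k with
    | zero =>
      intro j hj i
      obtain rfl : j = 0 := Fin.ext hj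
      rw [pow_zero, hK0, one_apply]
    | succ k ih =>
      intro j hj i
      have hk : k < 4 := by
        have := j.2
        omega
      rw [← hcol ⟨k, hk⟩ j hj, pow_succ', mul_apply, mul_apply]
      exact Finset.sum_congr rfl fun l _ => by rw [ih ⟨k, hk⟩ rfl]
  have : krylov (η⁻¹ * L) = K := by
    ext i j
    exact hkr j j rfl i
  change IsUnit (krylov (η⁻¹ * hessMat η p u)).det
  rw [hu, this]
  exact hK

lemma symMat_smul (c : ℝ) (x : Fin 6 → ℝ) : symMat (c • x) = c • symMat x := by
  ext i j
  fin_cases i <;> fin_cases j <;> simp [symMat]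

/-- On the line from `u` to a known cyclic point the Krylov determinant is a polynomial in `t` that
is nonzero at `t = 1`. It has finitely many roots, so `t = 0` is a limit of good parameters. -/
lemma dense_cyclicSet (hη : η.IsSymm) (hdet : IsUnit η.det) (hp : p ≠ 0) : Dense (cyclicSet η p) := by
  obtain ⟨u₀, h₀⟩ := cyclicSet_nonempty hη hdet hp
  intro u
  let c : ℝ →+* Polynomial ℝ := Polynomial.C
  let P : Polynomial ℝ := (krylov (η⁻¹.map c *
    ((hessMat η p u).map c + (Polynomial.X : Polynomial ℝ) • (symMat (u₀ - u)).map c))).det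
  have hP : ∀ t : ℝ, P.eval t = (krylov (η⁻¹ * hessMat η p (u + t • (u₀ - u)))).det := by
    intro t
    have h1 : P.eval t = Polynomial.evalRingHom t P := rfl
    rw [h1, RingHom.map_det, RingHom.mapMatrix_apply, krylov_map]
    congr 2
    have h2 : hessMat η p (u + t • (u₀ - u)) = hessMat η p u + t • symMat (u₀ - u) := by
      rw [hessMat, symMat_add, symMat_smul, ← add_assoc]
      rfl
    rw [h2, Matrix.map_mul]
    congr 1
    · ext i j
      simp [c]
    · ext i j
      simp only [c, map_apply, Matrix.add_apply, Matrix.smul_apply, smul_eq_mul,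
        Polynomial.coe_evalRingHom, Polynomial.eval_C, Polynomial.eval_X, Polynomial.eval_add, Polynomial.eval_mul]
  have hne : P ≠ 0 := by
    intro h
    have h1 := hP 1
    rw [h, Polynomial.eval_zero, one_smul, add_sub_cancel] at h1
    exact h₀.ne_zero h1.symm
  have hdense : Dense ({t : ℝ | P.IsRoot t}ᶜ) :=
    (Polynomial.finite_setOfPred_isRoot hne).countable.dense_compl ℝ
  have hc : Continuous fun t : ℝ => u + t • (u₀ - u) := by fun_prop
  have h := map_mem_closure hc (hdense 0) (t := cyclicSet η p) (by
    intro t ht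
    change IsUnit (krylov (η⁻¹ * hessMat η p (u + t • (u₀ - u)))).det
    rw [← hP, isUnit_iff_ne_zero]
    exact ht)
  simpa using h

lemma commute_of_comm_eq_zero {A B : Matrix (Fin 4) (Fin 4) ℝ} (h : comm η⁻¹ A B = 0) :
    Commute (η⁻¹ * B) (η⁻¹ * A) := by
  have h' : A * η⁻¹ * B = B * η⁻¹ * A := sub_eq_zero.1 h
  rw [commute_iff_eq, Matrix.mul_assoc, ← Matrix.mul_assoc B, ← h', Matrix.mul_assoc, Matrix.mul_assoc]

lemma comm_eq_zero_of_coords (hη : η.IsSymm) {A B : Matrix (Fin 4) (Fin 4) ℝ} (hA : A.IsSymm) (hB : B.IsSymm)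
    (h : coords (comm η⁻¹ A B) = 0) : comm η⁻¹ A B = 0 :=
  coords_injective (comm_skew (inv_isSymm hη) hA hB) h

/-- If ψ(u)x = 0, then η⁻¹S(x) commutes with η⁻¹L_p(u). It kills e₀ because S(x) has zero first
column, so cyclicity makes it zero. -/
lemma cyclicSet_subset (hη : η.IsSymm) (hdet : IsUnit η.det) (hp : p ≠ 0) : cyclicSet η p ⊆ regularSet η p := by
  intro u hu
  change IsUnit (psi η p u).det
  rw [isUnit_iff_ne_zero, ne_eq, ← exists_mulVec_eq_zero_iff]
  rintro ⟨x, hx, h⟩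
  rw [psi_mulVec hη hdet hp] at h
  have h1 := comm_eq_zero_of_coords hη (hessMat_isSymm η p u) (symMat_isSymm x) h
  have h2 := eq_zero_of_commute hu (commute_of_comm_eq_zero h1) (fun i => by
    rw [mul_apply]
    refine Finset.sum_eq_zero fun j _ => ?_
    have : symMat x j 0 = 0 := by fin_cases j <;> rfl
    rw [this, mul_zero])
  refine hx (symMat_injective ?_)
  rw [← mul_nonsing_inv_cancel_left η (symMat x) hdet, h2, mul_zero]

lemma dense_regularSet (hη : η.IsSymm) (hdet : IsUnit η.det) (hp : p ≠ 0) : Dense (regularSet η p) :=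
  (dense_cyclicSet hη hdet hp).mono (cyclicSet_subset hη hdet hp)

lemma continuous_psi (η : Matrix (Fin 4) (Fin 4) ℝ) (p : Fin 4) : Continuous (psi η p) := by
  refine continuous_matrix fun γ i => ?_
  simp only [psi, of_apply]
  fun_prop

lemma isOpen_regularSet (η : Matrix (Fin 4) (Fin 4) ℝ) (p : Fin 4) : IsOpen (regularSet η p) := by
  have : regularSet η p = (fun u => (psi η p u).det) ⁻¹' {0}ᶜ := by
    ext u
    exact isUnit_iff_ne_zero
  rw [this]
  exact isOpen_compl_singleton.preimage (continuous_psi η p).matrix_det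

/-! ### The fluxes -/

lemma psi_mulVec_flux (q : Fin 4) {u : Fin 6 → ℝ} (hu : u ∈ regularSet η p) :
    psi η p u *ᵥ flux η p q u = omega η q *ᵥ u + xi η p q := by
  rw [flux, mulVec_mulVec, mul_nonsing_inv _ hu, one_mulVec]

lemma congruence_eq_zero_iff (hη : η.IsSymm) (q : Fin 4) {u : Fin 6 → ℝ} (hu : u ∈ regularSet η p)
    (v : Fin 6 → ℝ) : (∀ γ, congruence η p q u v γ = 0) ↔ v = flux η p q u := by
  have h : (∀ γ, congruence η p q u v γ = 0) ↔ psi η p u *ᵥ v = omega η q *ᵥ u + xi η p q := by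
    rw [← sub_eq_zero, ← congruence_eq_sub hη]
    exact ⟨fun h => funext h, fun h γ => congrFun h γ⟩
  rw [h, ← psi_mulVec_flux q hu]
  refine ⟨fun h => ?_, fun h => by rw [h]⟩
  have h1 := congrArg ((psi η p u)⁻¹ *ᵥ ·) h
  simpa only [mulVec_mulVec, nonsing_inv_mul _ hu, one_mulVec] using h1

/-! ### Commuting Jacobians of the fluxes. -/

/-- The Jacobian matrix of the flux. -/
def fluxJac (η : Matrix (Fin 4) (Fin 4) ℝ) (p q : Fin 4) (u : Fin 6 → ℝ) : Matrix (Fin 6) (Fin 6) ℝ :=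
  (psi η p u)⁻¹ * psi η q (flux η p q u)

lemma lie_eq_of_coords (hη : η.IsSymm) {A B C D : Matrix (Fin 4) (Fin 4) ℝ} (hA : A.IsSymm) (hB : B.IsSymm)
    (hC : C.IsSymm) (hD : D.IsSymm) (h : coords (comm η⁻¹ A B) = coords (comm η⁻¹ C D)) :
    ⁅η⁻¹ * A, η⁻¹ * B⁆ = ⁅η⁻¹ * C, η⁻¹ * D⁆ := by
  have hE := inv_isSymm hη
  have h1 : comm η⁻¹ A B - comm η⁻¹ C D = 0 := by
    refine coords_injective ?_ ?_
    · rw [transpose_sub, comm_skew hE hA hB, comm_skew hE hC hD]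
      abel
    · exact sub_eq_zero.2 h
  have h2 := congrArg (η⁻¹ * ·) (sub_eq_zero.1 h1)
  simpa only [comm, Ring.lie_def, mul_sub, Matrix.mul_assoc] using h2

/-- Put P = η⁻¹L_p, Q = η⁻¹L_q and R = η⁻¹L_r. Both Q and R commute with P, hence with each other by
cyclicity. The Jacobian J_q is characterised by [P, η⁻¹S(J_q x)] = [Q, η⁻¹S(x)], and similarly for
r, so the claim reduces to ad_Q and ad_R commuting, plus the removal of ad_P twice. -/
lemma fluxJac_commute_of_cyclic (hη : η.IsSymm) (hdet : IsUnit η.det) (hp : p ≠ 0) {q r : Fin 4} (hq : q ≠ 0)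
    (hr : r ≠ 0) {u : Fin 6 → ℝ} (hu : u ∈ cyclicSet η p) :
    fluxJac η p q u * fluxJac η p r u = fluxJac η p r u * fluxJac η p q u := by
  have hU : u ∈ regularSet η p := cyclicSet_subset hη hdet hp hu
  have hcom : ∀ {q : Fin 4}, q ≠ 0 → Commute (η⁻¹ * hessMat η q (flux η p q u)) (η⁻¹ * hessMat η p u) := by
    intro q hq
    refine commute_of_comm_eq_zero (comm_eq_zero_of_coords hη (hessMat_isSymm _ _ _) (hessMat_isSymm _ _ _) ?_)
    rw [← congruence_eq hη hdet hp hq]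
    exact funext ((congruence_eq_zero_iff hη q hU _).2 rfl)
  have hqr := commute_of_commute hu (hcom hq) (hcom hr)
  have hjac : ∀ {q : Fin 4}, q ≠ 0 → ∀ x, ⁅η⁻¹ * hessMat η p u, η⁻¹ * symMat (fluxJac η p q u *ᵥ x)⁆ =
      ⁅η⁻¹ * hessMat η q (flux η p q u), η⁻¹ * symMat x⁆ := by
    intro q hq x
    refine lie_eq_of_coords hη (hessMat_isSymm _ _ _) (symMat_isSymm _) (hessMat_isSymm _ _ _) (symMat_isSymm _) ?_
    rw [← psi_mulVec hη hdet hp, ← psi_mulVec hη hdet hq, fluxJac, mulVec_mulVec,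
      mul_nonsing_inv_cancel_left _ _ hU]
  have hq' := hcom hq
  have hr' := hcom hr
  have jq := fun x => hjac hq x
  have jr := fun x => hjac hr x
  generalize η⁻¹ * hessMat η q (flux η p q u) = Q at hqr hq' jq
  generalize η⁻¹ * hessMat η r (flux η p r u) = R at hqr hr' jr
  have hlie : ∀ P A B : Matrix (Fin 4) (Fin 4) ℝ, Commute A B → ⁅A, ⁅B, P⁆⁆ = ⁅B, ⁅A, P⁆⁆ := by
    intro P A B h
    simp only [Ring.lie_def, mul_sub, sub_mul, ← mul_assoc, h.eq]
    simp only [mul_assoc, h.eq]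
    abel
  refine Matrix.ext_of_mulVec_single fun i => ?_
  generalize (Pi.single i 1 : Fin 6 → ℝ) = x
  rw [← mulVec_mulVec, ← mulVec_mulVec, ← sub_eq_zero]
  set z := fluxJac η p q u *ᵥ fluxJac η p r u *ᵥ x with hz
  set z' := fluxJac η p r u *ᵥ fluxJac η p q u *ᵥ x with hz'
  -- The two sides are [Q,[R,η⁻¹S(x)]] and [R,[Q,η⁻¹S(x)]].
  have h1 : ⁅η⁻¹ * hessMat η p u, ⁅η⁻¹ * hessMat η p u, η⁻¹ * symMat z⁆⁆ =
      ⁅η⁻¹ * hessMat η p u, ⁅η⁻¹ * hessMat η p u, η⁻¹ * symMat z'⁆⁆ := by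
    rw [hz, hz', jq, jr, ← hlie _ _ _ hq', ← hlie _ _ _ hr', jq, jr, hlie _ _ _ hqr]
  have hsub : symMat (z - z') = symMat z - symMat z' := by
    rw [sub_eq_add_neg, symMat_add, ← neg_one_smul ℝ, symMat_smul, neg_one_smul, ← sub_eq_add_neg]
  have h2 : Commute ⁅η⁻¹ * hessMat η p u, η⁻¹ * symMat (z - z')⁆ (η⁻¹ * hessMat η p u) := by
    have h3 : ⁅η⁻¹ * hessMat η p u, ⁅η⁻¹ * hessMat η p u, η⁻¹ * symMat (z - z')⁆⁆ = 0 := by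
      rw [hsub, mul_sub]
      simp only [Ring.lie_def, mul_sub, sub_mul] at h1 ⊢
      rw [← sub_eq_zero] at h1
      rw [← h1]
      abel
    rw [Ring.lie_def, sub_eq_zero] at h3
    exact h3.symm
  have hE := inv_isSymm hη
  have h4 : ∀ A B : Matrix (Fin 4) (Fin 4) ℝ, η * ⁅η⁻¹ * A, η⁻¹ * B⁆ = comm η⁻¹ A B := by
    intro A B
    rw [Ring.lie_def, mul_sub, comm, Matrix.mul_assoc, Matrix.mul_assoc η⁻¹ B, mul_nonsing_inv_cancel_left _ _ hdet,
      mul_nonsing_inv_cancel_left _ _ hdet, Matrix.mul_assoc, Matrix.mul_assoc]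
  -- The inner bracket commutes with P, so it is a polynomial in P and hence self-adjoint for η. Yet
  -- η times a bracket of η-self-adjoint matrices is skew, so the bracket vanishes.
  have h5 := selfAdjoint_of_commute (G := η) hu (by
    rw [transpose_mul, hE.eq, (hessMat_isSymm η p u).eq, nonsing_inv_mul_cancel_right _ _ hdet,
      mul_nonsing_inv_cancel_left _ _ hdet]) h2
  have h6 := comm_skew hE (hessMat_isSymm η p u) (symMat_isSymm (z - z'))
  rw [← h4, transpose_mul, hη.eq, h5, h4] at h6
  have h7 : comm η⁻¹ (hessMat η p u) (symMat (z - z')) = 0 := by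
    ext i j
    have := congrFun (congrFun h6 i) j
    rw [Matrix.neg_apply] at this
    rw [Matrix.zero_apply]
    linarith
  by_contra hne
  have h8 : (psi η p u).det = 0 := exists_mulVec_eq_zero_iff.1 ⟨z - z', hne, by
    rw [psi_mulVec hη hdet hp, h7]
    rfl⟩
  exact hU.ne_zero h8

/-- Both products are continuous on the regular set, and the cyclic points are dense in it. -/
lemma fluxJac_commute (hη : η.IsSymm) (hdet : IsUnit η.det) (hp : p ≠ 0) {q r : Fin 4} (hq : q ≠ 0)
    (hr : r ≠ 0) {u : Fin 6 → ℝ} (hu : u ∈ regularSet η p) :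
    fluxJac η p q u * fluxJac η p r u = fluxJac η p r u * fluxJac η p q u := by
  have hinv : ContinuousOn (fun u => (psi η p u)⁻¹) (regularSet η p) := by
    simp only [inv_def, Ring.inverse_eq_inv']
    exact ((continuous_psi η p).matrix_det.continuousOn.inv₀ fun u hu => IsUnit.ne_zero hu).smul
      (continuous_psi η p).matrix_adjugate.continuousOn
  have hmul : ∀ {A B : (Fin 6 → ℝ) → Matrix (Fin 6) (Fin 6) ℝ}, ContinuousOn A (regularSet η p) →
      ContinuousOn B (regularSet η p) → ContinuousOn (fun u => A u * B u) (regularSet η p) := by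
    intro A B hA hB
    exact (continuous_fst.matrix_mul continuous_snd).comp_continuousOn (hA.prodMk hB)
  have hflux : ∀ q, ContinuousOn (flux η p q) (regularSet η p) := by
    intro q
    have hc : Continuous fun u : Fin 6 → ℝ => omega η q *ᵥ u + xi η p q :=
      (Continuous.matrix_mulVec continuous_const continuous_id).add continuous_const
    exact (continuous_fst.matrix_mulVec continuous_snd).comp_continuousOn (hinv.prodMk hc.continuousOn)
  have hjac : ∀ q, ContinuousOn (fluxJac η p q) (regularSet η p) := fun q =>
    hmul hinv ((continuous_psi η q).comp_continuousOn (hflux q))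
  have hcl : u ∈ closure (cyclicSet η p) := dense_cyclicSet hη hdet hp u
  have hcont := (hmul (hjac q) (hjac r)).sub (hmul (hjac r) (hjac q))
  have h0 : Filter.Tendsto (fun u => fluxJac η p q u * fluxJac η p r u - fluxJac η p r u * fluxJac η p q u)
      (nhdsWithin u (cyclicSet η p)) (nhds (fluxJac η p q u * fluxJac η p r u - fluxJac η p r u * fluxJac η p q u)) :=
    ((hcont u hu).mono (cyclicSet_subset hη hdet hp)).tendsto
  have : (nhdsWithin u (cyclicSet η p)).NeBot := mem_closure_iff_nhdsWithin_neBot.1 hcl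
  refine sub_eq_zero.1 (tendsto_nhds_unique h0 (tendsto_const_nhds.congr' ?_))
  filter_upwards [self_mem_nhdsWithin] with v hv
  rw [fluxJac_commute_of_cyclic hη hdet hp hq hr hv, sub_self]

end WDVV
end

noncomputable section
namespace WDVV

open Matrix

variable {η : Matrix (Fin 4) (Fin 4) ℝ} {p q : Fin 4}

/-! ### Solutions of the WDVV equations -/

lemma hessMat_field {c : Fin 4 → Fin 4 → Fin 4 → ℝ} (h₁ : ∀ α β γ, c α β γ = c β α γ)
    (h₂ : ∀ α β γ, c α β γ = c α γ β) (h₀ : ∀ α β, c 0 α β = η α β) (p : Fin 4) :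
    hessMat η p (field c p) = of (c p) := by
  have e0 : ∀ i, c p 0 i = η p i := fun i => by rw [h₁, h₀]
  have e1 : ∀ i, c p i 0 = η p i := fun i => by rw [h₂, e0]
  ext i j
  fin_cases i <;> fin_cases j <;> simp [hessMat, baseMat, symMat, field, lo, hi, e0, e1] <;> exact h₂ _ _ _

/-- Total symmetry of `c` puts the contracted indices next to η⁻¹, so the contractions become matrix
products. -/
lemma wdvv_eq (hη : η.IsSymm) {c : Fin 4 → Fin 4 → Fin 4 → ℝ} (h₁ : ∀ α β γ, c α β γ = c β α γ)
    (h₂ : ∀ α β γ, c α β γ = c α γ β) (p q β ν : Fin 4) :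
    wdvv η c p β q ν = comm η⁻¹ (of (c p)) (of (c q)) β ν := by
  have hE : ∀ i j, η⁻¹ j i = η⁻¹ i j := fun i j => congrFun (congrFun (inv_isSymm hη) i) j
  have e : ∀ a b β ν, (of (c a) * η⁻¹ * of (c b)) β ν = ∑ l, ∑ m, η⁻¹ l m * (c l a β * c m b ν) := by
    intro a b β ν
    simp only [mul_apply, of_apply, Finset.sum_mul]
    rw [Finset.sum_comm]
    refine Finset.sum_congr rfl fun l _ => Finset.sum_congr rfl fun m _ => ?_
    rw [h₂ a β l, h₁ a l β, h₁ b m ν]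
    ring
  rw [comm, Matrix.sub_apply, e, e, wdvv]
  simp only [mul_sub, Finset.sum_sub_distrib]
  congr 1
  rw [Finset.sum_comm]
  refine Finset.sum_congr rfl fun l _ => Finset.sum_congr rfl fun m _ => ?_
  rw [hE]
  ring

lemma congruence_eq_wdvv (hη : η.IsSymm) (hdet : IsUnit η.det) (hp : p ≠ 0) (hq : q ≠ 0)
    {c : Fin 4 → Fin 4 → Fin 4 → ℝ} (h₁ : ∀ α β γ, c α β γ = c β α γ) (h₂ : ∀ α β γ, c α β γ = c α γ β)
    (h₀ : ∀ α β, c 0 α β = η α β) (γ : Fin 6) :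
    congruence η p q (field c p) (field c q) γ = wdvv η c p (bt γ) q (hi γ) := by
  rw [congruence_eq hη hdet hp hq, hessMat_field h₁ h₂ h₀, hessMat_field h₁ h₂ h₀, wdvv_eq hη h₁ h₂, coords]

lemma contDiffOn_pd {M : Set (Fin 4 → ℝ)} (hM : IsOpen M) {G : (Fin 4 → ℝ) → ℝ} {k : ℕ}
    (hG : ContDiffOn ℝ (k + 1 : ℕ) G M) (i : Fin 4) : ContDiffOn ℝ k (pd i G) M :=
  (hG.fderiv_of_isOpen hM (m := k) (by norm_cast)).clm_apply contDiffOn_const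

lemma pd_comm {M : Set (Fin 4 → ℝ)} (hM : IsOpen M) {G : (Fin 4 → ℝ) → ℝ} (hG : ContDiffOn ℝ 2 G M) {t : Fin 4 → ℝ}
    (ht : t ∈ M) (i j : Fin 4) : pd i (pd j G) t = pd j (pd i G) t := by
  have hGt : ContDiffAt ℝ 2 G t := hG.contDiffAt (hM.mem_nhds ht)
  have hd : DifferentiableAt ℝ (fderiv ℝ G) t :=
    (hGt.fderiv_right (m := 1) (by norm_num)).differentiableAt one_ne_zero
  have h : ∀ i j, pd i (pd j G) t = fderiv ℝ (fderiv ℝ G) t (Pi.single i 1) (Pi.single j 1) := by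
    intro i j
    change fderiv ℝ (fun t => fderiv ℝ G t (Pi.single j 1)) t (Pi.single i 1) = _
    rw [fderiv_clm_apply hd (by fun_prop)]
    simp
  rw [h, h]
  exact (hGt.isSymmSndFDerivAt (by simp)) _ _

lemma pd_congr {M : Set (Fin 4 → ℝ)} (hM : IsOpen M) {G H : (Fin 4 → ℝ) → ℝ} (h : ∀ t ∈ M, G t = H t)
    {t : Fin 4 → ℝ} (ht : t ∈ M) (i : Fin 4) : pd i G t = pd i H t := by
  have : G =ᶠ[nhds t] H := by filter_upwards [hM.mem_nhds ht] with s hs using h s hs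
  rw [pd, pd, this.fderiv_eq]

lemma third_symm {M : Set (Fin 4 → ℝ)} (hM : IsOpen M) {F : (Fin 4 → ℝ) → ℝ} (hF : ContDiffOn ℝ 4 F M)
    {t : Fin 4 → ℝ} (ht : t ∈ M) (α β γ : Fin 4) :
    third F t α β γ = third F t β α γ ∧ third F t α β γ = third F t α γ β := by
  have h3 : ContDiffOn ℝ 3 (pd γ F) M := contDiffOn_pd (k := 3) hM hF γ
  refine ⟨pd_comm hM (h3.of_le (by norm_num)) ht α β, ?_⟩
  exact pd_congr hM (fun s hs => pd_comm hM (hF.of_le (by norm_num)) hs β γ) ht α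

lemma flux_of_solution (hη : η.IsSymm) (hdet : IsUnit η.det) (hp : p ≠ 0) (hq : q ≠ 0) {M : Set (Fin 4 → ℝ)}
    {F : (Fin 4 → ℝ) → ℝ} (hF : IsWDVVSolution η M F) {t : Fin 4 → ℝ} (ht : t ∈ M)
    (hu : field (third F t) p ∈ regularSet η p) : field (third F t) q = flux η p q (field (third F t) p) := by
  obtain ⟨hM, hC, hW⟩ := hF
  rw [← congruence_eq_zero_iff hη q hu]
  intro γ
  rw [congruence_eq_wdvv hη hdet hp hq (fun α β γ => (third_symm hM hC ht α β γ).1)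
    (fun α β γ => (third_symm hM hC ht α β γ).2) (hW t ht).1]
  exact (hW t ht).2 _ _ _ _

/-- Equality of mixed derivatives gives ∂_q u_p = ∂_p u_q; the algebraic relation then replaces u_q
by the flux. -/
lemma conservation_of_solution (hη : η.IsSymm) (hdet : IsUnit η.det) (hp : p ≠ 0) (hq : q ≠ 0)
    {M : Set (Fin 4 → ℝ)} {F : (Fin 4 → ℝ) → ℝ} (hF : IsWDVVSolution η M F) {t : Fin 4 → ℝ} (ht : t ∈ M)
    (hu : field (third F t) p ∈ regularSet η p) (I : Fin 6) :
    pd q (fun s => field (third F s) p I) t = pd p (fun s => flux η p q (field (third F s) p) I) t := by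
  have hM := hF.1
  have hC := hF.2.1
  have h2 : ContDiffOn ℝ 2 (pd (lo I) (pd (hi I) F)) M :=
    contDiffOn_pd (k := 2) hM (contDiffOn_pd (k := 3) hM hC _) _
  have hcont : ContinuousAt (fun s => field (third F s) p) t := by
    refine continuousAt_pi.2 fun J => ?_
    have : ContDiffOn ℝ 1 (pd p (pd (lo J) (pd (hi J) F))) M :=
      contDiffOn_pd (k := 1) hM (contDiffOn_pd (k := 2) hM (contDiffOn_pd (k := 3) hM hC _) _) _
    exact this.continuousOn.continuousAt (hM.mem_nhds ht)
  -- The relation is about to be differentiated, so it is needed near `t`; openness of the regular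
  -- set and continuity of u_p provide this.
  have hev : (fun s => field (third F s) q I) =ᶠ[nhds t] fun s => flux η p q (field (third F s) p) I := by
    filter_upwards [hM.mem_nhds ht, hcont.preimage_mem_nhds ((isOpen_regularSet η p).mem_nhds hu)] with s hs hs'
    rw [flux_of_solution hη hdet hp hq hF hs hs']
  have h : pd p (fun s => flux η p q (field (third F s) p) I) t = pd p (fun s => field (third F s) q I) t := by
    rw [pd, pd, hev.fderiv_eq]
  rw [h]
  exact pd_comm hM h2 ht q p

end WDVV
end

noncomputable section
namespace WDVV

open Matrix

variable {η : Matrix (Fin 4) (Fin 4) ℝ} {p : Fin 4}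

/-! ### The Monge metric -/

lemma monge_eq (η : Matrix (Fin 4) (Fin 4) ℝ) (p : Fin 4) (u : Fin 6 → ℝ) :
    monge η p u = (psi η p u)ᵀ * (phi η * psi η p u) := by
  ext i j
  simp only [monge, of_apply, mul_apply, transpose_apply, Finset.mul_sum]
  exact Finset.sum_congr rfl fun α _ => Finset.sum_congr rfl fun β _ => by ring

lemma psiC_eq (η : Matrix (Fin 4) (Fin 4) ℝ) (γ i k : Fin 6) :
    psiC η γ i k = psiForm η (Pi.single i 1) (Pi.single k 1) γ := by
  simp [psiForm, Pi.single_apply]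

lemma psiC_skew (hη : η.IsSymm) (γ i k : Fin 6) : psiC η γ i k = -psiC η γ k i := by
  rw [psiC_eq, psiC_eq, psiForm_skew hη, Pi.neg_apply]

/-- The pairing `φ_{αβ} ψ^α_{sk} ψ^β_m`. -/
def phiPair (η : Matrix (Fin 4) (Fin 4) ℝ) (p : Fin 4) (u : Fin 6 → ℝ) (s k m : Fin 6) : ℝ :=
  ∑ α, ∑ β, phi η α β * psiC η α s k * psi η p u β m

lemma phiPair_skew (hη : η.IsSymm) (u : Fin 6 → ℝ) (s k m : Fin 6) :
    phiPair η p u s k m = -phiPair η p u k s m := by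
  simp only [phiPair, psiC_skew hη _ s k, mul_neg, neg_mul, Finset.sum_neg_distrib]

lemma phiPair_eq (η : Matrix (Fin 4) (Fin 4) ℝ) (p : Fin 4) (u : Fin 6 → ℝ) (s k m : Fin 6) : phiPair η p u s k m =
    phi η *ᵥ (psi η p u *ᵥ Pi.single m 1) ⬝ᵥ psiForm η (Pi.single s 1) (Pi.single k 1) := by
  rw [mulVec_single_one]
  simp only [phiPair, psiC_eq, mulVec, dotProduct, Finset.sum_mul, col_apply]
  refine Finset.sum_congr rfl fun α _ => Finset.sum_congr rfl fun β _ => ?_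
  ring

lemma phiPair_cyclic (hη : η.IsSymm) (hdet : IsUnit η.det) (hp : p ≠ 0) (u : Fin 6 → ℝ) (s k m : Fin 6) :
    phiPair η p u s k m + phiPair η p u k m s + phiPair η p u m s k = 0 := by
  rw [phiPair_eq, phiPair_eq, phiPair_eq]
  have h := phi_cyclic hη hdet hp u (Pi.single m 1) (Pi.single s 1) (Pi.single k 1)
  linarith

lemma hasFDerivAt_psi (η : Matrix (Fin 4) (Fin 4) ℝ) (p : Fin 4) (γ i : Fin 6) (u : Fin 6 → ℝ) :
    HasFDerivAt (fun w => psi η p w γ i)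
      (∑ k, psiC η γ i k • ContinuousLinearMap.proj (R := ℝ) (φ := fun _ : Fin 6 => ℝ) k) u := by
  have h : HasFDerivAt (fun w : Fin 6 → ℝ => ∑ k, psiC η γ i k * w k)
      (∑ k, psiC η γ i k • ContinuousLinearMap.proj (R := ℝ) (φ := fun _ : Fin 6 => ℝ) k) u :=
    HasFDerivAt.fun_sum fun k _ => (hasFDerivAt_apply k u).const_mul (psiC η γ i k)
  exact h.add_const _

lemma entryD_monge (hη : η.IsSymm) (u : Fin 6 → ℝ) (s m k : Fin 6) :
    entryD (monge η p) s m k u = phiPair η p u s k m + phiPair η p u m k s := by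
  have h : HasFDerivAt (fun w => monge η p w s m) (∑ α, ∑ β,
      ((phi η α β * psi η p u α s) • (∑ k, psiC η β m k • ContinuousLinearMap.proj (R := ℝ) (φ := fun _ : Fin 6 => ℝ) k) +
      psi η p u β m • (phi η α β • ∑ k, psiC η α s k • ContinuousLinearMap.proj (R := ℝ) (φ := fun _ : Fin 6 => ℝ) k))) u := by
    simp only [monge, of_apply]
    exact HasFDerivAt.fun_sum fun α _ => HasFDerivAt.fun_sum fun β _ =>
      ((hasFDerivAt_psi η p α s u).const_mul (phi η α β)).mul (hasFDerivAt_psi η p β m u)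
  have hs : ∀ (f : Fin 6 → ℝ), ∑ x, f x * (Pi.single k 1 : Fin 6 → ℝ) x = f k := fun f => by
    simp [Pi.single_apply]
  have hsym : ∀ α β, phi η β α = phi η α β := fun α β => congrFun (congrFun (phi_isSymm hη) α) β
  rw [entryD, h.fderiv]
  simp only [_root_.sum_apply, _root_.add_apply, _root_.smul_apply, ContinuousLinearMap.proj_apply,
    smul_eq_mul, hs, Finset.sum_add_distrib]
  rw [add_comm]
  refine congrArg₂ _ ?_ ?_
  · exact Finset.sum_congr rfl fun α _ => Finset.sum_congr rfl fun β _ => by ring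
  · rw [phiPair, Finset.sum_comm]
    exact Finset.sum_congr rfl fun α _ => Finset.sum_congr rfl fun β _ => by rw [hsym]; ring

lemma isUnit_det_monge (hη : η.IsSymm) (hdet : IsUnit η.det) {u : Fin 6 → ℝ} (hu : u ∈ regularSet η p) :
    IsUnit (monge η p u).det := by
  have hu' : IsUnit (psi η p u).det := hu
  rw [monge_eq, det_mul, det_mul, det_transpose]
  exact hu'.mul ((isUnit_det_phi hη hdet).mul hu')

/-- In the Monge identity the six product-rule terms cancel in pairs by skew-symmetry of ψ^γ_{ik}
alone; the cyclic identity is not needed here. -/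
lemma isMongeMetric_monge (hη : η.IsSymm) (hdet : IsUnit η.det) :
    IsMongeMetric (regularSet η p) (monge η p) := by
  intro u hu
  refine ⟨?_, isUnit_det_monge hη hdet hu, fun m k s => ?_⟩
  · rw [IsSymm, monge_eq, transpose_mul, transpose_mul, transpose_transpose, (phi_isSymm hη).eq, Matrix.mul_assoc]
  · rw [entryD_monge hη, entryD_monge hη, entryD_monge hη, phiPair_skew hη u s m k, phiPair_skew hη u k m s,
      phiPair_skew hη u s k m]
    ring

/-- The cyclic identity merges the four product-rule terms into three copies of a single one, which
absorbs the factor 1/3. -/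
lemma cLow_monge (hη : η.IsSymm) (hdet : IsUnit η.det) (hp : p ≠ 0) (u : Fin 6 → ℝ) (s k m : Fin 6) :
    cLow (monge η p) s k m u = phiPair η p u m k s := by
  rw [cLow, entryD_monge hη, entryD_monge hη]
  have h := phiPair_cyclic hη hdet hp u s k m
  have h1 := phiPair_skew (p := p) hη u s m k
  have h2 := phiPair_skew (p := p) hη u k m s
  linarith

/-- The derivative of `ψ` in the direction `w`. -/
def psiDir (η : Matrix (Fin 4) (Fin 4) ℝ) (w : Fin 6 → ℝ) : Matrix (Fin 6) (Fin 6) ℝ :=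
  of fun γ i => ∑ k, psiC η γ i k * w k

/-- Contracted with `w`, the connection coefficients form the matrix -f⁻¹(∂_wψ)ᵀψ⁻ᵀ. With `w = u_x`
this cancels the derivative of ψᵀ when the first-order factor acts on ψᵀa, leaving ψ⁻¹φ⁻¹Da. -/
lemma sum_cUp_monge (hη : η.IsSymm) (hdet : IsUnit η.det) (hp : p ≠ 0) {u : Fin 6 → ℝ} (hu : u ∈ regularSet η p)
    (w : Fin 6 → ℝ) (i j : Fin 6) : ∑ k, cUp (monge η p) i j k u * w k =
      -((monge η p u)⁻¹ * (psiDir η w)ᵀ * ((psi η p u)ᵀ)⁻¹) i j := by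
  have hu' : IsUnit (psi η p u).det := hu
  have hg := isUnit_det_monge hη hdet hu
  have hsymm : ((monge η p u)⁻¹)ᵀ = (monge η p u)⁻¹ := by
    rw [transpose_nonsing_inv, (isMongeMetric_monge hη hdet u hu).1.eq]
  have h1 : ((psi η p u)ᵀ)⁻¹ = phi η * psi η p u * (monge η p u)⁻¹ := by
    have ht : IsUnit ((psi η p u)ᵀ).det := by rwa [det_transpose]
    have h2 : (psi η p u)ᵀ * (phi η * psi η p u * (monge η p u)⁻¹) = 1 := by
      rw [← Matrix.mul_assoc, ← monge_eq, mul_nonsing_inv _ hg]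
    exact inv_eq_right_inv h2
  have h3 : ∀ a b, ∑ k, cLow (monge η p) b a k u * w k = -((psiDir η w)ᵀ * (phi η * psi η p u)) a b := by
    intro a b
    have hc : ∀ k, cLow (monge η p) b a k u = -phiPair η p u a k b := fun k =>
      (cLow_monge hη hdet hp u b a k).trans (phiPair_skew hη u k a b)
    simp only [hc, phiPair, mul_apply, transpose_apply, psiDir, of_apply,
      Finset.sum_mul, Finset.mul_sum, neg_mul, Finset.sum_neg_distrib]
    rw [Finset.sum_comm]
    refine congrArg Neg.neg (Finset.sum_congr rfl fun α _ => ?_)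
    rw [Finset.sum_comm]
    exact Finset.sum_congr rfl fun k _ => Finset.sum_congr rfl fun β _ => by ring
  have h4 : ∑ k, cUp (monge η p) i j k u * w k =
      ∑ b, (∑ a, (monge η p u)⁻¹ i a * ∑ k, cLow (monge η p) b a k u * w k) * (monge η p u)⁻¹ b j := by
    have hs : ∀ b, (monge η p u)⁻¹ b j = (monge η p u)⁻¹ j b := fun b => congrFun (congrFun hsymm j) b
    simp only [cUp, Finset.sum_mul, Finset.mul_sum, hs]
    rw [Finset.sum_comm]
    refine Finset.sum_congr rfl fun b _ => ?_
    rw [Finset.sum_comm]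
    exact Finset.sum_congr rfl fun a _ => Finset.sum_congr rfl fun k _ => by ring
  rw [h4, h1]
  simp only [h3]
  have h5 : (monge η p u)⁻¹ * (psiDir η w)ᵀ * (phi η * psi η p u * (monge η p u)⁻¹) =
      (monge η p u)⁻¹ * ((psiDir η w)ᵀ * (phi η * psi η p u)) * (monge η p u)⁻¹ := by
    simp only [Matrix.mul_assoc]
  rw [h5, mul_apply, ← Finset.sum_neg_distrib]
  refine Finset.sum_congr rfl fun b _ => ?_
  rw [mul_apply, Finset.sum_mul, Finset.sum_mul, ← Finset.sum_neg_distrib]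
  exact Finset.sum_congr rfl fun a _ => by ring

/-- The first-order factor in terms of `ψ` and `φ`. -/
lemma innerOp_monge (hη : η.IsSymm) (hdet : IsUnit η.det) (hp : p ≠ 0) (d : ℕ) {z : Jet 6}
    (hz : z.2 d ∈ regularSet η p) (P : Fin 6 → Jet 6 → ℝ) {a b y : Fin 6 → ℝ}
    (ha : (psi η p (z.2 d))ᵀ *ᵥ a = fun j => P j z)
    (hb : (psiDir η (z.2 (d + 1)))ᵀ *ᵥ a + (psi η p (z.2 d))ᵀ *ᵥ b = fun j => totalD (P j) z)
    (hy : b = phi η *ᵥ (psi η p (z.2 d) *ᵥ y)) (i : Fin 6) : innerOp d (monge η p) P i z = y i := by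
  have ht : IsUnit ((psi η p (z.2 d))ᵀ).det := by
    rw [det_transpose]
    exact hz
  have hg := isUnit_det_monge hη hdet hz
  have h1 : innerOp d (monge η p) P i z = ((monge η p (z.2 d))⁻¹ *ᵥ (fun j => totalD (P j) z)) i -
      (((monge η p (z.2 d))⁻¹ * (psiDir η (z.2 (d + 1)))ᵀ * ((psi η p (z.2 d))ᵀ)⁻¹) *ᵥ fun j => P j z) i := by
    simp only [innerOp, sum_cUp_monge hη hdet hp hz, Finset.sum_add_distrib, neg_mul, Finset.sum_neg_distrib]
    rfl
  have h2 : ((psi η p (z.2 d))ᵀ)⁻¹ *ᵥ ((psi η p (z.2 d))ᵀ *ᵥ a) = a := by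
    rw [mulVec_mulVec, nonsing_inv_mul _ ht, one_mulVec]
  have h3 : (monge η p (z.2 d))⁻¹ *ᵥ ((psi η p (z.2 d))ᵀ *ᵥ (phi η *ᵥ (psi η p (z.2 d) *ᵥ y))) = y := by
    rw [mulVec_mulVec y, mulVec_mulVec y, ← monge_eq, mulVec_mulVec, nonsing_inv_mul _ hg, one_mulVec]
  rw [h1, ← ha, ← hb, hy, mulVec_add, ← mulVec_mulVec, ← mulVec_mulVec, h2, h3, Pi.add_apply, add_sub_cancel_left]

end WDVV
end

noncomputable section
namespace WDVV

open Matrix diffAlg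

variable {η : Matrix (Fin 4) (Fin 4) ℝ} {p : Fin 4}

/-! ### The operator on the algebra of differential functions -/

/-- A constant matrix over the algebra `R`. -/
abbrev cst (R : Type*) [CommRing R] [Algebra ℝ R] {m n : Type*} (A : Matrix m n ℝ) : Matrix m n R :=
  A.map (algebraMap ℝ R)

/-- The bilinear map `ψ_{··}` over `R`. -/
def psiFormA {R : Type*} [CommRing R] [Algebra ℝ R] (η : Matrix (Fin 4) (Fin 4) ℝ) (x y : Fin 6 → R) : Fin 6 → R :=
  fun γ => ∑ i, ∑ k, algebraMap ℝ R (psiC η γ i k) * x i * y k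

/-- The matrix `ψ(u)` over `R`. -/
def psiA {R : Type*} [CommRing R] [Algebra ℝ R] (η : Matrix (Fin 4) (Fin 4) ℝ) (p : Fin 4) (u : Fin 6 → R) :
    Matrix (Fin 6) (Fin 6) R :=
  of fun γ i => ∑ k, algebraMap ℝ R (psiC η γ i k) * u k + algebraMap ℝ R (omega η p γ i)

section Algebra

variable {R : Type*} [CommRing R] [Algebra ℝ R]

lemma derivation_psiFormA (δ : Derivation ℝ R R) (x y : Fin 6 → R) :
    δ ∘ psiFormA η x y = psiFormA η (δ ∘ x) y + psiFormA η x (δ ∘ y) := by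
  funext γ
  simp only [psiFormA, Function.comp_apply, map_sum, Derivation.leibniz, Derivation.map_algebraMap, smul_eq_mul,
    mul_zero, add_zero, Pi.add_apply, ← Finset.sum_add_distrib]
  exact Finset.sum_congr rfl fun i _ => Finset.sum_congr rfl fun k _ => by ring

lemma derivation_psiA_mulVec (δ : Derivation ℝ R R) (u y : Fin 6 → R) :
    (psiA η p u).map δ *ᵥ y = psiFormA η y (δ ∘ u) := by
  funext γ
  simp only [mulVec, dotProduct, psiA, psiFormA, map_apply, of_apply, map_add, map_sum, Derivation.leibniz,
    Derivation.map_algebraMap, smul_eq_mul, mul_zero, add_zero, Finset.sum_mul, Function.comp_apply]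
  exact Finset.sum_congr rfl fun i _ => Finset.sum_congr rfl fun k _ => by ring

lemma psiA_mulVec (u x : Fin 6 → R) : psiA η p u *ᵥ x = psiFormA η x u + cst R (omega η p) *ᵥ x := by
  funext γ
  simp only [mulVec, dotProduct, psiA, of_apply, psiFormA, Pi.add_apply, add_mul, Finset.sum_add_distrib,
    Finset.sum_mul, map_apply]
  congr 1
  exact Finset.sum_congr rfl fun i _ => Finset.sum_congr rfl fun k _ => by ring

lemma psiFormA_skew (hη : η.IsSymm) (x y : Fin 6 → R) : psiFormA η x y = -psiFormA η y x := by
  funext γ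
  simp only [psiFormA, Pi.neg_apply, ← Finset.sum_neg_distrib]
  rw [Finset.sum_comm]
  refine Finset.sum_congr rfl fun i _ => Finset.sum_congr rfl fun k _ => ?_
  rw [psiC_skew hη, map_neg]
  ring

variable (f : R →ₐ[ℝ] ℝ)

lemma map_psiFormA (x y : Fin 6 → R) : f ∘ psiFormA η x y = psiForm η (f ∘ x) (f ∘ y) := by
  funext γ
  simp only [psiFormA, psiForm, Function.comp_apply, map_sum, map_mul, AlgHom.commutes, Algebra.algebraMap_self,
    RingHom.id_apply]

lemma map_psiA (u : Fin 6 → R) : (psiA η p u).map f = psi η p (f ∘ u) := by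
  ext γ i
  simp only [psiA, psi, map_apply, of_apply, Function.comp_apply, map_sum, map_mul, map_add, AlgHom.commutes,
    Algebra.algebraMap_self, RingHom.id_apply]

lemma map_mulVec_comp {m n : Type*} [Fintype n] (A : Matrix m n R) (x : n → R) :
    f ∘ (A *ᵥ x) = A.map f *ᵥ (f ∘ x) :=
  funext fun i => RingHom.map_mulVec f.toRingHom A x i

lemma map_cst {m n : Type*} (A : Matrix m n ℝ) : (cst R A).map f = A := by
  ext i j
  simp

lemma map_dotProduct {n : Type*} [Fintype n] (x y : n → R) : f (x ⬝ᵥ y) = f ∘ x ⬝ᵥ f ∘ y :=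
  RingHom.map_dotProduct f.toRingHom x y

end Algebra

/-- The field variables as differential functions. -/
def fieldA (η : Matrix (Fin 4) (Fin 4) ℝ) (p : Fin 4) (d k : ℕ) : Fin 6 → diffAlg d (regularSet η p) :=
  coord d (regularSet η p) k

lemma eval_fieldA (d k : ℕ) (z : Jet 6) (hz : z ∈ jetDomain d (regularSet η p)) :
    eval z hz ∘ fieldA η p d k = z.2 k := rfl

lemma D_fieldA (d k : ℕ) : (jets d (isOpen_regularSet η p)).D ∘ fieldA η p d k = fieldA η p d (k + 1) :=
  funext fun i => D_coord (isOpen_regularSet η p) k i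

/-- The regular set is exactly where the determinant is nonzero, so ψ⁻¹ has entries in the algebra.
-/
lemma isUnit_det_psiA (η : Matrix (Fin 4) (Fin 4) ℝ) (p : Fin 4) (d : ℕ) :
    IsUnit (psiA η p (fieldA η p d d)).det := by
  refine isUnit_of_eval_ne_zero _ fun z hz => ?_
  have h : eval z hz (psiA η p (fieldA η p d d)).det = ((psiA η p (fieldA η p d d)).map (eval z hz)).det :=
    RingHom.map_det (eval z hz).toRingHom _
  rw [h, map_psiA, eval_fieldA]
  exact IsUnit.ne_zero hz

lemma innerOp_eq_eval (hη : η.IsSymm) (hdet : IsUnit η.det) (hp : p ≠ 0) (d : ℕ) {P : Fin 6 → Jet 6 → ℝ}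
    (hP : ∀ j, IsDiffFun d (regularSet η p) (P j)) {a y : Fin 6 → diffAlg d (regularSet η p)}
    (ha : (psiA η p (fieldA η p d d))ᵀ *ᵥ a = fun j => ofFn (P j) (hP j))
    (hy : (jets d (isOpen_regularSet η p)).D ∘ a = cst _ (phi η) *ᵥ (psiA η p (fieldA η p d d) *ᵥ y))
    (z : Jet 6) (hz : z ∈ jetDomain d (regularSet η p)) (i : Fin 6) :
    innerOp d (monge η p) P i z = eval z hz (y i) := by
  have ht : ∀ (A : Matrix (Fin 6) (Fin 6) (diffAlg d (regularSet η p))), Aᵀ.map (eval z hz) = (A.map (eval z hz))ᵀ :=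
    fun A => rfl
  refine innerOp_monge hη hdet hp d hz P (a := eval z hz ∘ a) (b := eval z hz ∘ ((jets d (isOpen_regularSet η p)).D ∘ a))
    (y := eval z hz ∘ y) ?_ ?_ ?_ i
  · have h := congrArg (eval z hz ∘ ·) ha
    simp only [map_mulVec_comp, ht, map_psiA, eval_fieldA] at h
    exact h
  · have h := congrArg (fun v => eval z hz ∘ ((jets d (isOpen_regularSet η p)).D ∘ v)) ha
    have h2 : (jets d (isOpen_regularSet η p)).D ∘ (fun j => ofFn (P j) (hP j)) =
        fun j => ofFn (totalD (P j)) ((hP j).totalD (isOpen_regularSet η p)) := funext fun j => D_ofFn _ _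
    have h3 : ∀ v w : Fin 6 → diffAlg d (regularSet η p), eval z hz ∘ (v + w) = eval z hz ∘ v + eval z hz ∘ w :=
      fun v w => funext fun i => map_add _ _ _
    have h4 : ((psiA η p (fieldA η p d d)).map (jets d (isOpen_regularSet η p)).D).map (eval z hz) = psiDir η (z.2 (d + 1)) := by
      ext γ j
      simp only [psiA, psiDir, map_apply, of_apply, map_add, map_sum, Derivation.leibniz, Derivation.map_algebraMap,
        smul_eq_mul, mul_zero, add_zero, map_mul, AlgHom.commutes, Algebra.algebraMap_self, RingHom.id_apply]
      refine Finset.sum_congr rfl fun k _ => ?_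
      rw [fieldA, D_coord, eval_coord]
    have h5 : (psiA η p (fieldA η p d d))ᵀ.map (jets d (isOpen_regularSet η p)).D =
        ((psiA η p (fieldA η p d d)).map (jets d (isOpen_regularSet η p)).D)ᵀ := rfl
    simp only [derivation_mulVec, h2, h3, map_mulVec_comp, ht, h5, map_psiA, eval_fieldA, h4] at h
    exact h
  · have h := congrArg (eval z hz ∘ ·) hy
    simp only [map_mulVec_comp, map_psiA, eval_fieldA, map_cst] at h
    exact h

/-- The intermediate functions `a = ψ⁻ᵀ D P` and `y = ψ⁻¹ φ⁻¹ D a`. -/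
lemma exists_chain (hη : η.IsSymm) (hdet : IsUnit η.det) (P : Fin 6 → diffAlg 0 (regularSet η p)) :
    ∃ a y, (jets 0 (isOpen_regularSet η p)).Chain (psiA η p (fieldA η p 0 0)) (cst _ (phi η)) P a y := by
  have hu := isUnit_det_psiA η p 0
  have ht : IsUnit ((psiA η p (fieldA η p 0 0))ᵀ).det := by rwa [det_transpose]
  have hφ : cst (diffAlg 0 (regularSet η p)) (phi η) * cst _ (phi η)⁻¹ = 1 := by
    rw [← Matrix.map_mul, mul_nonsing_inv _ (isUnit_det_phi hη hdet), Matrix.map_one _ (map_zero _) (map_one _)]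
  let a := ((psiA η p (fieldA η p 0 0))ᵀ)⁻¹ *ᵥ ((jets 0 (isOpen_regularSet η p)).D ∘ P)
  refine ⟨a, (psiA η p (fieldA η p 0 0))⁻¹ *ᵥ (cst _ (phi η)⁻¹ *ᵥ ((jets 0 (isOpen_regularSet η p)).D ∘ a)), ?_, ?_⟩
  · rw [mulVec_mulVec, mul_nonsing_inv _ ht, one_mulVec]
  · rw [mulVec_mulVec (M := psiA η p (fieldA η p 0 0)), mul_nonsing_inv _ hu, one_mulVec, mulVec_mulVec, hφ, one_mulVec]

lemma thirdOrderOp_eq (hη : η.IsSymm) (hdet : IsUnit η.det) (hp : p ≠ 0) {P : Fin 6 → Jet 6 → ℝ}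
    (hP : ∀ j, IsDiffFun 0 (regularSet η p) (P j)) {a y : Fin 6 → diffAlg 0 (regularSet η p)}
    (h : (jets 0 (isOpen_regularSet η p)).Chain (psiA η p (fieldA η p 0 0)) (cst _ (phi η)) (fun j => ofFn (P j) (hP j)) a y)
    (z : Jet 6) (hz : z ∈ jetDomain 0 (regularSet η p)) (i : Fin 6) :
    thirdOrderOp (monge η p) P i z = eval z hz ((jets 0 (isOpen_regularSet η p)).D (y i)) := by
  have hD : (jets 0 (isOpen_regularSet η p)).D ∘ (fun j => ofFn (P j) (hP j)) =
      fun j => ofFn (totalD (P j)) ((hP j).totalD (isOpen_regularSet η p)) := funext fun j => D_ofFn _ _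
  have h1 := innerOp_eq_eval hη hdet hp 0 (fun j => (hP j).totalD (isOpen_regularSet η p)) (h.left.trans hD) h.right
  obtain ⟨s, hs, hy⟩ := exists_ofFn (y i)
  rw [hy, D_ofFn, eval_ofFn, thirdOrderOp]
  refine totalD_congr (isOpen_regularSet η p) (fun w hw => ?_) z hz
  rw [h1 w hw, hy, eval_ofFn]

lemma bracket_eq (hη : η.IsSymm) (hdet : IsUnit η.det) (hp : p ≠ 0) {f g : Jet 6 → ℝ}
    (hf : IsDiffFun 0 (regularSet η p) f) (hg : IsDiffFun 0 (regularSet η p) g)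
    {a y : Fin 6 → diffAlg 0 (regularSet η p)}
    (h : (jets 0 (isOpen_regularSet η p)).Chain (psiA η p (fieldA η p 0 0)) (cst _ (phi η))
      ((jets 0 (isOpen_regularSet η p)).euler (ofFn g hg)) a y) (z : Jet 6) (hz : z ∈ jetDomain 0 (regularSet η p)) :
    bracket (thirdOrderOp (monge η p)) f g z =
      eval z hz ((jets 0 (isOpen_regularSet η p)).euler (ofFn f hf) ⬝ᵥ ((jets 0 (isOpen_regularSet η p)).D ∘ y)) := by
  have he : (jets 0 (isOpen_regularSet η p)).euler (ofFn g hg) = fun j => ofFn (varD g j) (isDiffFun_varD (isOpen_regularSet η p) hg j) :=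
    funext fun j => euler_ofFn _ _ _
  rw [he] at h
  rw [map_dotProduct, bracket, dotProduct]
  refine Finset.sum_congr rfl fun i _ => ?_
  rw [thirdOrderOp_eq hη hdet hp _ h z hz, varD_eq (isOpen_regularSet η p) hf i z hz]
  rfl

lemma evolD_fieldA (X : Fin 6 → diffAlg 0 (regularSet η p)) :
    (jets 0 (isOpen_regularSet η p)).evolD X ∘ fieldA η p 0 0 = X := by
  funext j
  rw [Function.comp_apply, (jets 0 (isOpen_regularSet η p)).evolD_eq_sum X (N := 1)]
  · simp [fieldA, pd_coord]
  · intro k hk i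
    rw [fieldA, pd_coord, if_neg]
    omega

/-- The operator is Hamiltonian. -/
theorem isHamiltonianOperator_monge (hη : η.IsSymm) (hdet : IsUnit η.det) (hp : p ≠ 0) :
    IsHamiltonianOperator (regularSet η p) (thirdOrderOp (monge η p)) := by
  have hφ : cst (diffAlg 0 (regularSet η p)) (phi η)⁻¹ * cst _ (phi η) = 1 := by
    rw [← Matrix.map_mul, nonsing_inv_mul _ (isUnit_det_phi hη hdet), Matrix.map_one _ (map_zero _) (map_one _)]
  have hs : ((phi η)⁻¹).IsSymm := by rw [IsSymm, transpose_nonsing_inv, (phi_isSymm hη).eq]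
  refine ⟨fun f g hf hg => ?_, fun f g h hf hg hh => ?_⟩
  · obtain ⟨a, x, ha⟩ := exists_chain hη hdet ((jets 0 (isOpen_regularSet η p)).euler (ofFn f hf))
    obtain ⟨b, y, hb⟩ := exists_chain hη hdet ((jets 0 (isOpen_regularSet η p)).euler (ofFn g hg))
    refine isNullFunctional_of_fnl (isOpen_regularSet η p) ((jets 0 (isOpen_regularSet η p)).fnl_bracket_skew hφ hs ha hb) fun z hz => ?_
    rw [map_add, bracket_eq hη hdet hp hf hg hb z hz, bracket_eq hη hdet hp hg hf ha z hz]
  · obtain ⟨a, x, ha⟩ := exists_chain hη hdet ((jets 0 (isOpen_regularSet η p)).euler (ofFn f hf))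
    obtain ⟨b, y, hb⟩ := exists_chain hη hdet ((jets 0 (isOpen_regularSet η p)).euler (ofFn g hg))
    obtain ⟨c, w, hc⟩ := exists_chain hη hdet ((jets 0 (isOpen_regularSet η p)).euler (ofFn h hh))
    -- The Jacobi identity takes variational derivatives of brackets, so each inner bracket must
    -- itself be recognised as an element of the algebra.
    have hbr : ∀ {f g : Jet 6 → ℝ} (hf : IsDiffFun 0 (regularSet η p) f) (hg : IsDiffFun 0 (regularSet η p) g)
        {a y : Fin 6 → diffAlg 0 (regularSet η p)}, (jets 0 (isOpen_regularSet η p)).Chain (psiA η p (fieldA η p 0 0))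
          (cst _ (phi η)) ((jets 0 (isOpen_regularSet η p)).euler (ofFn g hg)) a y →
        ∃ hd : IsDiffFun 0 (regularSet η p) (bracket (thirdOrderOp (monge η p)) f g),
          ofFn _ hd = (jets 0 (isOpen_regularSet η p)).euler (ofFn f hf) ⬝ᵥ ((jets 0 (isOpen_regularSet η p)).D ∘ y) := by
      intro f g hf hg a y hch
      have hd : IsDiffFun 0 (regularSet η p) (bracket (thirdOrderOp (monge η p)) f g) :=
        (isDiffFun_fn ((jets 0 (isOpen_regularSet η p)).euler (ofFn f hf) ⬝ᵥ ((jets 0 (isOpen_regularSet η p)).D ∘ y))).congr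
          fun z hz => by rw [bracket_eq hη hdet hp hf hg hch z hz, eval_eq_fn]
      exact ⟨hd, diffAlg.ext fun z hz => bracket_eq hη hdet hp hf hg hch z hz⟩
    obtain ⟨hfg, efg⟩ := hbr hf hg hb
    obtain ⟨hgh, egh⟩ := hbr hg hh hc
    obtain ⟨hhf, ehf⟩ := hbr hh hf ha
    refine isNullFunctional_of_fnl (isOpen_regularSet η p) ((jets 0 (isOpen_regularSet η p)).fnl_jacobi hφ hs (B := psiFormA η)
      (fun X y => ?_) (psiFormA_skew hη) (derivation_psiFormA _) (fun x y w => ?_) ha hb hc) fun z hz => ?_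
    · rw [derivation_psiA_mulVec, evolD_fieldA]
    -- Evaluation at jets separates elements of the algebra, so the cyclic identity over ℝ suffices.
    · refine diffAlg.ext fun z hz => ?_
      simp only [map_add, map_dotProduct, map_mulVec_comp, map_psiA, map_psiFormA, map_cst, map_zero]
      exact phi_cyclic hη hdet hp _ _ _ _
    · rw [map_add, map_add, bracket_eq hη hdet hp hfg hh hc z hz, bracket_eq hη hdet hp hgh hf ha z hz,
        bracket_eq hη hdet hp hhf hg hb z hz, efg, egh, ehf]

end WDVV
end

noncomputable section
namespace WDVV

open Matrix diffAlg

variable {η : Matrix (Fin 4) (Fin 4) ℝ} {p q : Fin 4}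

/-! ### The Hamiltonians -/

section Algebra

variable {R : Type*} [CommRing R] [Algebra ℝ R]

/-- The constant vector `ξ` over `R`. -/
def xiA (R : Type*) [CommRing R] [Algebra ℝ R] (η : Matrix (Fin 4) (Fin 4) ℝ) (p q : Fin 4) : Fin 6 → R :=
  fun γ => algebraMap ℝ R (xi η p q γ)

lemma derivation_xiA (δ : Derivation ℝ R R) : δ ∘ xiA R η p q = 0 :=
  funext fun _ => Derivation.map_algebraMap _ _

lemma map_xiA (f : R →ₐ[ℝ] ℝ) : f ∘ xiA R η p q = xi η p q :=
  funext fun _ => AlgHom.commutes _ _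

/-- The density of the Hamiltonian in terms of the potential `b`, the field `u` and the space variable `x`. -/
def hamDensity (η : Matrix (Fin 4) (Fin 4) ℝ) (p q : Fin 4) (b u : Fin 6 → R) (x : R) : R :=
  -- Homotopy formula: each term of the desired variational derivative, paired with `b`, is divided
  -- by its total degree in `b` and `u = b_x`, which is 3, 2, 2, 1. The explicit `x` appears because
  -- the constant ξ has primitive xξ.
  (1 / 3 : ℝ) • (cst R (phi η) *ᵥ psiFormA η b u ⬝ᵥ cst R (omega η q) *ᵥ b) +
    (1 / 2 : ℝ) • (x * (cst R (phi η) *ᵥ psiFormA η b u ⬝ᵥ xiA R η p q)) +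
    ((1 / 2 : ℝ) • (cst R (phi η) *ᵥ (cst R (omega η p) *ᵥ b) ⬝ᵥ cst R (omega η q) *ᵥ b) +
    x * (cst R (phi η) *ᵥ (cst R (omega η p) *ᵥ b) ⬝ᵥ xiA R η p q))

lemma psiFormA_zero_left (y : Fin 6 → R) : psiFormA η 0 y = 0 := by
  funext γ
  simp [psiFormA]

lemma psiFormA_zero_right (y : Fin 6 → R) : psiFormA η y 0 = 0 := by
  funext γ
  simp [psiFormA]

/-- The partial derivatives of the density along the potential. -/
lemma derivation_hamDensity_potential (δ : Derivation ℝ R R) {b u e : Fin 6 → R} {x : R} (hb : δ ∘ b = e)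
    (hu : δ ∘ u = 0) (hx : δ x = 0) :
    δ (hamDensity η p q b u x) =
      (1 / 3 : ℝ) • (cst R (phi η) *ᵥ psiFormA η e u ⬝ᵥ cst R (omega η q) *ᵥ b +
        cst R (phi η) *ᵥ psiFormA η b u ⬝ᵥ cst R (omega η q) *ᵥ e) +
      (1 / 2 : ℝ) • (x * (cst R (phi η) *ᵥ psiFormA η e u ⬝ᵥ xiA R η p q)) +
      ((1 / 2 : ℝ) • (cst R (phi η) *ᵥ (cst R (omega η p) *ᵥ e) ⬝ᵥ cst R (omega η q) *ᵥ b +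
        cst R (phi η) *ᵥ (cst R (omega η p) *ᵥ b) ⬝ᵥ cst R (omega η q) *ᵥ e) +
      x * (cst R (phi η) *ᵥ (cst R (omega η p) *ᵥ e) ⬝ᵥ xiA R η p q)) := by
  simp only [hamDensity, map_add, Derivation.map_smul, Derivation.leibniz, smul_eq_mul, derivation_dotProduct,
    JetCalculus.D_comp_const_mulVec, derivation_psiFormA, derivation_xiA, hb, hu, hx, psiFormA_zero_right,
    add_zero, mul_zero, dotProduct_zero]

/-- The partial derivatives of the density along the field. -/
lemma derivation_hamDensity_field (δ : Derivation ℝ R R) {b u e : Fin 6 → R} {x : R} (hb : δ ∘ b = 0)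
    (hu : δ ∘ u = e) (hx : δ x = 0) :
    δ (hamDensity η p q b u x) =
      (1 / 3 : ℝ) • (cst R (phi η) *ᵥ psiFormA η b e ⬝ᵥ cst R (omega η q) *ᵥ b) +
      (1 / 2 : ℝ) • (x * (cst R (phi η) *ᵥ psiFormA η b e ⬝ᵥ xiA R η p q)) := by
  simp only [hamDensity, map_add, Derivation.map_smul, Derivation.leibniz, smul_eq_mul, derivation_dotProduct,
    JetCalculus.D_comp_const_mulVec, derivation_psiFormA, derivation_xiA, hb, hu, hx, psiFormA_zero_left,
    add_zero, zero_add, mul_zero, mulVec_zero, dotProduct_zero, zero_dotProduct, smul_zero]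

lemma derivation_hamDensity_eq_zero (δ : Derivation ℝ R R) {b u : Fin 6 → R} {x : R} (hb : δ ∘ b = 0)
    (hu : δ ∘ u = 0) (hx : δ x = 0) : δ (hamDensity η p q b u x) = 0 := by
  rw [derivation_hamDensity_field δ hb hu hx, psiFormA_zero_right, mulVec_zero, zero_dotProduct, zero_dotProduct,
    mul_zero, smul_zero, smul_zero, add_zero]

end Algebra

lemma phi_mulVec_dotProduct (hη : η.IsSymm) (v w : Fin 6 → ℝ) : phi η *ᵥ v ⬝ᵥ w = phi η *ᵥ w ⬝ᵥ v := by
  rw [dotProduct_comm, dotProduct_mulVec, ← mulVec_transpose, (phi_isSymm hη).eq]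

lemma psi_transpose_mulVec_phi_dotProduct (hη : η.IsSymm) (a x u : Fin 6 → ℝ) (c : ℝ) (e : Fin 6 → ℝ) :
    (psi η p u)ᵀ *ᵥ (phi η *ᵥ (a + c • x)) ⬝ᵥ e =
      phi η *ᵥ psiForm η e u ⬝ᵥ a + phi η *ᵥ (omega η p *ᵥ e) ⬝ᵥ a +
      c * (phi η *ᵥ psiForm η e u ⬝ᵥ x + phi η *ᵥ (omega η p *ᵥ e) ⬝ᵥ x) := by
  rw [transpose_mulVec_dotProduct, phi_mulVec_dotProduct hη, psi_mulVec_eq, mulVec_add, add_dotProduct, dotProduct_add, dotProduct_add,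
    dotProduct_smul, dotProduct_smul, smul_eq_mul, smul_eq_mul]
  ring

/-- The variational derivative of the density. -/
lemma euler_hamDensity (hη : η.IsSymm) (hdet : IsUnit η.det) (hp : p ≠ 0) (hq : q ≠ 0) :
    (jets 1 (isOpen_regularSet η p)).euler
        (-hamDensity η p q (fieldA η p 1 0) (fieldA η p 1 1) (var 1 (regularSet η p))) =
      (psiA η p (fieldA η p 1 1))ᵀ *ᵥ -(cst _ (phi η) *ᵥ
        (cst _ (omega η q) *ᵥ fieldA η p 1 0 + var 1 (regularSet η p) • xiA _ η p q)) := by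
  have hpd : ∀ k i, (jets 1 (isOpen_regularSet η p)).pd k i ∘ fieldA η p 1 k = Pi.single i 1 := by
    intro k i
    funext j
    rw [Function.comp_apply, fieldA, pd_coord]
    simp [Pi.single_apply]
  have hpd0 : ∀ k l i, l ≠ k → (jets 1 (isOpen_regularSet η p)).pd k i ∘ fieldA η p 1 l = 0 := by
    intro k l i h
    funext j
    rw [Function.comp_apply, fieldA, pd_coord, if_neg fun h' => h h'.1, Pi.zero_apply]
  funext i
  have h0 : ∀ k, 2 ≤ k → ∀ i, (jets 1 (isOpen_regularSet η p)).pd k i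
      (-hamDensity η p q (fieldA η p 1 0) (fieldA η p 1 1) (var 1 (regularSet η p))) = 0 := by
    intro k hk i
    rw [map_neg, derivation_hamDensity_eq_zero _ (hpd0 k 0 i (by omega)) (hpd0 k 1 i (by omega)) (pd_var _ _ _),
      neg_zero]
  have hcst : (jets 1 (isOpen_regularSet η p)).D ∘ (Pi.single i 1 : Fin 6 → diffAlg 1 (regularSet η p)) = 0 := by
    funext j
    rcases eq_or_ne j i with rfl | h <;> simp [*]
  rw [JetCalculus.euler_eq_sum _ h0, Finset.sum_range_succ, Finset.sum_range_one, Function.iterate_zero, Function.iterate_one,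
    id, map_neg, map_neg,
    derivation_hamDensity_potential ((jets 1 (isOpen_regularSet η p)).pd 0 i) (hpd 0 i) (hpd0 0 1 i one_ne_zero) (pd_var _ _ _),
    derivation_hamDensity_field ((jets 1 (isOpen_regularSet η p)).pd 1 i) (hpd0 1 0 i zero_ne_one) (hpd 1 i) (pd_var _ _ _)]
  simp only [map_add, map_neg, Derivation.map_smul, Derivation.leibniz, smul_eq_mul, derivation_dotProduct,
    JetCalculus.D_comp_const_mulVec, derivation_psiFormA, derivation_xiA, hcst, D_fieldA, D_var,
    psiFormA_zero_right, add_zero, zero_add, dotProduct_zero, mul_one]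
  refine diffAlg.ext fun z hz => ?_
  have he : eval z hz ∘ (Pi.single i 1 : Fin 6 → diffAlg 1 (regularSet η p)) = Pi.single i 1 := by
    funext j
    rcases eq_or_ne j i with rfl | h <;> simp [*]
  have hr : eval z hz (((psiA η p (fieldA η p 1 1))ᵀ *ᵥ -(cst _ (phi η) *ᵥ
        (cst _ (omega η q) *ᵥ fieldA η p 1 0 + var 1 (regularSet η p) • xiA _ η p q))) i) =
      -((psi η p (z.2 1))ᵀ *ᵥ (phi η *ᵥ (omega η q *ᵥ z.2 0 + z.1 • xi η p q)) ⬝ᵥ Pi.single i 1) := by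
    rw [dotProduct_single_one, mulVec_neg, Pi.neg_apply, map_neg, neg_inj]
    have ht : (psiA η p (fieldA η p 1 1))ᵀ.map (eval z hz) = ((psiA η p (fieldA η p 1 1)).map (eval z hz))ᵀ := rfl
    have ha : eval z hz ∘ (cst _ (omega η q) *ᵥ fieldA η p 1 0 + var 1 (regularSet η p) • xiA _ η p q) =
        omega η q *ᵥ z.2 0 + z.1 • xi η p q := by
      have : eval z hz ∘ (cst _ (omega η q) *ᵥ fieldA η p 1 0 + var 1 (regularSet η p) • xiA _ η p q) =
        eval z hz ∘ (cst _ (omega η q) *ᵥ fieldA η p 1 0) +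
          eval z hz (var 1 (regularSet η p)) • (eval z hz ∘ xiA _ η p q) :=
        funext fun _ => by simp
      rw [this, map_mulVec_comp, map_cst, eval_fieldA, map_xiA, eval_var]
    have h := congrFun (map_mulVec_comp (eval z hz) (psiA η p (fieldA η p 1 1))ᵀ (cst _ (phi η) *ᵥ
        (cst _ (omega η q) *ᵥ fieldA η p 1 0 + var 1 (regularSet η p) • xiA _ η p q))) i
    rw [Function.comp_apply] at h
    rw [h, ht, map_psiA, map_mulVec_comp, map_cst, eval_fieldA, ha]
  rw [hr, psi_transpose_mulVec_phi_dotProduct hη]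
  simp only [map_add, map_neg, map_smul, map_mul, map_pow, map_one, map_dotProduct, map_mulVec_comp, map_psiFormA,
    map_cst, map_xiA, eval_fieldA, he, eval_var, smul_eq_mul]
  -- The cubic terms differ from the target by a multiple of the cyclic identity for ω_q. The
  -- asymmetry of the ω_p, ω_q term is balanced by the ξ term that arises when D falls on `x`.
  have h1 := phi_cyclic_omega hη hdet hq (z.2 0) (Pi.single i 1) (z.2 1)
  have h2 := phi_omega_omega hη hdet hp hq (z.2 0) (Pi.single i 1)
  rw [phi_mulVec_dotProduct hη, phi_mulVec_dotProduct hη (omega η q *ᵥ Pi.single i 1),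
    phi_mulVec_dotProduct hη (omega η q *ᵥ z.2 1), psiForm_skew hη (z.2 1) (z.2 0), mulVec_neg, neg_dotProduct] at h1
  rw [phi_mulVec_dotProduct hη (xi η p q)] at h2
  rw [psiForm_skew hη (z.2 1) (Pi.single i 1), mulVec_neg, neg_dotProduct, neg_dotProduct]
  linear_combination (1 / 3) * h1 - (1 / 2) * h2

/-- The flux over the algebra of differential functions. -/
def fluxA (η : Matrix (Fin 4) (Fin 4) ℝ) (p q : Fin 4) (d : ℕ) : Fin 6 → diffAlg d (regularSet η p) :=
  (psiA η p (fieldA η p d d))⁻¹ *ᵥ (cst _ (omega η q) *ᵥ fieldA η p d d + xiA _ η p q)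

lemma psiA_mulVec_fluxA (d : ℕ) :
    psiA η p (fieldA η p d d) *ᵥ fluxA η p q d = cst _ (omega η q) *ᵥ fieldA η p d d + xiA _ η p q := by
  rw [fluxA, mulVec_mulVec, mul_nonsing_inv _ (isUnit_det_psiA η p d), one_mulVec]

lemma eval_fluxA (d : ℕ) (z : Jet 6) (hz : z ∈ jetDomain d (regularSet η p)) :
    eval z hz ∘ fluxA η p q d = flux η p q (z.2 d) := by
  have h := congrArg (eval z hz ∘ ·) (psiA_mulVec_fluxA (η := η) (p := p) (q := q) d)
  have h3 : ∀ v w : Fin 6 → diffAlg d (regularSet η p), eval z hz ∘ (v + w) = eval z hz ∘ v + eval z hz ∘ w :=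
    fun v w => funext fun i => map_add _ _ _
  simp only [h3, map_mulVec_comp, map_psiA, eval_fieldA, map_cst, map_xiA] at h
  have hz' : IsUnit (psi η p (z.2 d)).det := hz
  rw [flux, ← h, mulVec_mulVec, nonsing_inv_mul _ hz', one_mulVec]

/-- The system with flux `V_q` is Hamiltonian. -/
theorem isHamiltonianSystem_flux (hη : η.IsSymm) (hdet : IsUnit η.det) (hp : p ≠ 0) (hq : q ≠ 0) :
    IsHamiltonianSystem (regularSet η p) (monge η p) (flux η p q) := by
  obtain ⟨h, hh, he⟩ :=
    exists_ofFn (-hamDensity η p q (fieldA η p 1 0) (fieldA η p 1 1) (var 1 (regularSet η p)))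
  have heu := euler_hamDensity hη hdet hp hq
  rw [he] at heu
  -- Here a = -φ(ω_q b + xξ), so Da = -φ(ω_q u + ξ) = φψ(u)(-V); the sign compensates the minus in
  -- the definition of a Hamiltonian system.
  have hin := innerOp_eq_eval hη hdet hp 1 (isDiffFun_varD (isOpen_regularSet η p) hh) (y := -fluxA η p q 1)
    (heu.symm.trans (funext fun j => euler_ofFn _ _ _)) (by
      have hn : ∀ v : Fin 6 → diffAlg 1 (regularSet η p),
          (jets 1 (isOpen_regularSet η p)).D ∘ (-v) = -((jets 1 (isOpen_regularSet η p)).D ∘ v) := fun v => funext fun i => map_neg _ _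
      have hx : (jets 1 (isOpen_regularSet η p)).D ∘
          (cst _ (omega η q) *ᵥ fieldA η p 1 0 + var 1 (regularSet η p) • xiA _ η p q) =
          cst _ (omega η q) *ᵥ fieldA η p 1 1 + xiA _ η p q := by
        rw [← D_fieldA 1 0, ← JetCalculus.D_comp_const_mulVec]
        funext i
        have := congrFun (derivation_xiA (η := η) (p := p) (q := q) (jets 1 (isOpen_regularSet η p)).D) i
        simp only [Function.comp_apply, Pi.zero_apply] at this
        simp [Derivation.leibniz, this, D_var]
      rw [hn, JetCalculus.D_comp_const_mulVec, hx, mulVec_neg, mulVec_neg, psiA_mulVec_fluxA])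
  refine ⟨h, hh, fun z hz i => ?_⟩
  obtain ⟨s, hs, hy⟩ := exists_ofFn (fluxA η p q 1 i)
  have hflux : ∀ w (hw : w ∈ jetDomain 1 (regularSet η p)), eval w hw (fluxA η p q 1 i) = flux η p q (w.2 1) i :=
    fun w hw => congrFun (eval_fluxA 1 w hw) i
  have h1 : totalD (fun y => flux η p q (y.2 1) i) z = eval z hz ((jets 1 (isOpen_regularSet η p)).D (fluxA η p q 1 i)) := by
    rw [hy, D_ofFn, eval_ofFn]
    refine totalD_congr (isOpen_regularSet η p) (fun w hw => ?_) z hz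
    rw [← hflux w hw, hy, eval_ofFn]
  obtain ⟨t, ht, hty⟩ := exists_ofFn (-fluxA η p q 1 i)
  have h2 : totalD (innerOp 1 (monge η p) (varD h) i) z =
      eval z hz ((jets 1 (isOpen_regularSet η p)).D (-fluxA η p q 1 i)) := by
    rw [hty, D_ofFn, eval_ofFn]
    refine totalD_congr (isOpen_regularSet η p) (fun w hw => ?_) z hz
    rw [hin w hw, Pi.neg_apply, hty, eval_ofFn]
  rw [h1, h2, map_neg, map_neg, neg_neg]

/-! ### The two systems commute -/

/-- Differentiate ψ(u)V = ω_q u + ξ. Skew-symmetry turns the derivative of ψ(u) applied to V into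
the missing part of ψ_q(V), by the symmetry of the congruence in u and V. -/
lemma psiA_mulVec_derivation_fluxA (hη : η.IsSymm) (d : ℕ)
    (δ : Derivation ℝ (diffAlg d (regularSet η p)) (diffAlg d (regularSet η p))) :
    psiA η p (fieldA η p d d) *ᵥ (δ ∘ fluxA η p q d) = psiA η q (fluxA η p q d) *ᵥ (δ ∘ fieldA η p d d) := by
  have h := congrArg (δ ∘ ·) (psiA_mulVec_fluxA (η := η) (p := p) (q := q) d)
  have h3 : ∀ v w : Fin 6 → diffAlg d (regularSet η p), δ ∘ (v + w) = δ ∘ v + δ ∘ w :=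
    fun v w => funext fun i => map_add _ _ _
  simp only [h3, derivation_mulVec, derivation_psiA_mulVec, derivation_xiA, derivation_map_algebraMap, zero_mulVec,
    zero_add, add_zero] at h
  rw [psiA_mulVec (p := q), psiFormA_skew hη, ← h]
  abel

lemma eval_derivation_fluxA (hη : η.IsSymm) (d : ℕ)
    (δ : Derivation ℝ (diffAlg d (regularSet η p)) (diffAlg d (regularSet η p))) (z : Jet 6)
    (hz : z ∈ jetDomain d (regularSet η p)) :
    eval z hz ∘ (δ ∘ fluxA η p q d) = fluxJac η p q (z.2 d) *ᵥ (eval z hz ∘ (δ ∘ fieldA η p d d)) := by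
  have h := congrArg (eval z hz ∘ ·) (psiA_mulVec_derivation_fluxA (q := q) hη d δ)
  simp only [map_mulVec_comp, map_psiA, eval_fieldA, eval_fluxA] at h
  have hz' : IsUnit (psi η p (z.2 d)).det := hz
  rw [fluxJac, ← mulVec_mulVec, ← h, mulVec_mulVec, nonsing_inv_mul _ hz', one_mulVec]

/-- The flows with fluxes `V_q` and `V_r` commute. -/
theorem systemsCommute_flux (hη : η.IsSymm) (hdet : IsUnit η.det) (hp : p ≠ 0) {r : Fin 4} (hq : q ≠ 0) (hr : r ≠ 0) :
    SystemsCommute (regularSet η p) (flux η p q) (flux η p r) := by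
  intro z hz i
  have hflux : ∀ q j w (hw : w ∈ jetDomain 0 (regularSet η p)),
      flux η p q (w.2 0) j = eval w hw (fluxA η p q 0 j) :=
    fun q j w hw => (congrFun (eval_fluxA 0 w hw) j).symm
  have hF : ∀ q j, IsDiffFun 0 (regularSet η p) (fun w => flux η p q (w.2 0) j) := fun q j =>
    (isDiffFun_fn (fluxA η p q 0 j)).congr fun w hw => by rw [hflux q j w hw, eval_eq_fn]
  have hofn : ∀ q j, ofFn _ (hF q j) = fluxA η p q 0 j := fun q j =>
    diffAlg.ext fun w hw => by rw [eval_ofFn, hflux q j w hw]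
  have hC : ∀ q j, IsDiffFun 0 (regularSet η p) (conservationLaw (flux η p q) j) := fun q j =>
    (hF q j).totalD (isOpen_regularSet η p)
  have hCo : ∀ q j, ofFn _ (hC q j) = (jets 0 (isOpen_regularSet η p)).D (fluxA η p q 0 j) := fun q j => by
    rw [← hofn, D_ofFn]
    rfl
  have hX : ∀ q, (fun j => ofFn _ (hC q j)) = (jets 0 (isOpen_regularSet η p)).D ∘ fluxA η p q 0 := fun q => funext (hCo q)
  -- Along the flow u_t = (V_q)_x the flux V_r changes by J_r J_q u_x, so commuting Jacobians make
  -- the two cross derivatives equal; applying D gives the bracket.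
  have key : (jets 0 (isOpen_regularSet η p)).evolD ((jets 0 (isOpen_regularSet η p)).D ∘ fluxA η p q 0) (fluxA η p r 0 i) =
      (jets 0 (isOpen_regularSet η p)).evolD ((jets 0 (isOpen_regularSet η p)).D ∘ fluxA η p r 0) (fluxA η p q 0 i) := by
    refine diffAlg.ext fun w hw => ?_
    have h1 := congrFun (eval_derivation_fluxA (q := r) hη 0
      ((jets 0 (isOpen_regularSet η p)).evolD ((jets 0 (isOpen_regularSet η p)).D ∘ fluxA η p q 0)) w hw) i
    have h2 := congrFun (eval_derivation_fluxA (q := q) hη 0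
      ((jets 0 (isOpen_regularSet η p)).evolD ((jets 0 (isOpen_regularSet η p)).D ∘ fluxA η p r 0)) w hw) i
    rw [evolD_fieldA, eval_derivation_fluxA hη 0 (jets 0 (isOpen_regularSet η p)).D, mulVec_mulVec] at h1 h2
    rw [fluxJac_commute hη hdet hp hq hr hw] at h2
    exact h1.trans h2.symm
  rw [evol_eq (isOpen_regularSet η p) (hC q) (hC r i) z hz, evol_eq (isOpen_regularSet η p) (hC r) (hC q i) z hz, hX, hX, hCo, hCo,
    JetCalculus.evolD_D, JetCalculus.evolD_D, key, sub_self]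

end WDVV
end

theorem mainTheorem7 (η : Matrix (Fin 4) (Fin 4) ℝ) (hη : η.IsSymm) (hdet : IsUnit η.det)
    (p : Fin 4) (hp : p ≠ 0) :
    -- the matrices `φ` and `ψ` are nondegenerate
    (IsUnit (WDVV.phi η).det ∧ IsOpen (WDVV.regularSet η p) ∧ Dense (WDVV.regularSet η p)) ∧
    -- the two linear line congruences, which consist of WDVV equations, become systems of conservation laws
    (∀ q : Fin 4, q ≠ 0 → q ≠ p →
      (∀ c : Fin 4 → Fin 4 → Fin 4 → ℝ, (∀ α β γ, c α β γ = c β α γ) → (∀ α β γ, c α β γ = c α γ β) →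
        (∀ α β, c 0 α β = η α β) → ∀ γ : Fin 6,
          WDVV.congruence η p q (WDVV.field c p) (WDVV.field c q) γ =
            WDVV.wdvv η c p (WDVV.bt γ) q (WDVV.hi γ)) ∧
      (∀ u ∈ WDVV.regularSet η p, ∀ v : Fin 6 → ℝ,
        (∀ γ, WDVV.congruence η p q u v γ = 0) ↔ v = WDVV.flux η p q u) ∧
      (∀ (M : Set (Fin 4 → ℝ)) (F : (Fin 4 → ℝ) → ℝ), WDVV.IsWDVVSolution η M F →
        ∀ t ∈ M, WDVV.field (WDVV.third F t) p ∈ WDVV.regularSet η p →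
          WDVV.field (WDVV.third F t) q = WDVV.flux η p q (WDVV.field (WDVV.third F t) p) ∧
          ∀ I : Fin 6, WDVV.pd q (fun s => WDVV.field (WDVV.third F s) p I) t =
            WDVV.pd p (fun s => WDVV.flux η p q (WDVV.field (WDVV.third F s) p) I) t)) ∧
    -- the two systems are Hamiltonian with respect to the same third-order Hamiltonian operator
    (WDVV.IsMongeMetric (WDVV.regularSet η p) (WDVV.monge η p) ∧
      WDVV.IsHamiltonianOperator (WDVV.regularSet η p) (WDVV.thirdOrderOp (WDVV.monge η p)) ∧
      ∀ q : Fin 4, q ≠ 0 → q ≠ p →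
        WDVV.IsHamiltonianSystem (WDVV.regularSet η p) (WDVV.monge η p) (WDVV.flux η p q)) ∧
    -- the two systems commute
    (∀ q₁ q₂ : Fin 4, q₁ ≠ 0 → q₁ ≠ p → q₂ ≠ 0 → q₂ ≠ p → q₁ ≠ q₂ →
      WDVV.SystemsCommute (WDVV.regularSet η p) (WDVV.flux η p q₁) (WDVV.flux η p q₂)) := by
  exact ⟨⟨WDVV.isUnit_det_phi hη hdet, WDVV.isOpen_regularSet η p, WDVV.dense_regularSet hη hdet hp⟩,
    fun q hq _ => ⟨fun c h₁ h₂ h₀ γ => WDVV.congruence_eq_wdvv hη hdet hp hq h₁ h₂ h₀ γ,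
      fun u hu v => WDVV.congruence_eq_zero_iff hη q hu v,
      fun M F hF t ht hu => ⟨WDVV.flux_of_solution hη hdet hp hq hF ht hu,
        fun I => WDVV.conservation_of_solution hη hdet hp hq hF ht hu I⟩⟩,
    ⟨WDVV.isMongeMetric_monge hη hdet, WDVV.isHamiltonianOperator_monge hη hdet hp,
      fun q hq _ => WDVV.isHamiltonianSystem_flux hη hdet hp hq⟩,
    fun q₁ q₂ h₁ _ h₂ _ _ => WDVV.systemsCommute_flux hη hdet hp h₁ h₂⟩
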